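/- Let $(M,\eta)$ be a contact manifold: $M$ is a smooth (Hausdorff, second countable) manifold of dimension $2n+1$ and $\eta$ a smooth $1$-form such that $\eta\wedge(\mathrm d\eta)^n$ vanishes nowhere. Let $\flat(v)=\iota_v\mathrm d\eta+\eta(v)\eta$, $\sharp=\flat^{-1}$, let $\mathcal R=\sharp\eta$ be the Reeb field, $\Lambda(\alpha,\beta)=-\mathrm d\eta(\sharp\alpha,\sharp\beta)$, and $\sharp_\Lambda(\alpha)=\Lambda(\alpha,\cdot)$. For a subspace $\Delta\subseteq T_xM$ with annihilator $\Delta^\circ$, the contact complement is $\Delta^{\perp}=\sharp_\Lambda(\Delta^\circ)$. An embedded submanifold $S$ is coisotropic if $TS^{\perp}\subseteq TS$ and Legendrian if $TS=TS^{\perp}$; an immersion $f:P\to M$ is Legendrian if $\mathrm df(T_pP)=\mathrm df(T_pP)^{\perp}$ for all $p\in P$, and the image of such an immersion (not necessarily injective, $P$ Hausdorff and second countable) is called an immersed Legendrian submanifold. Let $\iota:N\hookrightarrow M$ be a nonempty coisotropic embedded submanifold without horizontal points (at no $x\in N$ is $T_xN\subseteq\ker\eta_x$). Assume that the quotient $\tilde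 N$ of $N$ by the characteristic distribution $TN^{\perp}$ is a manifold, that is, $\tilde N$ is a smooth (Hausdorff, second countable) manifold and $\pi:N\to\tilde N$ is a surjective smooth submersion whose fibres are connected and satisfy $\ker T_x\pi=(T_xN)^{\perp}$ for all $x\in N$. Call a smooth $1$-form $\tilde\eta$ on $\tilde N$ a reduced form with factor $f$ if $f$ is a nowhere vanishing smooth function on $N$ and $\pi^*\tilde\eta=f\,\iota^*\eta$. Let $L\subseteq M$ be a Legendrian submanifold that meets $N$ cleanly: $N\cap L$ is an embedded submanifold (possibly with components of different dimensions) and $T(N\cap L)=TN\cap TL$. Then: 1. There is a reduced form on $\tilde N$, with some factor $f$. If every point of $N$ is vertical, that is, $T_xN=(T_xN\cap\ker\eta_x)\oplus\langle\mathcal R_x\rangle$ for all $x\in N$, then there is exactly one $1$-form $\tilde\eta$ on $\tilde N$ with $\pi^*\tilde\eta=\iota^*\eta$ (a reduced form with factor $1$). 2. For every reduced form $\tilde\eta$ on $\tilde N$ (in particular for every $\tilde\eta$ with $\pi^*\tilde\eta=\iota^*\eta$), $(\tilde N,\tilde\eta)$ is a contact manifold and $\tilde L=\pi(L\cap N)$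 is an immersed Legendrian submanifold of $(\tilde N,\tilde\eta)$. If $\tilde L$ is an embedded submanifold of $\tilde N$, then it is a Legendrian submanifold of $(\tilde N,\tilde\eta)$. -/

import Mathlib

open scoped Manifold ContDiff Topology

noncomputable section

namespace ContactReduction

/-! ### Linear algebra of one tangent space

`V` is a tangent space, `η` the value of the contact form and `Ω` the value of `dη`. -/

section Linear

variable {V : Type*} [AddCommGroup V] [Module ℝ V]

/-- Up to a positive constant factor, the value of `η ∧ Ω ∧ ... ∧ Ω` (`n` factors `Ω`)
at the vectors `v 0, ..., v (2 n)`. -/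
def wedgePow (n : ℕ) (η : Module.Dual ℝ V) (Ω : V →ₗ[ℝ] V →ₗ[ℝ] ℝ)
    (v : Fin (2 * n + 1) → V) : ℝ :=
  ∑ σ : Equiv.Perm (Fin (2 * n + 1)), ((Equiv.Perm.sign σ : ℤ) : ℝ) *
    (η (v (σ ⟨0, by omega⟩)) *
      ∏ i : Fin n, Ω (v (σ ⟨2 * (i : ℕ) + 1, by omega⟩)) (v (σ ⟨2 * (i : ℕ) + 2, by omega⟩)))

/-- `♭ v = ι_v Ω + η(v) η`. -/
def flat (η : Module.Dual ℝ V) (Ω : V →ₗ[ℝ] V →ₗ[ℝ] ℝ) : V →ₗ[ℝ] Module.Dual ℝ V :=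
  Ω + LinearMap.smulRight η η

open Classical in
/-- `♯ = ♭⁻¹` (with value `0` if `♭` is not invertible, which does not happen for contact forms). -/
def sharp (η : Module.Dual ℝ V) (Ω : V →ₗ[ℝ] V →ₗ[ℝ] ℝ) : Module.Dual ℝ V →ₗ[ℝ] V :=
  if h : Function.Bijective (flat η Ω) then
    ((LinearEquiv.ofBijective (flat η Ω) h).symm : Module.Dual ℝ V →ₗ[ℝ] V)
  else 0

/-- The Reeb vector, `♭ R = η`. -/
def reeb (η : Module.Dual ℝ V) (Ω : V →ₗ[ℝ] V →ₗ[ℝ] ℝ) : V := sharp η Ω η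

/-- The bivector `Λ(α, β) = - Ω(♯α, ♯β)`. -/
def bivector (η : Module.Dual ℝ V) (Ω : V →ₗ[ℝ] V →ₗ[ℝ] ℝ) :
    Module.Dual ℝ V →ₗ[ℝ] Module.Dual ℝ V →ₗ[ℝ] ℝ :=
  -(Ω.compl₁₂ (sharp η Ω) (sharp η Ω))

variable [Module.Finite ℝ V]

/-- `♯_Λ α = Λ(α, ·)`, an element of the bidual of `V`, read as a vector. -/
def sharpLambda (η : Module.Dual ℝ V) (Ω : V →ₗ[ℝ] V →ₗ[ℝ] ℝ) : Module.Dual ℝ V →ₗ[ℝ] V :=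
  ((Module.evalEquiv ℝ V).symm : Module.Dual ℝ (Module.Dual ℝ V) →ₗ[ℝ] V) ∘ₗ bivector η Ω

/-- The contact complement `Δ^⊥ = ♯_Λ(Δ°)`. -/
def complement (η : Module.Dual ℝ V) (Ω : V →ₗ[ℝ] V →ₗ[ℝ] ℝ) (Δ : Submodule ℝ V) :
    Submodule ℝ V :=
  Δ.dualAnnihilator.map (sharpLambda η Ω)

end Linear

/-! ### One-forms and contact forms on manifolds -/

/-- The model space `ℝ^m`. -/
abbrev Euc (m : ℕ) : Type := EuclideanSpace ℝ (Fin m)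

instance tangentSpaceFinite {m : ℕ} {M : Type*} [TopologicalSpace M] [ChartedSpace (Euc m) M]
    (x : M) : Module.Finite ℝ (TangentSpace (𝓡 m) x) :=
  inferInstanceAs (Module.Finite ℝ (Euc m))

section Forms

variable {m : ℕ} {M : Type*} [TopologicalSpace M] [ChartedSpace (Euc m) M]

/-- The expression of the one-form `η` in the chart at `x₀`: the pullback of `η` by the inverse
of that chart. -/
def chartForm (η : ∀ x : M, TangentSpace (𝓡 m) x →L[ℝ] ℝ) (x₀ : M) (e : Euc m) :
    Euc m →L[ℝ] ℝ :=
  (η ((extChartAt (𝓡 m) x₀).symm e)).comp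
    (mfderiv 𝓘(ℝ, Euc m) (𝓡 m) (extChartAt (𝓡 m) x₀).symm e)

/-- `η` is a smooth one-form. -/
def IsSmoothForm (η : ∀ x : M, TangentSpace (𝓡 m) x →L[ℝ] ℝ) : Prop :=
  ∀ x₀ : M, ContDiffOn ℝ ∞ (chartForm η x₀) (extChartAt (𝓡 m) x₀).target

/-- The derivative `A` of the chart expression of `η` at the point `x`, in the chart at `x`. -/
def chartDeriv (η : ∀ x : M, TangentSpace (𝓡 m) x →L[ℝ] ℝ) (x : M) :
    Euc m →L[ℝ] Euc m →L[ℝ] ℝ :=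
  fderiv ℝ (chartForm η x) (extChartAt (𝓡 m) x x)

/-- The exterior derivative of a one-form: `dη(v, w) = A(v)(w) - A(w)(v)` in the chart at `x`. -/
def extD (η : ∀ x : M, TangentSpace (𝓡 m) x →L[ℝ] ℝ) (x : M) :
    TangentSpace (𝓡 m) x →ₗ[ℝ] TangentSpace (𝓡 m) x →ₗ[ℝ] ℝ :=
  (LinearMap.mk₂ ℝ (fun v w : Euc m => chartDeriv η x v w - chartDeriv η x w v)
    (by intros; simp; ring) (by intros; simp; ring)
    (by intros; simp; ring) (by intros; simp; ring)).compl₁₂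
    (mfderiv (𝓡 m) 𝓘(ℝ, Euc m) (extChartAt (𝓡 m) x) x).toLinearMap
    (mfderiv (𝓡 m) 𝓘(ℝ, Euc m) (extChartAt (𝓡 m) x) x).toLinearMap

/-- `η` is a contact form: `M` has odd dimension `2 n + 1`, `η` is a smooth one-form, and
`η ∧ (dη)^n` vanishes at no point. -/
def IsContactForm (η : ∀ x : M, TangentSpace (𝓡 m) x →L[ℝ] ℝ) : Prop :=
  IsSmoothForm η ∧ ∃ n : ℕ, m = 2 * n + 1 ∧
    ∀ x : M, ∃ v : Fin (2 * n + 1) → TangentSpace (𝓡 m) x,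
      wedgePow n (η x).toLinearMap (extD η x) v ≠ 0

/-- The contact complement of a subspace of `T_x M`. -/
def contactCompl (η : ∀ x : M, TangentSpace (𝓡 m) x →L[ℝ] ℝ) (x : M)
    (Δ : Submodule ℝ (TangentSpace (𝓡 m) x)) : Submodule ℝ (TangentSpace (𝓡 m) x) :=
  complement (η x).toLinearMap (extD η x) Δ

/-- `Δ ⊆ T_x M` is horizontal: `Δ = Δ ∩ ker η`. -/
def IsHorizontal (η : ∀ x : M, TangentSpace (𝓡 m) x →L[ℝ] ℝ) (x : M)
    (Δ : Submodule ℝ (TangentSpace (𝓡 m) x)) : Prop :=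
  Δ = Δ ⊓ LinearMap.ker (η x).toLinearMap

/-- `Δ ⊆ T_x M` is vertical: `Δ = (Δ ∩ ker η) ⊕ ⟨R⟩` (the sum is direct since `η(R) = 1`). -/
def IsVertical (η : ∀ x : M, TangentSpace (𝓡 m) x →L[ℝ] ℝ) (x : M)
    (Δ : Submodule ℝ (TangentSpace (𝓡 m) x)) : Prop :=
  Δ = (Δ ⊓ LinearMap.ker (η x).toLinearMap) ⊔ Submodule.span ℝ {reeb (η x).toLinearMap (extD η x)}

/-! ### Submanifolds -/

/-- `S` is an embedded submanifold of `M`: near each of its points it is a linear slice in some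
smooth chart of `M`. Its components may have different dimensions. -/
def IsSubmanifold (m : ℕ) {M : Type*} [TopologicalSpace M] [ChartedSpace (Euc m) M]
    (S : Set M) : Prop :=
  ∀ x ∈ S, ∃ φ ∈ IsManifold.maximalAtlas (𝓡 m) ∞ M, x ∈ φ.source ∧
    ∃ W : Submodule ℝ (Euc m), ∀ y ∈ φ.source, y ∈ S ↔ φ y ∈ W

/-- The tangent space `T_x S`, spanned by the velocities at `x` of the smooth curves in `S`
(for a submanifold these velocities already form a subspace). -/
def tangentTo (m : ℕ) {M : Type*} [TopologicalSpace M] [ChartedSpace (Euc m) M]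
    (S : Set M) (x : M) : Submodule ℝ (TangentSpace (𝓡 m) x) :=
  Submodule.span ℝ {v | ∃ γ : ℝ → M, γ 0 = x ∧ ContMDiffAt 𝓘(ℝ, ℝ) (𝓡 m) ∞ γ 0 ∧
    (∀ᶠ t in 𝓝 (0 : ℝ), γ t ∈ S) ∧
    HasMFDerivAt 𝓘(ℝ, ℝ) (𝓡 m) γ 0 (ContinuousLinearMap.toSpanSingleton ℝ v)}

/-- `S` is a Legendrian (embedded) submanifold: `T S = (T S)^⊥`. -/
def IsLegendrian (η : ∀ x : M, TangentSpace (𝓡 m) x →L[ℝ] ℝ) (S : Set M) : Prop :=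
  IsSubmanifold m S ∧ ∀ x ∈ S, tangentTo m S x = contactCompl η x (tangentTo m S x)

/-- `S` is a Legendrian immersed submanifold: the image of an immersion `f` of a manifold `P`
such that the subspaces `df(T_p P)` are equal to their contact complements. -/
def IsImmersedLegendrian (η : ∀ x : M, TangentSpace (𝓡 m) x →L[ℝ] ℝ) (S : Set M) : Prop :=
  ∃ (k : ℕ) (P : Type) (_ : TopologicalSpace P) (_ : ChartedSpace (Euc k) P),
    m = 2 * k + 1 ∧ IsManifold (𝓡 k) ∞ P ∧ T2Space P ∧ SecondCountableTopology P ∧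
    ∃ f : P → M, Manifold.IsImmersion (𝓡 k) (𝓡 m) ∞ f ∧ Set.range f = S ∧
      ∀ p : P, LinearMap.range (mfderiv (𝓡 k) (𝓡 m) f p).toLinearMap =
        contactCompl η (f p) (LinearMap.range (mfderiv (𝓡 k) (𝓡 m) f p).toLinearMap)

end Forms

/-! ### Coisotropic submanifolds and their reduction -/

section Reduction

variable {m d r : ℕ}
  {M : Type*} [TopologicalSpace M] [ChartedSpace (Euc m) M]
  {N : Type*} [TopologicalSpace N] [ChartedSpace (Euc d) N]
  {Q : Type*} [TopologicalSpace Q] [ChartedSpace (Euc r) Q]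

/-- The tangent space of the submanifold `ι : N → M` at `ι x`, as a subspace of `T_{ι x} M`. -/
def tangentOf (ι : N → M) (x : N) : Submodule ℝ (TangentSpace (𝓡 m) (ι x)) :=
  LinearMap.range (mfderiv (𝓡 d) (𝓡 m) ι x).toLinearMap

/-- The submanifold `ι : N → M` is coisotropic: `(T N)^⊥ ⊆ T N`. -/
def IsCoisotropic (η : ∀ x : M, TangentSpace (𝓡 m) x →L[ℝ] ℝ) (ι : N → M) : Prop :=
  Manifold.IsSmoothEmbedding (𝓡 d) (𝓡 m) ∞ ι ∧
    ∀ x : N, contactCompl η (ι x) (tangentOf (d := d) ι x) ≤ tangentOf (d := d) ι x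

/-- The characteristic distribution `(T N)^⊥` of a coisotropic submanifold, as a distribution
on `N`. -/
def charDistribution (η : ∀ x : M, TangentSpace (𝓡 m) x →L[ℝ] ℝ) (ι : N → M) (x : N) :
    Submodule ℝ (TangentSpace (𝓡 d) x) :=
  (contactCompl η (ι x) (tangentOf (d := d) ι x)).comap (mfderiv (𝓡 d) (𝓡 m) ι x).toLinearMap

/-- `π : N → Q` is the projection onto the manifold of leaves of the distribution `D`:
a smooth submersion onto `Q` whose fibres are connected and everywhere tangent to `D` (of full
dimension), that is, are the leaves of `D`. -/
structure IsLeafQuotient (D : ∀ x : N, Submodule ℝ (TangentSpace (𝓡 d) x)) (π : N → Q) :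
    Prop where
  submersion : Manifold.IsSubmersion (𝓡 d) (𝓡 r) ∞ π
  connected_fibre : ∀ q : Q, IsConnected (π ⁻¹' {q})
  ker_eq : ∀ x : N, LinearMap.ker (mfderiv (𝓡 d) (𝓡 r) π x).toLinearMap = D x

/-- `N` and `L` intersect cleanly: `N ∩ L` is a submanifold and `T(N ∩ L) = T N ∩ T L`. -/
def CleanIntersection (m : ℕ) {M : Type*} [TopologicalSpace M] [ChartedSpace (Euc m) M]
    {d : ℕ} {N : Type*} [TopologicalSpace N] [ChartedSpace (Euc d) N]
    (ι : N → M) (L : Set M) : Prop :=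
  IsSubmanifold m (Set.range ι ∩ L) ∧
    ∀ x : N, ι x ∈ L →
      tangentTo m (Set.range ι ∩ L) (ι x) = tangentOf (d := d) ι x ⊓ tangentTo m L (ι x)

/-- `ηQ` is a smooth one-form on `Q` with `π^* ηQ = f · ι^* η`, where `f` is a nowhere vanishing
smooth function on `N`. -/
structure IsReducedForm (η : ∀ x : M, TangentSpace (𝓡 m) x →L[ℝ] ℝ) (ι : N → M) (π : N → Q)
    (f : N → ℝ) (ηQ : ∀ q : Q, TangentSpace (𝓡 r) q →L[ℝ] ℝ) : Prop where
  smooth : IsSmoothForm ηQ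
  smooth_factor : ContMDiff (𝓡 d) 𝓘(ℝ, ℝ) ∞ f
  factor_ne_zero : ∀ x : N, f x ≠ 0
  pullback_eq : ∀ x : N, (ηQ (π x)).comp (mfderiv (𝓡 d) (𝓡 r) π x) =
    f x • (η (ι x)).comp (mfderiv (𝓡 d) (𝓡 m) ι x)

end Reduction

end ContactReduction

end

/-! At a point, `η ∧ (dη)^n ≠ 0` means that `dη` is symplectic on the hyperplane `ker η`
(`isContactPair_of_wedgePow_ne_zero`, `IsContactPair.exists_wedgePow_ne_zero`), and the contact
complement of `Δ` is the symplectic orthogonal of `Δ ∩ ker η` in `ker η`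
(`IsContactPair.mem_complement_iff`). The pointwise content is therefore symplectic reduction: `TN ∩
ker η` is coisotropic, `ker dπ` is its radical, and a Lagrangian subspace has Lagrangian image in
the quotient (`IsLinearReduction.map_comap_eq_complement`).

Reduced forms: `ι^*η` kills `ker dπ`, so it defines at each `x` in `N` a covector `β x` on the
tangent space of the quotient at `π x`. For `X` tangent to the fibres, `ι_X dη` vanishes on `TN ∩
ker η`, so along `X` the form `ι^*η` changes only by a multiple of itself. Hence `β` keeps its
positive ray along a connected fibre (`covector_ray`). Rays are convex, so the local choices `β ∘
s`, with `s` a local section of `π`, can be averaged by a partition of unity. If all points are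
vertical, the Reeb vector is tangent to `N`, `ι_X dη` vanishes on all of `TN`, and `β` itself
descends. Any reduced form is contact because `d(fη) = df ∧ η + f dη` agrees with `f dη` on `ker η`.

Legendrian image: the differential of `π` restricted to `N ∩ L` has as image a subspace equal to its
contact complement, so its rank is `k` where the quotient has dimension `2 k + 1`. This rank is
constant even if the components of `N ∩ L` have different dimensions, and the constant rank theorem
(`exists_transversal_of_constant_rank`) makes the image of a small piece an immersed `k`-disc.
Countably many discs cover `π(N ∩ L)`, and their disjoint union is the domain of the immersion. If
the image is embedded, Hausdorff dimension bounds its dimension by `k`, so its tangent spaces are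
those of the discs. -/

noncomputable section

namespace ContactReduction

/-! ### From a nonzero top wedge product to nondegeneracy on `ker η` -/

section WedgePow

variable {V : Type*} [AddCommGroup V] [Module ℝ V]

/-- Each argument occurs in exactly one factor: argument `0` in `η`, argument `j > 0` in the factor
of index `(j - 1) / 2`. The other factors are constants. This gives both multilinearity axioms of
`tensorPow`. -/
lemma exists_linear_update_tensorPow (n : ℕ) (η : Module.Dual ℝ V) (Ω : V →ₗ[ℝ] V →ₗ[ℝ] ℝ)
    [DecidableEq (Fin (2 * n + 1))] (v : Fin (2 * n + 1) → V) (j : Fin (2 * n + 1)) :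
    ∃ φ : V →ₗ[ℝ] ℝ, ∀ z, η (Function.update v j z ⟨0, by omega⟩) *
      ∏ i : Fin n, Ω (Function.update v j z ⟨2 * (i : ℕ) + 1, by omega⟩)
        (Function.update v j z ⟨2 * (i : ℕ) + 2, by omega⟩) = φ z := by
  obtain ⟨j, hjn⟩ := j
  rcases Nat.eq_zero_or_pos j with rfl | hj
  · refine ⟨(∏ i : Fin n, Ω (v ⟨2 * (i : ℕ) + 1, by omega⟩) (v ⟨2 * (i : ℕ) + 2, by omega⟩)) • η,
      fun z => ?_⟩
    simp [mul_comm]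
  · obtain ⟨i, hi⟩ : ∃ i : Fin n, j = 2 * (i : ℕ) + 1 ∨ j = 2 * (i : ℕ) + 2 :=
      ⟨⟨(j - 1) / 2, by omega⟩, by simp only; omega⟩
    simp only [← Finset.mul_prod_erase Finset.univ _ (Finset.mem_univ i)]
    have key : ∀ z, (∏ i' ∈ Finset.univ.erase i, Ω
        (Function.update v ⟨j, hjn⟩ z ⟨2 * (i' : ℕ) + 1, by omega⟩)
        (Function.update v ⟨j, hjn⟩ z ⟨2 * (i' : ℕ) + 2, by omega⟩)) =
        ∏ i' ∈ Finset.univ.erase i, Ω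
        (v ⟨2 * (i' : ℕ) + 1, by omega⟩) (v ⟨2 * (i' : ℕ) + 2, by omega⟩) := by
      intro z
      refine Finset.prod_congr rfl fun i' hi' => ?_
      have hne : (i' : ℕ) ≠ i := fun h => (Finset.mem_erase.mp hi').1 (Fin.ext h)
      rw [Function.update_of_ne, Function.update_of_ne] <;>
        · rw [Ne, Fin.ext_iff]; simp only; omega
    have h0 : ∀ z, Function.update v ⟨j, hjn⟩ z ⟨0, by omega⟩ = v ⟨0, by omega⟩ := fun z =>
      Function.update_of_ne (by rw [Ne, Fin.ext_iff]; simp only; omega) _ _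
    simp only [key, h0]
    rcases hi with rfl | rfl
    · refine ⟨(η (v ⟨0, by omega⟩) * ∏ i' ∈ Finset.univ.erase i, Ω
        (v ⟨2 * (i' : ℕ) + 1, by omega⟩) (v ⟨2 * (i' : ℕ) + 2, by omega⟩)) •
        Ω.flip (v ⟨2 * (i : ℕ) + 2, by omega⟩), fun z => ?_⟩
      simp; ring
    · refine ⟨(η (v ⟨0, by omega⟩) * ∏ i' ∈ Finset.univ.erase i, Ω
        (v ⟨2 * (i' : ℕ) + 1, by omega⟩) (v ⟨2 * (i' : ℕ) + 2, by omega⟩)) •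
        Ω (v ⟨2 * (i : ℕ) + 1, by omega⟩), fun z => ?_⟩
      simp; ring

/-- The value of `η ⊗ Ω ⊗ ... ⊗ Ω` as a multilinear map. -/
def tensorPow (n : ℕ) (η : Module.Dual ℝ V) (Ω : V →ₗ[ℝ] V →ₗ[ℝ] ℝ) :
    MultilinearMap ℝ (fun _ : Fin (2 * n + 1) => V) ℝ where
  toFun v := η (v ⟨0, by omega⟩) *
    ∏ i : Fin n, Ω (v ⟨2 * (i : ℕ) + 1, by omega⟩) (v ⟨2 * (i : ℕ) + 2, by omega⟩)
  map_update_add' v j x y := by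
    obtain ⟨φ, hφ⟩ := exists_linear_update_tensorPow n η Ω v j
    rw [hφ, hφ, hφ, map_add]
  map_update_smul' v j c x := by
    obtain ⟨φ, hφ⟩ := exists_linear_update_tensorPow n η Ω v j
    rw [hφ, hφ, map_smul]

/-- Makes `wedgePow` an alternating map, so that its vanishing can be tested on a basis. -/
lemma alternatization_tensorPow (n : ℕ) (η : Module.Dual ℝ V) (Ω : V →ₗ[ℝ] V →ₗ[ℝ] ℝ)
    (v : Fin (2 * n + 1) → V) :
    MultilinearMap.alternatization (tensorPow n η Ω) v = wedgePow n η Ω v := by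
  rw [MultilinearMap.alternatization_apply, wedgePow]
  refine Finset.sum_congr rfl fun σ _ => ?_
  simp [tensorPow, Units.smul_def]

/-- `(η, Ω)` is the value at a point of a contact form and its exterior derivative: `Ω` is
alternating, `η ≠ 0`, and `Ω` is nondegenerate on `ker η`. -/
structure IsContactPair (η : Module.Dual ℝ V) (Ω : V →ₗ[ℝ] V →ₗ[ℝ] ℝ) : Prop where
  alt : ∀ v, Ω v v = 0
  ne_zero : η ≠ 0
  nondeg : ∀ u, η u = 0 → (∀ w, η w = 0 → Ω u w = 0) → u = 0

lemma alt_swap {Ω : V →ₗ[ℝ] V →ₗ[ℝ] ℝ} (h : ∀ v, Ω v v = 0) (u w : V) : Ω u w = -Ω w u := by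
  have := h (u + w)
  simp only [map_add, LinearMap.add_apply, h] at this
  linarith

lemma exists_eq_one {η : Module.Dual ℝ V} (h : η ≠ 0) : ∃ v, η v = 1 := by
  obtain ⟨v, hv⟩ : ∃ v, η v ≠ 0 := by
    by_contra! hc
    exact h (LinearMap.ext hc)
  exact ⟨(η v)⁻¹ • v, by simp [hv]⟩

/-- A nonzero `u` in the radical of `Ω` on `ker η` extends to a basis contained in `{v₀} ∪ ker η`.
An injective choice of `2 n + 1` basis vectors uses all of them, so `u` occurs. A term of the sum
can be nonzero only with `v₀` in position `0`; then all other vectors lie in `ker η`, and the factor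
containing `u` is zero. So the alternating map vanishes on a basis. -/
lemma isContactPair_of_wedgePow_ne_zero {n : ℕ} (hn : Module.finrank ℝ V = 2 * n + 1)
    {η : Module.Dual ℝ V} {Ω : V →ₗ[ℝ] V →ₗ[ℝ] ℝ} (alt : ∀ v, Ω v v = 0)
    {v : Fin (2 * n + 1) → V} (hv : wedgePow n η Ω v ≠ 0) : IsContactPair η Ω := by
  have hη : η ≠ 0 := by
    rintro rfl
    simp [wedgePow] at hv
  refine ⟨alt, hη, fun u hu hΩ => ?_⟩
  by_contra hu0
  obtain ⟨v₀, hv₀⟩ := exists_eq_one hη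
  have hs : LinearIndepOn ℝ id {u} := LinearIndepOn.singleton hu0
  set t : Set V := insert v₀ {w | η w = 0} with ht
  have hst : {u} ⊆ t := by rintro _ rfl; exact Or.inr hu
  have hspan : ⊤ ≤ Submodule.span ℝ t := by
    intro w _
    have : w = η w • v₀ + (w - η w • v₀) := by abel
    rw [this]
    refine add_mem (Submodule.smul_mem _ _ (Submodule.subset_span (Or.inl rfl)))
      (Submodule.subset_span (Or.inr ?_))
    simp [hv₀]
  set b := Module.Basis.extendLe hs hst hspan with hb
  have hbt : ∀ i, b i = v₀ ∨ η (b i) = 0 := fun i =>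
    Module.Basis.extendLe_subset hs hst hspan ⟨i, rfl⟩
  obtain ⟨i₀, hi₀⟩ : u ∈ Set.range b := Module.Basis.subset_extendLe hs hst hspan rfl
  have : Module.Finite ℝ V := Module.finite_of_finrank_pos (by omega)
  have hzero : MultilinearMap.alternatization (tensorPow n η Ω) = 0 := by
    refine Module.Basis.ext_alternating b fun e he => ?_
    have hfin : Finite (hs.extend hst) := Module.Finite.finite_basis b
    have hbij : Function.Bijective e := by
      refine he.bijective_of_nat_card_le ?_
      rw [← Module.finrank_eq_nat_card_basis b, hn]
      simp
    rw [alternatization_tensorPow, wedgePow]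
    refine Finset.sum_eq_zero fun σ _ => ?_
    refine mul_eq_zero_of_right _ ?_
    by_contra hne
    rw [mul_eq_zero, not_or, Finset.prod_eq_zero_iff, not_exists] at hne
    obtain ⟨h0, hp⟩ := hne
    have h0' : b (e (σ ⟨0, by omega⟩)) = v₀ := (hbt _).resolve_right h0
    have hker : ∀ j, j ≠ ⟨0, by omega⟩ → η (b (e (σ j))) = 0 := fun j hj => by
      refine (hbt _).resolve_left fun h => hj (σ.injective (he (b.injective ?_)))
      rw [h, h0']
    obtain ⟨⟨j, hjn⟩, hj⟩ := (hbij.comp σ.bijective).2 i₀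
    have hju : b (e (σ ⟨j, hjn⟩)) = u := (congrArg b hj).trans hi₀
    have hj0 : j ≠ 0 := by
      rintro rfl
      rw [hju] at h0
      exact h0 hu
    obtain ⟨i, hi⟩ : ∃ i : Fin n, j = 2 * (i : ℕ) + 1 ∨ j = 2 * (i : ℕ) + 2 :=
      ⟨⟨(j - 1) / 2, by omega⟩, by simp only; omega⟩
    refine hp i ⟨Finset.mem_univ _, ?_⟩
    rcases hi with rfl | rfl
    · rw [hju]
      exact hΩ _ (hker _ (by simp))
    · rw [hju, alt_swap alt, hΩ _ (hker _ (by simp)), neg_zero]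
  rw [← alternatization_tensorPow, hzero] at hv
  exact hv rfl

end WedgePow

/-! ### From nondegeneracy on `ker η` to a nonzero top wedge product -/

section Symplectic

/-- A symplectic vector space has a symplectic basis (given here as a family of the right size). -/
lemma exists_symplectic_family (N : ℕ) : ∀ {W : Type*} [AddCommGroup W] [Module ℝ W]
    [Module.Finite ℝ W] (B : W →ₗ[ℝ] W →ₗ[ℝ] ℝ), Module.finrank ℝ W = N → (∀ v, B v v = 0) →
    (∀ u, (∀ w, B u w = 0) → u = 0) →
    ∃ n : ℕ, N = 2 * n ∧ ∃ e : Fin n × Fin 2 → W,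
      ∀ a b, B (e a) (e b) = if a.1 = b.1 then ((b.2 : ℕ) : ℝ) - ((a.2 : ℕ) : ℝ) else 0 := by
  induction N using Nat.strong_induction_on with
  | _ N ih =>
    intro W _ _ _ B hN alt nondeg
    rcases Nat.eq_zero_or_pos N with h0 | hpos
    · exact ⟨0, by omega, fun a => a.1.elim0, fun a => a.1.elim0⟩
    have : Nontrivial W := Module.nontrivial_of_finrank_pos (R := ℝ) (by omega)
    obtain ⟨x, hx⟩ := exists_ne (0 : W)
    obtain ⟨y, hy⟩ := exists_eq_one (η := B x) fun h => hx (nondeg x fun w => by rw [h]; rfl)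
    have hyx : B y x = -1 := by rw [alt_swap alt, hy]
    -- The kernel of `φ` is the orthogonal of the hyperbolic plane spanned by `x` and `y`; it has
    -- dimension `N - 2` and carries the induction.
    set φ : W →ₗ[ℝ] ℝ × ℝ := (B x).prod (B y) with hφ
    have hsurj : Function.Surjective φ := by
      rintro ⟨a, b⟩
      exact ⟨a • y - b • x, by simp [hφ, hy, hyx, alt]⟩
    have hdim := LinearMap.finrank_range_add_finrank_ker φ
    rw [LinearMap.range_eq_top.mpr hsurj, finrank_top, Module.finrank_prod,
      Module.finrank_self, hN] at hdim
    set K := LinearMap.ker φ with hK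
    have hKmem : ∀ u : K, B x u = 0 ∧ B y u = 0 := fun u =>
      Prod.mk_eq_zero.mp (LinearMap.mem_ker.mp u.2)
    obtain ⟨n, hn, e, he⟩ := ih (Module.finrank ℝ K) (by omega)
      (B.domRestrict₁₂ K K) rfl (fun v => alt v) (fun u hu => by
        refine Subtype.ext (nondeg u fun w => ?_)
        -- This is the projection of `w` to `K` along the plane; `u` in `K` pairs with it as with
        -- `w`.
        have hw : w - (B x w) • y + (B y w) • x ∈ K := by
          rw [hK, LinearMap.mem_ker, hφ]
          simp [hy, hyx, alt]
        have h1 := hu ⟨_, hw⟩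
        simp only [LinearMap.domRestrict₁₂_apply, map_add, map_sub, map_smul] at h1
        rw [alt_swap alt u y, (hKmem u).2, alt_swap alt u x, (hKmem u).1] at h1
        simpa using h1)
    refine ⟨n + 1, by omega, fun a => Fin.cases (if a.2 = 0 then x else y)
      (fun i => (e (i, a.2) : W)) a.1, ?_⟩
    rintro ⟨a, s⟩ ⟨b, t⟩
    have hl : ∀ c, B x (e c) = 0 ∧ B y (e c) = 0 := fun c => hKmem (e c)
    have hr : ∀ c, B (e c) x = 0 ∧ B (e c) y = 0 := fun c =>
      ⟨by rw [alt_swap alt, (hl c).1, neg_zero], by rw [alt_swap alt, (hl c).2, neg_zero]⟩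
    refine Fin.cases ?_ (fun i => ?_) a <;> refine Fin.cases ?_ (fun j => ?_) b
    · fin_cases s <;> fin_cases t <;> simp [alt, hy, hyx]
    · fin_cases s <;> simp [hl, (Fin.succ_ne_zero j).symm]
    · fin_cases t <;> simp [hr, Fin.succ_ne_zero i]
    · have := he (i, s) (j, t)
      simp only [LinearMap.domRestrict₁₂_apply] at this
      simpa using this

/-- The positions `0`, `2 i + 1`, `2 i + 2` of the arguments of `wedgePow`. -/
def wedgeIndexFun (n : ℕ) (a : Option (Fin n × Fin 2)) : Fin (2 * n + 1) :=
  a.elim ⟨0, by omega⟩ fun b => ⟨2 * (b.1 : ℕ) + 1 + (b.2 : ℕ), by omega⟩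

lemma wedgeIndexFun_bijective (n : ℕ) : Function.Bijective (wedgeIndexFun n) := by
  refine (Fintype.bijective_iff_injective_and_card _).mpr ⟨?_, by simp; ring⟩
  rintro (_ | ⟨a, s⟩) (_ | ⟨b, t⟩) h <;> simp [wedgeIndexFun] at h ⊢
  omega

/-- The bijection between `Option (Fin n × Fin 2)` and the positions of the arguments of
`wedgePow`. -/
def wedgeIndex (n : ℕ) : Option (Fin n × Fin 2) ≃ Fin (2 * n + 1) :=
  Equiv.ofBijective _ (wedgeIndexFun_bijective n)

/-- A permutation of `Fin n × Fin 2` which permutes the blocks `{i} × Fin 2` has the sign of the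
product of the signs inside the blocks. -/
lemma sign_mul_prod_of_preserves_blocks {n : ℕ} (σ : Equiv.Perm (Fin n × Fin 2))
    (h : ∀ i, (σ (i, 0)).1 = (σ (i, 1)).1) :
    ((Equiv.Perm.sign σ : ℤ) : ℝ) *
      ∏ i, ((((σ (i, 1)).2 : ℕ) : ℝ) - (((σ (i, 0)).2 : ℕ) : ℝ)) = 1 := by
  have hne : ∀ i, (σ (i, 0)).2 ≠ (σ (i, 1)).2 := fun i h' => by
    have := σ.injective (Prod.ext (h i) h')
    simp at this
  have hall : ∀ i s, (σ (i, s)).1 = (σ (i, 0)).1 := fun i s => by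
    fin_cases s
    · rfl
    · exact (h i).symm
  set τ : Fin n → Fin n := fun i => (σ (i, 0)).1 with hτ
  have hτinj : Function.Injective τ := by
    intro i j hij
    have hcases : (σ (j, 0)).2 = (σ (i, 0)).2 ∨ (σ (j, 0)).2 = (σ (i, 1)).2 := by
      have := hne i
      revert this
      generalize (σ (i, 0)).2 = a
      generalize (σ (i, 1)).2 = b
      generalize (σ (j, 0)).2 = c
      revert a b c
      decide
    rcases hcases with hc | hc
    · have := σ.injective (Prod.ext hij hc.symm)
      simpa using this
    · have := σ.injective (Prod.ext ((h i).symm.trans hij) hc.symm)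
      simpa using (Prod.ext_iff.mp this).1
  have hρinj : ∀ i, Function.Injective fun s => (σ (i, s)).2 := fun i s t hst => by
    have := σ.injective (Prod.ext ((hall i s).trans (hall i t).symm) hst)
    simpa using this
  set T : Equiv.Perm (Fin n) := Equiv.ofBijective τ (Finite.injective_iff_bijective.mp hτinj)
  set ρ : Fin n → Equiv.Perm (Fin 2) := fun i =>
    Equiv.ofBijective _ (Finite.injective_iff_bijective.mp (hρinj i)) with hρ
  have hσ : σ = (Equiv.prodCongrLeft fun _ => T) * Equiv.prodCongrRight ρ := by
    ext1 ⟨i, s⟩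
    refine Prod.ext ?_ rfl
    exact hall i s
  have hsign : Equiv.Perm.sign σ = ∏ i, Equiv.Perm.sign (ρ i) := by
    -- The block permutation `T` acts on two copies of `Fin n`, so its sign enters squared; only the
    -- signs inside the blocks survive.
    rw [hσ, map_mul, Equiv.Perm.sign_prodCongrLeft, Equiv.Perm.sign_prodCongrRight]
    simp
  have hρs : ∀ i, ((((σ (i, 1)).2 : ℕ) : ℝ) - (((σ (i, 0)).2 : ℕ) : ℝ)) =
      ((Equiv.Perm.sign (ρ i) : ℤ) : ℝ) := by
    intro i
    have h0 : (σ (i, 0)).2 = ρ i 0 := rfl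
    have h1 : (σ (i, 1)).2 = ρ i 1 := rfl
    rw [h0, h1]
    generalize ρ i = p
    have : (((p 1 : Fin 2) : ℕ) : ℤ) - ((p 0 : Fin 2) : ℕ) = (Equiv.Perm.sign p : ℤ) := by
      revert p; decide
    exact_mod_cast this
  rw [Finset.prod_congr rfl fun i _ => hρs i, hsign]
  push_cast
  rw [← Finset.prod_mul_distrib]
  refine Finset.prod_eq_one fun i _ => ?_
  rcases Int.units_eq_one_or (Equiv.Perm.sign (ρ i)) with h | h <;> simp [h]

variable {V : Type*} [AddCommGroup V] [Module ℝ V] [Module.Finite ℝ V]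

/-- The vectors are `v₀` followed by a symplectic basis of `ker η`. A term can be nonzero only if
its permutation fixes the position of `v₀` and permutes the hyperbolic pairs; its sign then cancels
that of the product. No term is negative, and the identity contributes a positive one. -/
lemma IsContactPair.exists_wedgePow_ne_zero {η : Module.Dual ℝ V} {Ω : V →ₗ[ℝ] V →ₗ[ℝ] ℝ}
    (h : IsContactPair η Ω) : ∃ n, Module.finrank ℝ V = 2 * n + 1 ∧
      ∃ v : Fin (2 * n + 1) → V, wedgePow n η Ω v ≠ 0 := by
  obtain ⟨v₀, hv₀⟩ := exists_eq_one h.ne_zero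
  obtain ⟨n, hn, e, he⟩ := exists_symplectic_family _
    (Ω.domRestrict₁₂ (LinearMap.ker η) (LinearMap.ker η)) rfl (fun v => h.alt v)
    (fun u hu => Subtype.ext (h.nondeg u u.2 fun w hw => hu ⟨w, hw⟩))
  have hdim := LinearMap.finrank_range_add_finrank_ker η
  rw [LinearMap.range_eq_top.mpr fun c => ⟨c • v₀, by simp [hv₀]⟩, finrank_top,
    Module.finrank_self] at hdim
  set ev : Option (Fin n × Fin 2) → V := fun a => a.elim v₀ fun a => (e a : V) with hev
  have hval : ∀ a b, Ω (ev (some a)) (ev (some b)) =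
      if a.1 = b.1 then ((b.2 : ℕ) : ℝ) - ((a.2 : ℕ) : ℝ) else 0 := fun a b => he a b
  refine ⟨n, by omega, fun j => ev ((wedgeIndex n).symm j), ne_of_gt ?_⟩
  have hterm : ∀ σ : Equiv.Perm (Option (Fin n × Fin 2)),
      0 ≤ ((Equiv.Perm.sign σ : ℤ) : ℝ) * (η (ev (σ none)) *
        ∏ i : Fin n, Ω (ev (σ (some (i, 0)))) (ev (σ (some (i, 1))))) := by
    intro σ
    rcases hσ : σ none with _ | a
    · set σ' := Equiv.removeNone σ with hσ'
      have hsome : ∀ a, σ (some a) = some (σ' a) := fun a =>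
        (Equiv.removeNone_some σ (Option.ne_none_iff_exists'.mp fun h => by
          simpa using σ.injective (h.trans hσ.symm))).symm
      have hcongr : σ = σ'.optionCongr := by
        ext1 (_ | a)
        · simp [hσ]
        · simp [hsome]
      simp only [hsome, hval]
      by_cases hblock : ∀ i, (σ' (i, 0)).1 = (σ' (i, 1)).1
      · have := sign_mul_prod_of_preserves_blocks σ' hblock
        rw [hcongr, Equiv.optionCongr_sign]
        simp only [hblock, if_true]
        rw [mul_left_comm, this, mul_one]
        simp [hev, hv₀]
      · push Not at hblock
        obtain ⟨i, hi⟩ := hblock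
        rw [Finset.prod_eq_zero (Finset.mem_univ i) (if_neg hi)]
        simp
    · have : η (ev (some a)) = 0 := (e a).2
      simp [this]
  have hsum : wedgePow n η Ω (fun j => ev ((wedgeIndex n).symm j)) =
      ∑ σ : Equiv.Perm (Option (Fin n × Fin 2)), ((Equiv.Perm.sign σ : ℤ) : ℝ) *
        (η (ev (σ none)) * ∏ i : Fin n, Ω (ev (σ (some (i, 0)))) (ev (σ (some (i, 1))))) := by
    rw [wedgePow, ← Equiv.sum_comp (wedgeIndex n).permCongr]
    have h0 : ∀ h, (⟨0, h⟩ : Fin (2 * n + 1)) = wedgeIndex n none := fun _ => rfl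
    have h1 : ∀ (i : Fin n) h, (⟨2 * (i : ℕ) + 1, h⟩ : Fin (2 * n + 1)) =
      wedgeIndex n (some (i, 0)) := fun _ _ => rfl
    have h2 : ∀ (i : Fin n) h, (⟨2 * (i : ℕ) + 2, h⟩ : Fin (2 * n + 1)) =
      wedgeIndex n (some (i, 1)) := fun _ _ => rfl
    simp only [h0, h1, h2, Equiv.permCongr_apply, Equiv.symm_apply_apply,
      Equiv.Perm.sign_permCongr]
  rw [hsum]
  refine Finset.sum_pos' (fun σ _ => hterm σ) ⟨1, Finset.mem_univ _, ?_⟩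
  simp only [Equiv.Perm.one_apply, hval]
  simp [hev, hv₀]

end Symplectic

/-! ### Contact complements as symplectic orthogonals -/

section Complement

variable {V : Type*} [AddCommGroup V] [Module ℝ V]
  {η : Module.Dual ℝ V} {Ω : V →ₗ[ℝ] V →ₗ[ℝ] ℝ}

/-- The restriction of `Ω` to `ker η`. -/
def kerForm (η : Module.Dual ℝ V) (Ω : V →ₗ[ℝ] V →ₗ[ℝ] ℝ) :
    LinearMap.BilinForm ℝ (LinearMap.ker η) :=
  Ω.domRestrict₁₂ (LinearMap.ker η) (LinearMap.ker η)

@[simp] lemma kerForm_apply (u w : LinearMap.ker η) : kerForm η Ω u w = Ω u w := rfl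

lemma IsContactPair.kerForm_isAlt (h : IsContactPair η Ω) : (kerForm η Ω).IsAlt :=
  fun v => h.alt v

lemma IsContactPair.kerForm_nondegenerate (h : IsContactPair η Ω) :
    (kerForm η Ω).Nondegenerate :=
  (LinearMap.IsRefl.nondegenerate_iff_separatingLeft h.kerForm_isAlt.isRefl).mpr
    fun u hu => Subtype.ext (h.nondeg u u.2 fun w hw => hu ⟨w, hw⟩)

lemma flat_sharp (h : Function.Bijective (flat η Ω)) (α : Module.Dual ℝ V) :
    flat η Ω (sharp η Ω α) = α := by
  rw [sharp, dif_pos h]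
  exact (LinearEquiv.ofBijective (flat η Ω) h).apply_symm_apply α

lemma sharp_flat (h : Function.Bijective (flat η Ω)) (v : V) :
    sharp η Ω (flat η Ω v) = v :=
  h.1 (flat_sharp h _)

variable [Module.Finite ℝ V]

/-- A vector `v₀` with `η v₀ = 1` is corrected by the element `k` of `ker η` that represents `Ω v₀`
on `ker η`. Pairing with the remaining direction is automatic, since `Ω` is alternating. -/
lemma IsContactPair.exists_reeb (h : IsContactPair η Ω) : ∃ R, η R = 1 ∧ ∀ w, Ω R w = 0 := by
  obtain ⟨v₀, hv₀⟩ := exists_eq_one h.ne_zero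
  have hinj : Function.Injective (kerForm η Ω) := by
    rw [injective_iff_map_eq_zero]
    exact fun u hu => Subtype.ext (h.nondeg u u.2 fun w hw =>
      LinearMap.congr_fun hu (⟨w, hw⟩ : LinearMap.ker η))
  have hsurj : Function.Surjective (kerForm η Ω) :=
    (LinearMap.injective_iff_surjective_of_finrank_eq_finrank
      (Subspace.dual_finrank_eq).symm).mp hinj
  obtain ⟨k, hk⟩ := hsurj ((Ω v₀).domRestrict (LinearMap.ker η))
  have hR : η (v₀ - k) = 1 := by
    rw [map_sub, hv₀, LinearMap.mem_ker.mp k.2, sub_zero]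
  have hker : ∀ w, η w = 0 → Ω (v₀ - k) w = 0 := fun w hw => by
    have := LinearMap.congr_fun hk (⟨w, hw⟩ : LinearMap.ker η)
    simp only [kerForm_apply, LinearMap.domRestrict_apply] at this
    rw [map_sub, LinearMap.sub_apply, this, sub_self]
  refine ⟨v₀ - k, hR, fun w => ?_⟩
  have hw := hker (w - η w • (v₀ - k)) (by simp [map_sub, hR] )
  rw [map_sub, map_smul, h.alt, smul_zero, sub_zero] at hw
  exact hw

lemma IsContactPair.flat_bijective (h : IsContactPair η Ω) : Function.Bijective (flat η Ω) := by
  obtain ⟨R, hR, hΩR⟩ := h.exists_reeb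
  have hinj : Function.Injective (flat η Ω) := by
    rw [injective_iff_map_eq_zero]
    intro u hu
    have happ : ∀ w, Ω u w + η u * η w = 0 := fun w => LinearMap.congr_fun hu w
    have h0 : η u = 0 := by
      have := happ R
      rw [alt_swap h.alt, hΩR, hR] at this
      simpa using this
    refine h.nondeg u h0 fun w _ => ?_
    simpa [h0] using happ w
  exact ⟨hinj, (LinearMap.injective_iff_surjective_of_finrank_eq_finrank
    (Subspace.dual_finrank_eq).symm).mp hinj⟩

lemma IsContactPair.reeb_spec (h : IsContactPair η Ω) :
    η (reeb η Ω) = 1 ∧ ∀ w, Ω (reeb η Ω) w = 0 := by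
  obtain ⟨R, hR, hΩR⟩ := h.exists_reeb
  have : flat η Ω R = η := by
    ext w
    simp [flat, hΩR, hR]
  have hR' : reeb η Ω = R := by
    rw [reeb]
    nth_rw 2 [← this]
    exact sharp_flat h.flat_bijective R
  rw [hR']
  exact ⟨hR, hΩR⟩

/-- Read through `♭`, the map `♯_Λ` is the projection to `ker η` along the Reeb direction: `Λ(♭v,
♭w) = Ω(w, v)`, and `♭w` takes the value `η w` at the Reeb vector. The minus sign in `Λ` is what
makes this a projection and not its negative. -/
lemma IsContactPair.sharpLambda_flat (h : IsContactPair η Ω) (v : V) :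
    sharpLambda η Ω (flat η Ω v) = v - η v • reeb η Ω := by
  obtain ⟨hR, hΩR⟩ := h.reeb_spec
  have hb := h.flat_bijective
  rw [sharpLambda, LinearMap.comp_apply, LinearEquiv.coe_coe, LinearEquiv.symm_apply_eq]
  ext β
  obtain ⟨w, rfl⟩ := hb.2 β
  simp only [bivector, LinearMap.neg_apply, LinearMap.compl₁₂_apply, sharp_flat hb,
    Module.evalEquiv_apply, Module.Dual.eval_apply]
  have e1 : Ω w (reeb η Ω) = 0 := by rw [alt_swap h.alt, hΩR, neg_zero]
  simp only [flat, LinearMap.add_apply, LinearMap.smulRight_apply, map_sub, map_smul,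
    LinearMap.smul_apply, smul_eq_mul, e1, hR]
  rw [alt_swap h.alt v w]
  ring

/-- The contact complement of `Δ` is the orthogonal in `ker η` of `Δ ∩ ker η`. -/
lemma IsContactPair.mem_complement_iff (h : IsContactPair η Ω) {Δ : Submodule ℝ V} {u : V} :
    u ∈ complement η Ω Δ ↔ η u = 0 ∧ ∀ w ∈ Δ, η w = 0 → Ω u w = 0 := by
  obtain ⟨hR, hΩR⟩ := h.reeb_spec
  have hb := h.flat_bijective
  constructor
  · rintro ⟨α, hα, rfl⟩
    obtain ⟨v, rfl⟩ := hb.2 α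
    rw [h.sharpLambda_flat]
    refine ⟨by simp [hR], fun w hw hηw => ?_⟩
    have := (Submodule.mem_dualAnnihilator _).mp hα w hw
    simp only [flat, LinearMap.add_apply, LinearMap.smulRight_apply, LinearMap.smul_apply,
      smul_eq_mul, hηw, mul_zero, add_zero] at this
    simp [this, hΩR]
  · rintro ⟨hu, hΔ⟩
    -- On `Δ` the functional `Ω u` is a multiple `c` of `η`, since it vanishes on `Δ ∩ ker η`. If
    -- `η` is nonzero at `w₀` in `Δ`, the ratio at `w₀` gives `c`; if `Δ` lies in `ker η`, then `c =
    -- 0` works.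
    obtain ⟨α, c, hα, hαβ⟩ : ∃ α : Module.Dual ℝ V, ∃ c : ℝ,
        α ∈ Δ.dualAnnihilator ∧ α + c • η = Ω u := by
      by_cases hΔη : ∃ w ∈ Δ, η w ≠ 0
      · obtain ⟨w₀, hw₀, hη₀⟩ := hΔη
        refine ⟨Ω u - (Ω u w₀ / η w₀) • η, Ω u w₀ / η w₀, ?_, by abel⟩
        refine (Submodule.mem_dualAnnihilator _).mpr fun w hw => ?_
        have := hΔ (w - (η w / η w₀) • w₀) (sub_mem hw (Δ.smul_mem _ hw₀)) (by simp [hη₀])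
        simp only [map_sub, map_smul, smul_eq_mul] at this
        simp only [LinearMap.sub_apply, LinearMap.smul_apply, smul_eq_mul]
        rw [← this]
        ring
      · push Not at hΔη
        exact ⟨Ω u, 0, (Submodule.mem_dualAnnihilator _).mpr fun w hw =>
          hΔ w hw (hΔη w hw), by simp⟩
    refine ⟨α, hα, ?_⟩
    have hα' : α = flat η Ω (u - c • reeb η Ω) := by
      ext w
      have := LinearMap.congr_fun hαβ w
      simp only [LinearMap.add_apply, LinearMap.smul_apply, smul_eq_mul] at this
      simp only [flat, LinearMap.add_apply, map_sub, map_smul, LinearMap.sub_apply,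
        LinearMap.smul_apply, hΩR, LinearMap.smulRight_apply, hu, hR, smul_eq_mul]
      linarith
    rw [hα', h.sharpLambda_flat]
    simp [hu, hR]

/-- A subspace equal to its contact complement has half the dimension of `ker η`. -/
lemma IsContactPair.finrank_of_eq_complement (h : IsContactPair η Ω) {Δ : Submodule ℝ V}
    (hΔ : Δ = complement η Ω Δ) : Module.finrank ℝ V = 2 * Module.finrank ℝ Δ + 1 := by
  have hle : Δ ≤ LinearMap.ker η := fun u hu => by
    rw [hΔ] at hu
    exact (h.mem_complement_iff.mp hu).1
  set K := Δ.comap (LinearMap.ker η).subtype with hK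
  -- Within `ker η` the hypothesis says that `Δ` is Lagrangian.
  have horth : (kerForm η Ω).orthogonal K = K := by
    ext u
    rw [LinearMap.BilinForm.mem_orthogonal_iff, hK, Submodule.mem_comap]
    nth_rw 2 [hΔ]
    rw [h.mem_complement_iff]
    refine ⟨fun hu => ⟨u.2, fun w hw hηw => ?_⟩, fun hu w hw => ?_⟩
    · have : Ω w u = 0 := hu ⟨w, hηw⟩ hw
      rw [Submodule.subtype_apply, alt_swap h.alt, this, neg_zero]
    · have := hu.2 w hw w.2
      rw [Submodule.subtype_apply] at this
      rw [kerForm_apply, alt_swap h.alt, this, neg_zero]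
  have h1 := LinearMap.BilinForm.finrank_orthogonal h.kerForm_nondegenerate K
  rw [horth] at h1
  have h2 : Module.finrank ℝ K = Module.finrank ℝ Δ :=
    (Submodule.comapSubtypeEquivOfLe hle).finrank_eq
  have h3 := LinearMap.finrank_range_add_finrank_ker η
  obtain ⟨v₀, hv₀⟩ := exists_eq_one h.ne_zero
  rw [LinearMap.range_eq_top.mpr fun c => ⟨c • v₀, by simp [hv₀]⟩, finrank_top,
    Module.finrank_self] at h3
  have h4 := Submodule.finrank_le K
  omega

end Complement

/-! ### Symplectic reduction of one tangent space -/

section LinearReduction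

variable {V T U : Type*} [AddCommGroup V] [Module ℝ V] [Module.Finite ℝ V]
  [AddCommGroup T] [Module ℝ T] [AddCommGroup U] [Module ℝ U]

/-- The linear data of a contact reduction at a point: `i` is the inclusion of the tangent space
of a coisotropic submanifold and `p` the projection to the tangent space of the quotient. -/
structure IsLinearReduction (η : Module.Dual ℝ V) (Ω : V →ₗ[ℝ] V →ₗ[ℝ] ℝ)
    (i : T →ₗ[ℝ] V) (p : T →ₗ[ℝ] U) (η' : Module.Dual ℝ U) (Ω' : U →ₗ[ℝ] U →ₗ[ℝ] ℝ)
    (c : ℝ) : Prop where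
  contact : IsContactPair η Ω
  alt : ∀ v, Ω' v v = 0
  coisotropic : complement η Ω (LinearMap.range i) ≤ LinearMap.range i
  nonhorizontal : ∃ u, η (i u) ≠ 0
  surjective : Function.Surjective p
  ker_eq : LinearMap.ker p = (complement η Ω (LinearMap.range i)).comap i
  ne_zero : c ≠ 0
  form_eq : ∀ u, η' (p u) = c * η (i u)
  -- Restricted to `ker η`, because in general `d(fη)` has the further term `df ∧ η`.
  deriv_eq : ∀ u w, η (i u) = 0 → η (i w) = 0 → Ω' (p u) (p w) = c * Ω (i u) (i w)

variable {η : Module.Dual ℝ V} {Ω : V →ₗ[ℝ] V →ₗ[ℝ] ℝ} {i : T →ₗ[ℝ] V} {p : T →ₗ[ℝ] U}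
  {η' : Module.Dual ℝ U} {Ω' : U →ₗ[ℝ] U →ₗ[ℝ] ℝ} {c : ℝ}

lemma IsLinearReduction.form_eq_zero_iff (h : IsLinearReduction η Ω i p η' Ω' c) (u : T) :
    η' (p u) = 0 ↔ η (i u) = 0 := by
  rw [h.form_eq, mul_eq_zero, or_iff_right h.ne_zero]

/-- `ker p` is exactly the radical of `Ω` on the vectors of `T` that `η ∘ i` kills, so the induced
form on the quotient has no radical. -/
lemma IsLinearReduction.isContactPair (h : IsLinearReduction η Ω i p η' Ω' c) :
    IsContactPair η' Ω' := by
  refine ⟨h.alt, ?_, fun q hq hΩq => ?_⟩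
  · rintro rfl
    obtain ⟨u, hu⟩ := h.nonhorizontal
    exact hu ((h.form_eq_zero_iff u).mp rfl)
  · obtain ⟨u, rfl⟩ := h.surjective q
    rw [h.form_eq_zero_iff] at hq
    rw [← LinearMap.mem_ker, h.ker_eq, Submodule.mem_comap, h.contact.mem_complement_iff]
    refine ⟨hq, ?_⟩
    rintro _ ⟨w, rfl⟩ hw
    have := hΩq (p w) ((h.form_eq_zero_iff w).mpr hw)
    rw [h.deriv_eq u w hq hw] at this
    exact (mul_eq_zero.mp this).resolve_left h.ne_zero

variable [Module.Finite ℝ U]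

/-- The reduction of a Legendrian subspace is Legendrian. -/
lemma IsLinearReduction.map_comap_eq_complement (h : IsLinearReduction η Ω i p η' Ω' c)
    {Λ : Submodule ℝ V} (hΛ : Λ = complement η Ω Λ) :
    (Λ.comap i).map p = complement η' Ω' ((Λ.comap i).map p) := by
  have hc := h.contact
  have hΛ' : ∀ u, u ∈ Λ ↔ η u = 0 ∧ ∀ w ∈ Λ, η w = 0 → Ω u w = 0 := fun u => by
    nth_rw 1 [hΛ]; exact hc.mem_complement_iff
  ext q
  rw [h.isContactPair.mem_complement_iff]
  constructor
  · rintro ⟨u, hu, rfl⟩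
    have hu0 := ((hΛ' _).mp hu).1
    refine ⟨(h.form_eq_zero_iff u).mpr hu0, ?_⟩
    rintro _ ⟨w, hw, rfl⟩ _
    have hw0 := ((hΛ' _).mp hw).1
    rw [h.deriv_eq u w hu0 hw0, ((hΛ' _).mp hu).2 _ hw hw0, mul_zero]
  · rintro ⟨hq, hqΩ⟩
    obtain ⟨u, rfl⟩ := h.surjective q
    rw [h.form_eq_zero_iff] at hq
    set B := kerForm η Ω with hB
    set A := Λ.comap (LinearMap.ker η).subtype with hA
    set C := (LinearMap.range i).comap (LinearMap.ker η).subtype with hC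
    have hrefl : B.IsRefl := hc.kerForm_isAlt.isRefl
    have hnd := hc.kerForm_nondegenerate
    have horthA : B.orthogonal A ≤ A := by
      intro a ha
      rw [hA, Submodule.mem_comap, Submodule.subtype_apply, hΛ']
      refine ⟨a.2, fun w hw hηw => ?_⟩
      have : Ω w a = 0 := ha ⟨w, hηw⟩ hw
      rw [alt_swap hc.alt, this, neg_zero]
    -- Double orthogonality in `ker η`: the orthogonal of `B.orthogonal A ⊔ B.orthogonal C` lies in
    -- `A ⊓ C`.
    have horth : B.orthogonal (A ⊓ C) ≤ B.orthogonal A ⊔ B.orthogonal C := by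
      rw [← LinearMap.BilinForm.orthogonal_orthogonal hnd hrefl (B.orthogonal A ⊔ B.orthogonal C)]
      refine LinearMap.BilinForm.orthogonal_le ?_
      refine le_inf ?_ ?_
      · rw [← LinearMap.BilinForm.orthogonal_orthogonal hnd hrefl A]
        exact LinearMap.BilinForm.orthogonal_le
          (by rw [LinearMap.BilinForm.orthogonal_orthogonal hnd hrefl]; exact le_sup_left)
      · rw [← LinearMap.BilinForm.orthogonal_orthogonal hnd hrefl C]
        exact LinearMap.BilinForm.orthogonal_le
          (by rw [LinearMap.BilinForm.orthogonal_orthogonal hnd hrefl]; exact le_sup_right)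
    have hu : (⟨i u, hq⟩ : LinearMap.ker η) ∈ B.orthogonal (A ⊓ C) := by
      rintro ⟨_, hw0⟩ ⟨hwA, ⟨w, rfl⟩⟩
      have := hqΩ (p w) ⟨w, hwA, rfl⟩ ((h.form_eq_zero_iff w).mpr hw0)
      rw [h.deriv_eq u w hq hw0] at this
      change Ω (i w) (i u) = 0
      rw [alt_swap hc.alt]
      simpa [h.ne_zero] using this
    -- Write `i u = a + z` with `a` in `Λ` and `z` in the complement of `range i`. By coisotropy `z
    -- = i z'`, and `p z' = 0`; so `u - z'` lies over `p u` and is mapped into `Λ`.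
    obtain ⟨a, ha, z, hz, haz⟩ := Submodule.mem_sup.mp (horth hu)
    have hzc : (z : V) ∈ complement η Ω (LinearMap.range i) := by
      refine hc.mem_complement_iff.mpr ⟨z.2, fun w hw hηw => ?_⟩
      have : Ω w z = 0 := hz ⟨w, hηw⟩ hw
      rw [alt_swap hc.alt, this, neg_zero]
    obtain ⟨z', hz'⟩ := h.coisotropic hzc
    have hpz : p z' = 0 := by
      rw [← LinearMap.mem_ker, h.ker_eq, Submodule.mem_comap, hz']
      exact hzc
    refine ⟨u - z', ?_, by rw [map_sub, hpz, sub_zero]⟩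
    have hia : i (u - z') = a := by
      have := congrArg Subtype.val haz
      simp only [Submodule.coe_add] at this
      rw [map_sub, hz', ← this, add_sub_cancel_right]
    change i (u - z') ∈ Λ
    rw [hia]
    exact horthA ha

end LinearReduction

/-! ### Pullbacks of one-forms and their exterior derivatives -/

section PullForm

variable {m : ℕ} {M : Type*} [TopologicalSpace M] [ChartedSpace (Euc m) M]
  {E E' : Type*} [NormedAddCommGroup E] [NormedSpace ℝ E]
  [NormedAddCommGroup E'] [NormedSpace ℝ E']
  {η : ∀ x : M, TangentSpace (𝓡 m) x →L[ℝ] ℝ}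

/-- The pullback of a one-form by a map from a vector space. -/
def pullForm (η : ∀ x : M, TangentSpace (𝓡 m) x →L[ℝ] ℝ) (g : E → M) (e : E) : E →L[ℝ] ℝ :=
  (η (g e)).comp (mfderiv 𝓘(ℝ, E) (𝓡 m) g e)

lemma pullForm_congr {g g' : E → M} {e : E} (h : g =ᶠ[𝓝 e] g') :
    pullForm η g =ᶠ[𝓝 e] pullForm η g' := by
  filter_upwards [h.eventuallyEq_nhds] with e' he'
  have h1 : g e' = g' e' := he'.self_of_nhds
  ext v
  have h2 : (mfderiv 𝓘(ℝ, E) (𝓡 m) g e' : E →L[ℝ] Euc m) = mfderiv 𝓘(ℝ, E) (𝓡 m) g' e' :=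
    he'.mfderiv_eq
  have h3 : ∀ (x y : M) (v w : Euc m), x = y → v = w →
      (η x : Euc m →L[ℝ] ℝ) v = (η y : Euc m →L[ℝ] ℝ) w := by
    rintro x _ v _ rfl rfl; rfl
  exact h3 _ _ _ _ h1 (congrArg (fun A : E →L[ℝ] Euc m => A v) h2)

lemma pullForm_comp {g : E → M} {h : E' → E} {e : E'}
    (hg : MDifferentiableAt 𝓘(ℝ, E) (𝓡 m) g (h e)) (hh : DifferentiableAt ℝ h e) :
    pullForm η (g ∘ h) e = (pullForm η g (h e)).comp (fderiv ℝ h e) := by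
  rw [pullForm, mfderiv_comp e hg hh.mdifferentiableAt, mfderiv_eq_fderiv]
  rfl

lemma extD_apply (x : M) (v w : TangentSpace (𝓡 m) x) : extD η x v w =
    chartDeriv η x (mfderiv (𝓡 m) 𝓘(ℝ, Euc m) (extChartAt (𝓡 m) x) x v)
        (mfderiv (𝓡 m) 𝓘(ℝ, Euc m) (extChartAt (𝓡 m) x) x w) -
      chartDeriv η x (mfderiv (𝓡 m) 𝓘(ℝ, Euc m) (extChartAt (𝓡 m) x) x w)
        (mfderiv (𝓡 m) 𝓘(ℝ, Euc m) (extChartAt (𝓡 m) x) x v) := rfl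

lemma extD_self (x : M) (v : TangentSpace (𝓡 m) x) : extD η x v v = 0 := by
  rw [extD_apply, sub_self]

lemma IsSmoothForm.contDiffAt_chartForm (hη : IsSmoothForm η) (x : M) :
    ContDiffAt ℝ ∞ (chartForm η x) (extChartAt (𝓡 m) x x) :=
  (hη x).contDiffAt (extChartAt_target_mem_nhds x)

lemma contDiffAt_extChartAt_comp {g : E → M} {e : E}
    (hg : ContMDiffAt 𝓘(ℝ, E) (𝓡 m) ∞ g e) :
    ContDiffAt ℝ ∞ (fun e' => extChartAt (𝓡 m) (g e) (g e')) e :=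
  ((contMDiffAt_extChartAt (n := ∞)).comp e hg).contDiffAt

variable [IsManifold (𝓡 m) ∞ M]

/-- Factoring `g` through the chart at `g e` leaves an expression between vector spaces, which can
be differentiated. -/
lemma pullForm_eventuallyEq_chart {g : E → M} {e : E}
    (hg : ContMDiffAt 𝓘(ℝ, E) (𝓡 m) ∞ g e) :
    pullForm η g =ᶠ[𝓝 e] fun e' =>
      (chartForm η (g e) (extChartAt (𝓡 m) (g e) (g e'))).comp
        (fderiv ℝ (fun e' => extChartAt (𝓡 m) (g e) (g e')) e') := by
  have hsource : ∀ᶠ e' in 𝓝 e, g e' ∈ (extChartAt (𝓡 m) (g e)).source :=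
    hg.continuousAt (extChartAt_source_mem_nhds _)
  have hG := contDiffAt_extChartAt_comp hg
  have heq : g =ᶠ[𝓝 e] (extChartAt (𝓡 m) (g e)).symm ∘
      fun e' => extChartAt (𝓡 m) (g e) (g e') := by
    filter_upwards [hsource] with e' he'
    exact ((extChartAt (𝓡 m) (g e)).left_inv he').symm
  have hdiff : ∀ᶠ e' in 𝓝 e, DifferentiableAt ℝ (fun e' => extChartAt (𝓡 m) (g e) (g e')) e' := by
    filter_upwards [(hG.of_le (by exact_mod_cast le_top : (1 : ℕ∞ω) ≤ ∞)).eventually (by simp)]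
      with e' he' using he'.differentiableAt one_ne_zero
  filter_upwards [pullForm_congr (η := η) heq, hsource, hdiff] with e' h1 h2 h3
  rw [h1, pullForm_comp _ h3]
  · rfl
  · have ht := (extChartAt (𝓡 m) (g e)).map_source h2
    exact ((contMDiffOn_extChartAt_symm (n := ∞) (g e)).contMDiffAt
      ((isOpen_extChartAt_target (g e)).mem_nhds ht)).mdifferentiableAt (by simp)

/-- The pullback of a smooth one-form is smooth. -/
lemma IsSmoothForm.contDiffAt_pullForm (hη : IsSmoothForm η) {g : E → M} {e : E}
    (hg : ContMDiffAt 𝓘(ℝ, E) (𝓡 m) ∞ g e) : ContDiffAt ℝ ∞ (pullForm η g) e := by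
  refine ContDiffAt.congr_of_eventuallyEq ?_ (pullForm_eventuallyEq_chart hg)
  have hG := contDiffAt_extChartAt_comp hg
  exact ((hη.contDiffAt_chartForm (g e)).comp e hG).clm_comp
    (hG.fderiv_right (by simp))

/-- The exterior derivative commutes with pullbacks. -/
lemma IsSmoothForm.fderiv_pullForm_sub (hη : IsSmoothForm η) {g : E → M} {e : E}
    (hg : ContMDiffAt 𝓘(ℝ, E) (𝓡 m) ∞ g e) (v w : E) :
    fderiv ℝ (pullForm η g) e v w - fderiv ℝ (pullForm η g) e w v =
      extD η (g e) (mfderiv 𝓘(ℝ, E) (𝓡 m) g e v) (mfderiv 𝓘(ℝ, E) (𝓡 m) g e w) := by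
  have hG := contDiffAt_extChartAt_comp hg
  set G : E → Euc m := fun e' => extChartAt (𝓡 m) (g e) (g e') with hGdef
  have hdG : ∀ v, (mfderiv (𝓡 m) 𝓘(ℝ, Euc m) (extChartAt (𝓡 m) (g e)) (g e)
      (mfderiv 𝓘(ℝ, E) (𝓡 m) g e v) : Euc m) = fderiv ℝ G e v := by
    intro v
    have h1 : MDifferentiableAt (𝓡 m) 𝓘(ℝ, Euc m) (extChartAt (𝓡 m) (g e)) (g e) :=
      (contMDiffAt_extChartAt (n := ∞)).mdifferentiableAt (by simp)
    have h2 := mfderiv_comp e h1 (hg.mdifferentiableAt (by simp))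
    have h3 : mfderiv 𝓘(ℝ, E) 𝓘(ℝ, Euc m) ((extChartAt (𝓡 m) (g e)) ∘ g) e = fderiv ℝ G e :=
      mfderiv_eq_fderiv
    rw [h3] at h2
    rw [h2]
    rfl
  have hχ : DifferentiableAt ℝ (chartForm η (g e)) (G e) :=
    (hη.contDiffAt_chartForm (g e)).differentiableAt (by simp)
  have hGd : DifferentiableAt ℝ G e := hG.differentiableAt (by simp)
  have hG2 : DifferentiableAt ℝ (fderiv ℝ G) e :=
    (hG.fderiv_right (m := ∞) (by simp)).differentiableAt (by simp)
  -- The second derivative of `G` is symmetric and cancels when `v` and `w` are exchanged.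
  have hsymm : IsSymmSndFDerivAt ℝ G e := hG.isSymmSndFDerivAt (by
    rw [minSmoothness_of_isRCLikeNormedField]
    exact WithTop.coe_le_coe.mpr le_top)
  have hD : HasFDerivAt (fun e' => (chartForm η (g e) (G e')).comp (fderiv ℝ G e')) _ e :=
    (hχ.hasFDerivAt.comp e hGd.hasFDerivAt).clm_comp hG2.hasFDerivAt
  have hD' := (hD.congr_of_eventuallyEq (pullForm_eventuallyEq_chart hg)).fderiv
  rw [hD', extD_apply]
  refine Eq.trans ?_ (congrArg₂ (fun a b : Euc m =>
    chartDeriv η (g e) a b - chartDeriv η (g e) b a) (hdG v) (hdG w)).symm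
  have hs : fderiv ℝ (fderiv ℝ G) e v w = fderiv ℝ (fderiv ℝ G) e w v := hsymm v w
  have hc : chartDeriv η (g e) = fderiv ℝ (chartForm η (g e)) (G e) := rfl
  rw [hc]
  simp only [add_apply, ContinuousLinearMap.comp_apply,
    ContinuousLinearMap.compL_apply, ContinuousLinearMap.flip_apply, hs]
  ring

end PullForm

/-! ### Local normal forms of immersions and submersions -/

section LocalForms

variable {m d r : ℕ}
  {M : Type*} [TopologicalSpace M] [ChartedSpace (Euc m) M]
  {N : Type*} [TopologicalSpace N] [ChartedSpace (Euc d) N]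
  {Q : Type*} [TopologicalSpace Q] [ChartedSpace (Euc r) Q]

lemma contMDiffAt_symm_of_mem_maximalAtlas {φ : OpenPartialHomeomorph M (Euc m)}
    (hφ : φ ∈ IsManifold.maximalAtlas (𝓡 m) ∞ M) {e : Euc m} (he : e ∈ φ.target) :
    ContMDiffAt 𝓘(ℝ, Euc m) (𝓡 m) ∞ φ.symm e :=
  (contMDiffOn_symm_of_mem_maximalAtlas hφ).contMDiffAt (φ.open_target.mem_nhds he)

lemma contMDiffAt_of_mem_maximalAtlas' {φ : OpenPartialHomeomorph M (Euc m)}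
    (hφ : φ ∈ IsManifold.maximalAtlas (𝓡 m) ∞ M) {x : M} (hx : x ∈ φ.source) :
    ContMDiffAt (𝓡 m) 𝓘(ℝ, Euc m) ∞ φ x :=
  (contMDiffOn_of_mem_maximalAtlas hφ).contMDiffAt (φ.open_source.mem_nhds hx)

/-- The differential of an immersion is injective. -/
lemma mfderiv_injective_of_isImmersionAt {ι : N → M} {x : N}
    (h : Manifold.IsImmersionAt (𝓡 d) (𝓡 m) ∞ ι x) :
    Function.Injective (mfderiv (𝓡 d) (𝓡 m) ι x) := by
  set φ := h.domChart with hφ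
  set ψ := h.codChart with hψ
  have hw : ∀ y ∈ φ.source, ψ (ι y) = h.equiv (φ y, 0) := fun y hy => by
    have hy' : φ y ∈ (h.domChart.extend (𝓡 d)).target := by
      simpa [hφ] using φ.map_source hy
    have := h.writtenInCharts hy'
    simpa [← hφ, ← hψ, φ.left_inv hy] using this
  have hx : x ∈ φ.source := h.mem_domChart_source
  have hdφ : ContMDiffAt (𝓡 d) 𝓘(ℝ, Euc d) ∞ φ x :=
    contMDiffAt_of_mem_maximalAtlas' h.domChart_mem_maximalAtlas hx
  have hdψ : ContMDiffAt (𝓡 m) 𝓘(ℝ, Euc m) ∞ ψ (ι x) :=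
    contMDiffAt_of_mem_maximalAtlas' h.codChart_mem_maximalAtlas h.mem_codChart_source
  set l : Euc m → Euc d := fun e => (h.equiv.symm e).1 with hl
  have hdl : ContMDiff 𝓘(ℝ, Euc m) 𝓘(ℝ, Euc d) ∞ l := by
    rw [contMDiff_iff_contDiff]
    exact contDiff_fst.comp h.equiv.symm.contDiff
  have hdφs : ContMDiffAt 𝓘(ℝ, Euc d) (𝓡 d) ∞ φ.symm (φ x) :=
    contMDiffAt_symm_of_mem_maximalAtlas h.domChart_mem_maximalAtlas (φ.map_source hx)
  have hlx : l (ψ (ι x)) = φ x := by rw [hw x hx, hl]; simp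
  -- A local left inverse of `ι`: in the adapted charts it forgets the complementary coordinate.
  set ρ : M → N := φ.symm ∘ l ∘ ψ with hρ
  have hdρ : ContMDiffAt (𝓡 m) (𝓡 d) ∞ ρ (ι x) := by
    refine ContMDiffAt.comp (I' := 𝓘(ℝ, Euc d)) (ι x) ?_
      (hdl.contMDiffAt.comp (I' := 𝓘(ℝ, Euc m)) (ι x) hdψ)
    simpa only [Function.comp_apply, hlx] using hdφs
  have heq : ρ ∘ ι =ᶠ[𝓝 x] id := by
    filter_upwards [φ.open_source.mem_nhds hx] with y hy
    simp only [hρ, Function.comp_apply, hw y hy, hl, ContinuousLinearEquiv.symm_apply_apply, id]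
    exact φ.left_inv hy
  have hd := mfderiv_comp x (hdρ.mdifferentiableAt (by simp))
    (h.contMDiffAt.mdifferentiableAt (by simp))
  rw [heq.mfderiv_eq, mfderiv_id] at hd
  have hinv : ∀ u : TangentSpace (𝓡 d) x, (u : Euc d) =
      mfderiv (𝓡 m) (𝓡 d) ρ (ι x) (mfderiv (𝓡 d) (𝓡 m) ι x u) := fun u =>
    congrArg (fun A : Euc d →L[ℝ] Euc d => A u) hd
  intro u v huv
  exact (hinv u).trans ((congrArg _ huv).trans (hinv v).symm)

/-- Coordinates adapted to a submersion. -/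
lemma exists_submersion_coordinates {π : N → Q} {x₀ : N}
    (h : Manifold.IsSubmersionAt (𝓡 d) (𝓡 r) ∞ π x₀) :
    ∃ (F : Type) (_ : NormedAddCommGroup F) (_ : NormedSpace ℝ F)
      (φ : OpenPartialHomeomorph N (Euc r × F)) (ψ : OpenPartialHomeomorph Q (Euc r)),
      x₀ ∈ φ.source ∧ ψ ∈ IsManifold.maximalAtlas (𝓡 r) ∞ Q ∧
      ContMDiffOn (𝓡 d) 𝓘(ℝ, Euc r × F) ∞ φ φ.source ∧
      ContMDiffOn 𝓘(ℝ, Euc r × F) (𝓡 d) ∞ φ.symm φ.target ∧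
      ∀ x ∈ φ.source, π x ∈ ψ.source ∧ ψ (π x) = (φ x).1 := by
  refine ⟨h.complement, inferInstance, inferInstance,
    h.domChart.transHomeomorph h.equiv.toHomeomorph, h.codChart, h.mem_domChart_source,
    h.codChart_mem_maximalAtlas, ?_, ?_, fun x hx => ⟨h.source_subset_preimage_source hx, ?_⟩⟩
  · have he : ContMDiff 𝓘(ℝ, Euc d) 𝓘(ℝ, Euc r × h.complement) ∞ h.equiv :=
      contMDiff_iff_contDiff.mpr h.equiv.contDiff
    exact he.comp_contMDiffOn (contMDiffOn_of_mem_maximalAtlas h.domChart_mem_maximalAtlas)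
  · have he : ContMDiff 𝓘(ℝ, Euc r × h.complement) 𝓘(ℝ, Euc d) ∞ h.equiv.symm :=
      contMDiff_iff_contDiff.mpr h.equiv.symm.contDiff
    exact (contMDiffOn_symm_of_mem_maximalAtlas h.domChart_mem_maximalAtlas).comp
      he.contMDiffOn (fun c hc => by simpa using hc)
  · have hx' : x ∈ h.domChart.source := hx
    have hx'' : h.domChart x ∈ (h.domChart.extend (𝓡 d)).target := by
      simpa using h.domChart.map_source hx'
    have := h.writtenInCharts hx''
    simpa [h.domChart.left_inv hx'] using this

/-- A submersion has local sections through every point. -/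
lemma exists_local_section {π : N → Q} {x₀ : N}
    (h : Manifold.IsSubmersionAt (𝓡 d) (𝓡 r) ∞ π x₀) :
    ∃ (U : Set Q) (s : Q → N), IsOpen U ∧ π x₀ ∈ U ∧ s (π x₀) = x₀ ∧
      ContMDiffOn (𝓡 r) (𝓡 d) ∞ s U ∧ ∀ q ∈ U, π (s q) = q := by
  obtain ⟨F, _, _, φ, ψ, hx₀, hψ, hφ, hφs, hπ⟩ := exists_submersion_coordinates h
  -- The section keeps the fibre coordinate of `x₀`.
  set j : Euc r → Euc r × F := fun e => (e, (φ x₀).2) with hj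
  have hjc : Continuous j := by fun_prop
  have hj₀ : j (ψ (π x₀)) = φ x₀ := by rw [(hπ x₀ hx₀).2]
  refine ⟨ψ.source ∩ ψ ⁻¹' (j ⁻¹' φ.target), fun q => φ.symm (j (ψ q)),
    ψ.isOpen_inter_preimage (φ.open_target.preimage hjc), ⟨(hπ x₀ hx₀).1, ?_⟩, ?_, ?_, ?_⟩
  · change j (ψ (π x₀)) ∈ φ.target
    rw [hj₀]; exact φ.map_source hx₀
  · change φ.symm (j (ψ (π x₀))) = x₀
    rw [hj₀]; exact φ.left_inv hx₀
  · refine hφs.comp (t := φ.target) ?_ (fun q hq => hq.2)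
    have hjs : ContMDiff 𝓘(ℝ, Euc r) 𝓘(ℝ, Euc r × F) ∞ j :=
      contMDiff_iff_contDiff.mpr (by fun_prop)
    exact hjs.comp_contMDiffOn
      ((contMDiffOn_of_mem_maximalAtlas hψ).mono Set.inter_subset_left)
  · rintro q ⟨hq, hq'⟩
    have hs := φ.map_target hq'
    obtain ⟨h1, h2⟩ := hπ _ hs
    rw [φ.right_inv hq'] at h2
    exact ψ.injOn h1 hq h2

lemma mfderiv_comp_section {π : N → Q} {s : Q → N} {q : Q}
    (hπ : ContMDiffAt (𝓡 d) (𝓡 r) ∞ π (s q)) (hs : ContMDiffAt (𝓡 r) (𝓡 d) ∞ s q)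
    (h : π ∘ s =ᶠ[𝓝 q] id) (v : Euc r) :
    (mfderiv (𝓡 d) (𝓡 r) π (s q) (mfderiv (𝓡 r) (𝓡 d) s q v) : Euc r) = v := by
  have hd := mfderiv_comp q (hπ.mdifferentiableAt (by simp)) (hs.mdifferentiableAt (by simp))
  rw [h.mfderiv_eq, mfderiv_id] at hd
  exact (congrArg (fun A : Euc r →L[ℝ] Euc r => A v) hd).symm

lemma mfderiv_surjective_of_isSubmersionAt {π : N → Q} {x : N}
    (h : Manifold.IsSubmersionAt (𝓡 d) (𝓡 r) ∞ π x) :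
    Function.Surjective (mfderiv (𝓡 d) (𝓡 r) π x) := by
  obtain ⟨U, s, hU, hx, hsx, hs, hπs⟩ := exists_local_section h
  intro v
  have := mfderiv_comp_section (π := π) (s := s) (q := π x) (by rw [hsx]; exact h.contMDiffAt)
    (hs.contMDiffAt (hU.mem_nhds hx)) (by filter_upwards [hU.mem_nhds hx] using hπs) v
  rw [hsx] at this
  exact ⟨_, this⟩

end LocalForms

/-! ### One-forms along the fibres of a product -/

section Rays

variable {E F : Type*} [NormedAddCommGroup E] [NormedSpace ℝ E]
  [NormedAddCommGroup F] [NormedSpace ℝ F]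

lemma const_right_of_fderiv_eq_zero {G : Type*} [NormedAddCommGroup G] [NormedSpace ℝ G]
    {b : E × F → G} {e : E} {B : Set F} (hB : IsOpen B)
    (hB' : Convex ℝ B) (hb : ∀ z ∈ B, DifferentiableAt ℝ b (e, z))
    (hd : ∀ z ∈ B, ∀ z', fderiv ℝ b (e, z) (0, z') = 0) {z z' : F} (hz : z ∈ B) (hz' : z' ∈ B) :
    b (e, z) = b (e, z') := by
  have hd' : ∀ z ∈ B, HasFDerivAt (fun z => b (e, z)) (0 : F →L[ℝ] G) z := by
    intro z hz
    have h1 := (hb z hz).hasFDerivAt.comp z (hasFDerivAt_prodMk_right e z)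
    have h2 : (fderiv ℝ b (e, z)).comp (ContinuousLinearMap.inr ℝ E F) = 0 :=
      ContinuousLinearMap.ext fun z' => by simpa using hd z hz z'
    rwa [h2] at h1
  exact hB.is_const_of_fderiv_eq_zero hB'.isPreconnected
    (fun z hz => (hd' z hz).differentiableAt.differentiableWithinAt)
    (fun z hz => (hd' z hz).fderiv) hz hz'

/-- In `dα(v, w) = A(v)(w) - A(w)(v)`, with `A` the derivative of `α`, this removes the second term
when `α` kills `v` nearby; what is left is the derivative of `α` along `v`. -/
lemma fderiv_apply_eq_zero {α : E → E →L[ℝ] ℝ} {c v : E} (hα : DifferentiableAt ℝ α c)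
    (h : ∀ᶠ c' in 𝓝 c, α c' v = 0) (w : E) : fderiv ℝ α c w v = 0 := by
  have h1 : HasFDerivAt (fun c' => α c' v) ((fderiv ℝ α c).flip v) c :=
    (ContinuousLinearMap.apply ℝ ℝ v).hasFDerivAt.comp c hα.hasFDerivAt
  have h2 : HasFDerivAt (fun c' => α c' v) (0 : E →L[ℝ] ℝ) c :=
    (hasFDerivAt_const (0 : ℝ) c).congr_of_eventuallyEq h
  have := h1.unique h2
  exact congrArg (fun A : E →L[ℝ] ℝ => A w) this

/-- A one-form on a product which kills the second factor, and whose exterior derivative pairs the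
second factor trivially with the kernel of the form, keeps its ray along the second factor. -/
lemma exists_nhds_form_ray {α : E × F → E × F →L[ℝ] ℝ} {c₀ : E × F} {O : Set (E × F)}
    (hO : O ∈ 𝓝 c₀) (hα : ∀ c ∈ O, DifferentiableAt ℝ α c) (h0 : α c₀ ≠ 0)
    (hker : ∀ c ∈ O, ∀ z, α c (0, z) = 0)
    (hd : ∀ c ∈ O, ∀ z w, α c w = 0 → fderiv ℝ α c (0, z) w - fderiv ℝ α c w (0, z) = 0) :
    ∃ O' ∈ 𝓝 c₀, ∀ c ∈ O', ∀ c' ∈ O', c.1 = c'.1 → ∃ t : ℝ, 0 < t ∧ α c = t • α c' := by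
  obtain ⟨w₀, hw₀⟩ : ∃ w₀, 0 < α c₀ w₀ := by
    obtain ⟨w, hw⟩ : ∃ w, α c₀ w ≠ 0 := by
      by_contra! hc
      exact h0 (ContinuousLinearMap.ext hc)
    rcases hw.lt_or_gt with h | h
    · exact ⟨-w, by simpa using h⟩
    · exact ⟨w, h⟩
  have hcont : ContinuousAt (fun c => α c w₀) c₀ :=
    ((hα c₀ (mem_of_mem_nhds hO)).continuousAt).clm_apply continuousAt_const
  have hmem : O ∩ {c | 0 < α c w₀} ∈ 𝓝 c₀ :=
    Filter.inter_mem hO (hcont.eventually (lt_mem_nhds hw₀))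
  obtain ⟨ε, hε, hball⟩ := Metric.mem_nhds_iff.mp hmem
  refine ⟨Metric.ball c₀ ε, Metric.ball_mem_nhds c₀ hε, fun c hc c' hc' hcc' => ?_⟩
  obtain ⟨e, z⟩ := c
  obtain ⟨e', z'⟩ := c'
  obtain rfl : e = e' := hcc'
  rw [← ball_prod_same] at hc hc'
  have hin : ∀ y ∈ Metric.ball c₀.2 ε, (e, y) ∈ O ∩ {c | 0 < α c w₀} := fun y hy =>
    hball (by rw [← ball_prod_same]; exact ⟨hc.1, hy⟩)
  have hOnhds : ∀ y ∈ Metric.ball c₀.2 ε, ∀ᶠ c in 𝓝 (e, y), c ∈ O := fun y hy =>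
    Filter.mem_of_superset (Metric.isOpen_ball.mem_nhds
      (by rw [← ball_prod_same]; exact ⟨hc.1, hy⟩)) fun a ha => (hball ha).1
  -- The ray is constant if `α`, normalized to have value `1` at `w₀`, is constant. Balls of the
  -- product are products of balls, so the slices are convex.
  have key := const_right_of_fderiv_eq_zero (b := fun c => (α c w₀)⁻¹ • α c) (e := e)
    (Metric.isOpen_ball (x := c₀.2) (ε := ε)) (convex_ball _ _) ?_ ?_ hc.2 hc'.2
  · have h1 := (hin z hc.2).2
    have h2 := (hin z' hc'.2).2
    simp only [Set.mem_ofPred_eq] at h1 h2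
    refine ⟨α (e, z) w₀ * (α (e, z') w₀)⁻¹, by positivity, ?_⟩
    have key' : (α (e, z) w₀)⁻¹ • α (e, z) = (α (e, z') w₀)⁻¹ • α (e, z') := key
    rw [mul_smul, ← key', smul_smul, mul_inv_cancel₀ h1.ne', one_smul]
  · intro y hy
    have hy' := hin y hy
    have hdiff := hα _ hy'.1
    exact ((hdiff.clm_apply (differentiableAt_const w₀)).inv hy'.2.ne').smul hdiff
  · intro y hy z'
    have hy' := hin y hy
    have hdiff := hα _ hy'.1
    have hpos : 0 < α (e, y) w₀ := hy'.2
    have hA : ∀ w, α (e, y) w = 0 → fderiv ℝ α (e, y) (0, z') w = 0 := fun w hw => by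
      have h1 := hd _ hy'.1 z' w hw
      rwa [fderiv_apply_eq_zero hdiff ((hOnhds y hy).mono fun c hc => hker c hc z'),
        sub_zero] at h1
    -- The derivative along the fibre kills `ker α`, hence is a multiple of `α`; the ratio is read
    -- off at `w₀`.
    have hA' : ∀ w, fderiv ℝ α (e, y) (0, z') w * α (e, y) w₀ =
        fderiv ℝ α (e, y) (0, z') w₀ * α (e, y) w := fun w => by
      have := hA (w - (α (e, y) w / α (e, y) w₀) • w₀) (by
        simp [div_mul_cancel₀ _ hpos.ne'])
      simp only [map_sub, map_smul, smul_eq_mul] at this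
      field_simp at this
      linarith
    have hw : HasFDerivAt (fun c => α c w₀) ((fderiv ℝ α (e, y)).flip w₀) (e, y) :=
      (ContinuousLinearMap.apply ℝ ℝ w₀).hasFDerivAt.comp (e, y) hdiff.hasFDerivAt
    have hi : HasFDerivAt (fun c => (α c w₀)⁻¹) _ (e, y) :=
      (hasDerivAt_inv hpos.ne').comp_hasFDerivAt (e, y) hw
    have htot : HasFDerivAt (fun c => (α c w₀)⁻¹ • α c) _ (e, y) := hi.smul hdiff.hasFDerivAt
    rw [htot.fderiv]
    refine ContinuousLinearMap.ext fun w => ?_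
    have := hA' w
    simp only [add_apply, smul_apply,
      ContinuousLinearMap.smulRight_apply, ContinuousLinearMap.flip_apply, smul_eq_mul,
      zero_apply]
    field_simp
    linarith

/-- A one-form on a product which kills the second factor, and whose exterior derivative with
vectors of the second factor vanishes, is constant along the second factor. -/
lemma exists_nhds_form_const {α : E × F → E × F →L[ℝ] ℝ} {c₀ : E × F} {O : Set (E × F)}
    (hO : O ∈ 𝓝 c₀) (hα : ∀ c ∈ O, DifferentiableAt ℝ α c)
    (hker : ∀ c ∈ O, ∀ z, α c (0, z) = 0)
    (hd : ∀ c ∈ O, ∀ z w, fderiv ℝ α c (0, z) w - fderiv ℝ α c w (0, z) = 0) :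
    ∃ O' ∈ 𝓝 c₀, ∀ c ∈ O', ∀ c' ∈ O', c.1 = c'.1 → α c = α c' := by
  obtain ⟨ε, hε, hball⟩ := Metric.mem_nhds_iff.mp hO
  refine ⟨Metric.ball c₀ ε, Metric.ball_mem_nhds c₀ hε, fun c hc c' hc' hcc' => ?_⟩
  obtain ⟨e, z⟩ := c
  obtain ⟨e', z'⟩ := c'
  obtain rfl : e = e' := hcc'
  rw [← ball_prod_same] at hc hc'
  have hin : ∀ y ∈ Metric.ball c₀.2 ε, (e, y) ∈ Metric.ball c₀ ε := fun y hy => by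
    rw [← ball_prod_same]; exact ⟨hc.1, hy⟩
  refine const_right_of_fderiv_eq_zero (Metric.isOpen_ball (x := c₀.2) (ε := ε))
    (convex_ball _ _) (fun y hy => hα _ (hball (hin y hy))) (fun y hy z' => ?_) hc.2 hc'.2
  refine ContinuousLinearMap.ext fun w => ?_
  have h1 := hd _ (hball (hin y hy)) z' w
  rwa [fderiv_apply_eq_zero (hα _ (hball (hin y hy)))
    (Filter.mem_of_superset (Metric.isOpen_ball.mem_nhds (hin y hy))
      fun c hc => hker c (hball hc) z'), sub_zero] at h1

end Rays

/-! ### The covector induced on the quotient, and its behaviour along fibres -/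

section Covectors

variable {m d r : ℕ}
  {M : Type*} [TopologicalSpace M] [ChartedSpace (Euc m) M]
  {N : Type*} [TopologicalSpace N] [ChartedSpace (Euc d) N]
  {Q : Type*} [TopologicalSpace Q] [ChartedSpace (Euc r) Q]
  {η : ∀ x : M, TangentSpace (𝓡 m) x →L[ℝ] ℝ} {ι : N → M} {π : N → Q}

lemma finrank_tangentSpace (x : M) : Module.finrank ℝ (TangentSpace (𝓡 m) x) = m := by
  change Module.finrank ℝ (Euc m) = m
  simp

lemma IsContactForm.isContactPair (hη : IsContactForm η) (x : M) :
    IsContactPair (η x).toLinearMap (extD η x) := by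
  obtain ⟨-, n, hn, h⟩ := hη
  obtain ⟨v, hv⟩ := h x
  exact isContactPair_of_wedgePow_ne_zero ((finrank_tangentSpace x).trans hn) (extD_self x) hv

/-- One point is needed to read off the parity of `m`; the resulting `n` then serves all points. -/
lemma isContactForm_of_isContactPair [Nonempty M] (hη : IsSmoothForm η)
    (h : ∀ x, IsContactPair (η x).toLinearMap (extD η x)) : IsContactForm η := by
  refine ⟨hη, ?_⟩
  obtain ⟨n, hn, -⟩ := (h (Classical.arbitrary M)).exists_wedgePow_ne_zero
  rw [finrank_tangentSpace] at hn
  refine ⟨n, hn, fun x => ?_⟩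
  obtain ⟨n', hn', hv⟩ := (h x).exists_wedgePow_ne_zero
  rw [finrank_tangentSpace] at hn'
  obtain rfl : n = n' := by omega
  exact hv

/-- The hypotheses of contact reduction: `ι : N → M` is a coisotropic submanifold without
horizontal points of a contact manifold and `π : N → Q` is the quotient by its characteristic
distribution. -/
structure IsContactReduction (η : ∀ x : M, TangentSpace (𝓡 m) x →L[ℝ] ℝ) (ι : N → M)
    (π : N → Q) : Prop where
  contactForm : IsContactForm η
  coisotropic : IsCoisotropic (d := d) η ι
  nonhorizontal : ∀ x : N, ¬ IsHorizontal η (ι x) (tangentOf (d := d) ι x)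
  leafQuotient : IsLeafQuotient (d := d) (r := r) (charDistribution η ι) π

namespace IsContactReduction

lemma contact (h : IsContactReduction (d := d) (r := r) η ι π) (x : M) :
    IsContactPair (η x).toLinearMap (extD η x) := h.contactForm.isContactPair x

lemma exists_ne_zero (h : IsContactReduction (d := d) (r := r) η ι π) (x : N) :
    ∃ u, η (ι x) (mfderiv (𝓡 d) (𝓡 m) ι x u) ≠ 0 := by
  by_contra! hc
  refine h.nonhorizontal x (le_antisymm (fun v hv => ⟨hv, ?_⟩) inf_le_left)
  obtain ⟨u, rfl⟩ := hv
  exact hc u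

lemma contMDiff_inclusion (h : IsContactReduction (d := d) (r := r) η ι π) :
    ContMDiff (𝓡 d) (𝓡 m) ∞ ι := h.coisotropic.1.contMDiff

lemma contMDiff_projection (h : IsContactReduction (d := d) (r := r) η ι π) :
    ContMDiff (𝓡 d) (𝓡 r) ∞ π := h.leafQuotient.submersion.contMDiff

lemma mfderiv_projection_surjective (h : IsContactReduction (d := d) (r := r) η ι π) (x : N) :
    Function.Surjective (mfderiv (𝓡 d) (𝓡 r) π x) :=
  mfderiv_surjective_of_isSubmersionAt (h.leafQuotient.submersion.isSubmersionAt x)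

lemma projection_surjective (h : IsContactReduction (d := d) (r := r) η ι π) :
    Function.Surjective π := fun q => (h.leafQuotient.connected_fibre q).1

lemma mfderiv_projection_eq_zero_iff (h : IsContactReduction (d := d) (r := r) η ι π) (x : N)
    (u : TangentSpace (𝓡 d) x) : mfderiv (𝓡 d) (𝓡 r) π x u = 0 ↔
      η (ι x) (mfderiv (𝓡 d) (𝓡 m) ι x u) = 0 ∧
      ∀ w, η (ι x) (mfderiv (𝓡 d) (𝓡 m) ι x w) = 0 →
        extD η (ι x) (mfderiv (𝓡 d) (𝓡 m) ι x u) (mfderiv (𝓡 d) (𝓡 m) ι x w) = 0 := by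
  have h1 : mfderiv (𝓡 d) (𝓡 r) π x u = 0 ↔
      u ∈ LinearMap.ker (mfderiv (𝓡 d) (𝓡 r) π x).toLinearMap := Iff.rfl
  rw [h1, h.leafQuotient.ker_eq x, charDistribution, Submodule.mem_comap, contactCompl,
    (h.contact (ι x)).mem_complement_iff]
  refine and_congr Iff.rfl ⟨fun H w => H _ ⟨w, rfl⟩, ?_⟩
  rintro H _ ⟨w, rfl⟩
  exact H w

/-- With the Reeb vector tangent to `N`, any `w` can be moved into `ker η` by a multiple of it,
which changes no value of `dη`. -/
lemma extD_eq_zero_of_isVertical (h : IsContactReduction (d := d) (r := r) η ι π) {x : N}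
    (hv : IsVertical η (ι x) (tangentOf (d := d) ι x)) {u : TangentSpace (𝓡 d) x}
    (hu : mfderiv (𝓡 d) (𝓡 r) π x u = 0) (w : TangentSpace (𝓡 d) x) :
    extD η (ι x) (mfderiv (𝓡 d) (𝓡 m) ι x u) (mfderiv (𝓡 d) (𝓡 m) ι x w) = 0 := by
  obtain ⟨hR, hΩR⟩ := (h.contact (ι x)).reeb_spec
  have hmem : reeb (η (ι x)).toLinearMap (extD η (ι x)) ∈ tangentOf (d := d) ι x := by
    rw [hv]
    exact Submodule.mem_sup_right (Submodule.mem_span_singleton_self _)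
  obtain ⟨ρ, hρ⟩ := hmem
  have hρ' : mfderiv (𝓡 d) (𝓡 m) ι x ρ = reeb (η (ι x)).toLinearMap (extD η (ι x)) := hρ
  set a := η (ι x) (mfderiv (𝓡 d) (𝓡 m) ι x w) with ha
  have hR' : η (ι x) (reeb (η (ι x)).toLinearMap (extD η (ι x))) = 1 := hR
  have h1 := ((h.mfderiv_projection_eq_zero_iff x u).mp hu).2 (w - a • ρ) (by
    rw [map_sub, map_smul, hρ', map_sub, map_smul, hR', ← ha]
    simp)
  rw [map_sub, map_smul, hρ', map_sub, map_smul, alt_swap (extD_self (ι x)) _ (reeb _ _), hΩR,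
    neg_zero, smul_zero, sub_zero] at h1
  exact h1

/-- The one-form `η` restricted to `N` induces a covector on the quotient at every point. -/
lemma exists_covector (h : IsContactReduction (d := d) (r := r) η ι π) :
    ∃ β : N → Euc r →L[ℝ] ℝ, ∀ x u, β x (mfderiv (𝓡 d) (𝓡 r) π x u) =
      η (ι x) (mfderiv (𝓡 d) (𝓡 m) ι x u) := by
  have hx : ∀ x, ∃ β : Euc r →L[ℝ] ℝ, ∀ u, β (mfderiv (𝓡 d) (𝓡 r) π x u) =
      η (ι x) (mfderiv (𝓡 d) (𝓡 m) ι x u) := by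
    intro x
    -- The covector is `ι^*η ∘ s` for a linear right inverse `s` of `dπ`; two lifts of a vector
    -- differ by an element of `ker dπ`, which `ι^*η` kills.
    obtain ⟨s, hs⟩ := (mfderiv (𝓡 d) (𝓡 r) π x).toLinearMap.exists_rightInverse_of_surjective
      (LinearMap.range_eq_top.mpr (h.mfderiv_projection_surjective x))
    refine ⟨LinearMap.toContinuousLinearMap (E := Euc r) (((η (ι x)).comp
      (mfderiv (𝓡 d) (𝓡 m) ι x)).toLinearMap ∘ₗ s), fun u => ?_⟩
    set v := s (mfderiv (𝓡 d) (𝓡 r) π x u) with hv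
    have h1 : mfderiv (𝓡 d) (𝓡 r) π x v = mfderiv (𝓡 d) (𝓡 r) π x u :=
      LinearMap.congr_fun hs _
    have h2 : mfderiv (𝓡 d) (𝓡 r) π x (v - u) = 0 := by rw [map_sub, h1, sub_self]
    have h3 := ((h.mfderiv_projection_eq_zero_iff x _).mp h2).1
    rw [map_sub, map_sub, sub_eq_zero] at h3
    exact h3
  choose β hβ using hx
  exact ⟨β, hβ⟩

variable [IsManifold (𝓡 m) ∞ M] {β : N → Euc r →L[ℝ] ℝ}

/-- In coordinates adapted to the projection, `η` restricted to `N` is a form which kills the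
second factor, and its values are the covectors on the quotient. -/
lemma exists_coordinates (h : IsContactReduction (d := d) (r := r) η ι π)
    (hβ : ∀ x u, β x (mfderiv (𝓡 d) (𝓡 r) π x u) = η (ι x) (mfderiv (𝓡 d) (𝓡 m) ι x u))
    (x₀ : N) :
    ∃ (F : Type) (_ : NormedAddCommGroup F) (_ : NormedSpace ℝ F)
      (φ : OpenPartialHomeomorph N (Euc r × F)) (T : Euc r → Euc r →L[ℝ] Euc r)
      (α : Euc r × F → Euc r × F →L[ℝ] ℝ), x₀ ∈ φ.source ∧
      (∀ x ∈ φ.source, ∀ y ∈ φ.source, π x = π y → (φ x).1 = (φ y).1) ∧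
      (∀ x ∈ φ.source, Function.Surjective (T (φ x).1)) ∧
      (∀ c ∈ φ.target, DifferentiableAt ℝ α c) ∧
      (∀ c ∈ φ.target, ∀ w, α c w = β (φ.symm c) (T c.1 w.1)) ∧
      (∀ c ∈ φ.target, ∀ z, ∃ u, mfderiv (𝓡 d) (𝓡 r) π (φ.symm c) u = 0 ∧ ∀ w, ∃ w',
        α c w = η (ι (φ.symm c)) (mfderiv (𝓡 d) (𝓡 m) ι (φ.symm c) w') ∧
        fderiv ℝ α c (0, z) w - fderiv ℝ α c w (0, z) =
          extD η (ι (φ.symm c)) (mfderiv (𝓡 d) (𝓡 m) ι (φ.symm c) u)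
            (mfderiv (𝓡 d) (𝓡 m) ι (φ.symm c) w')) := by
  obtain ⟨F, i1, i2, φ, ψ, hx₀, hψ, hφ, hφs, hπ⟩ :=
    exists_submersion_coordinates (h.leafQuotient.submersion.isSubmersionAt x₀)
  have hsm : ∀ c ∈ φ.target, ContMDiffAt 𝓘(ℝ, Euc r × F) (𝓡 d) ∞ φ.symm c := fun c hc =>
    hφs.contMDiffAt (φ.open_target.mem_nhds hc)
  have hg : ∀ c ∈ φ.target, ContMDiffAt 𝓘(ℝ, Euc r × F) (𝓡 m) ∞ (ι ∘ φ.symm) c := fun c hc =>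
    (h.contMDiff_inclusion _).comp c (hsm c hc)
  have hdg : ∀ c ∈ φ.target, ∀ w, (mfderiv 𝓘(ℝ, Euc r × F) (𝓡 m) (ι ∘ φ.symm) c w : Euc m) =
      mfderiv (𝓡 d) (𝓡 m) ι (φ.symm c) (mfderiv 𝓘(ℝ, Euc r × F) (𝓡 d) φ.symm c w) := by
    intro c hc w
    rw [mfderiv_comp c ((h.contMDiff_inclusion _).mdifferentiableAt (by simp))
      ((hsm c hc).mdifferentiableAt (by simp))]
    rfl
  have hψt : ∀ c ∈ φ.target, c.1 ∈ ψ.target ∧ π (φ.symm c) = ψ.symm c.1 := fun c hc => by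
    obtain ⟨h1, h2⟩ := hπ _ (φ.map_target hc)
    rw [φ.right_inv hc] at h2
    rw [← h2]
    exact ⟨ψ.map_source h1, (ψ.left_inv h1).symm⟩
  have hdπ : ∀ c ∈ φ.target, ∀ w, (mfderiv (𝓡 d) (𝓡 r) π (φ.symm c)
      (mfderiv 𝓘(ℝ, Euc r × F) (𝓡 d) φ.symm c w) : Euc r) =
      mfderiv 𝓘(ℝ, Euc r) (𝓡 r) ψ.symm c.1 w.1 := by
    intro c hc w
    have h1 := mfderiv_comp c ((h.contMDiff_projection _).mdifferentiableAt (by simp))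
      ((hsm c hc).mdifferentiableAt (by simp))
    have h2 : π ∘ φ.symm =ᶠ[𝓝 c] ψ.symm ∘ Prod.fst := by
      filter_upwards [φ.open_target.mem_nhds hc] with c' hc' using (hψt c' hc').2
    have h3 : MDifferentiableAt 𝓘(ℝ, Euc r) (𝓡 r) ψ.symm c.1 :=
      (contMDiffAt_symm_of_mem_maximalAtlas hψ (hψt c hc).1).mdifferentiableAt (by simp)
    have h5 : MDifferentiableAt 𝓘(ℝ, Euc r × F) 𝓘(ℝ, Euc r) (Prod.fst : Euc r × F → Euc r) c :=
      differentiableAt_fst.mdifferentiableAt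
    have h4 := mfderiv_comp c h3 h5
    have h6 : mfderiv 𝓘(ℝ, Euc r × F) 𝓘(ℝ, Euc r) (Prod.fst : Euc r × F → Euc r) c =
        ContinuousLinearMap.fst ℝ (Euc r) F := by
      rw [mfderiv_eq_fderiv, fderiv_fst]
    rw [h6] at h4
    have h7 := h2.mfderiv_eq (I := 𝓘(ℝ, Euc r × F)) (I' := 𝓡 r)
    have h8 : ((mfderiv (𝓡 d) (𝓡 r) π (φ.symm c)).comp
        (mfderiv 𝓘(ℝ, Euc r × F) (𝓡 d) φ.symm c) : Euc r × F →L[ℝ] Euc r) =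
        (mfderiv 𝓘(ℝ, Euc r) (𝓡 r) ψ.symm c.1).comp (ContinuousLinearMap.fst ℝ (Euc r) F) :=
      (h1.symm.trans h7).trans h4
    exact congrArg (fun A : Euc r × F →L[ℝ] Euc r => A w) h8
  have hval : ∀ c ∈ φ.target, ∀ w, pullForm η (ι ∘ φ.symm) c w =
      β (φ.symm c) (mfderiv 𝓘(ℝ, Euc r) (𝓡 r) ψ.symm c.1 w.1) := by
    intro c hc w
    rw [← hdπ c hc w]
    refine Eq.trans ?_ (hβ _ _).symm
    exact congrArg (η (ι (φ.symm c))) (hdg c hc w)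
  -- The witness for `T` is the differential of `ψ.symm`. It depends on the first coordinate only,
  -- so comparing `α` along a slice compares `β` along a fibre.
  refine ⟨F, i1, i2, φ, fun e => mfderiv 𝓘(ℝ, Euc r) (𝓡 r) ψ.symm e, pullForm η (ι ∘ φ.symm),
    hx₀, fun x hx y hy hxy => ?_, fun x hx => ?_, fun c hc => ?_, hval, fun c hc z => ?_⟩
  · rw [← (hπ x hx).2, ← (hπ y hy).2, hxy]
  · intro v
    have hc := φ.map_source hx
    have ht := (hψt _ hc).1
    have hψs := ψ.map_target ht
    have h1 := mfderiv_comp (ψ.symm (φ x).1) (I := 𝓡 r) (I' := 𝓘(ℝ, Euc r)) (I'' := 𝓡 r)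
      (g := ψ.symm) (f := ψ) ((contMDiffAt_symm_of_mem_maximalAtlas hψ
        (ψ.map_source hψs)).mdifferentiableAt (by simp))
      ((contMDiffAt_of_mem_maximalAtlas' hψ hψs).mdifferentiableAt (by simp))
    have h2 : ψ.symm ∘ ψ =ᶠ[𝓝 (ψ.symm (φ x).1)] id := by
      filter_upwards [ψ.open_source.mem_nhds hψs] with y hy using ψ.left_inv hy
    rw [h2.mfderiv_eq, mfderiv_id] at h1
    have h3 := congrArg (fun A : Euc r →L[ℝ] Euc r => A v) h1
    rw [ψ.right_inv ht] at h3
    exact ⟨_, h3.symm⟩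
  · exact (h.contactForm.1.contDiffAt_pullForm (hg c hc)).differentiableAt (by simp)
  · refine ⟨mfderiv 𝓘(ℝ, Euc r × F) (𝓡 d) φ.symm c (0, z), ?_, fun w =>
      ⟨mfderiv 𝓘(ℝ, Euc r × F) (𝓡 d) φ.symm c w, ?_, ?_⟩⟩
    · refine (hdπ c hc (0, z)).trans ?_
      exact map_zero _
    · exact congrArg (η (ι (φ.symm c))) (hdg c hc w)
    · rw [h.contactForm.1.fderiv_pullForm_sub (hg c hc)]
      exact congrArg₂ (fun a b => extD η (ι (φ.symm c)) a b) (hdg c hc (0, z)) (hdg c hc w)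

/-- The ray of the induced covector is constant along the fibres. -/
lemma covector_ray (h : IsContactReduction (d := d) (r := r) η ι π)
    (hβ : ∀ x u, β x (mfderiv (𝓡 d) (𝓡 r) π x u) = η (ι x) (mfderiv (𝓡 d) (𝓡 m) ι x u))
    {x y : N} (hxy : π x = π y) : ∃ t : ℝ, 0 < t ∧ β x = t • β y := by
  have hloc : ∀ x₀ : N, ∀ᶠ x in 𝓝 x₀, π x = π x₀ → ∃ t : ℝ, 0 < t ∧ β x = t • β x₀ := by
    intro x₀
    obtain ⟨F, _, _, φ, T, α, hx₀, hfst, hT, hα, hval, hd⟩ := h.exists_coordinates hβ x₀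
    have hc₀ := φ.map_source hx₀
    have hker : ∀ c ∈ φ.target, ∀ z, α c (0, z) = 0 := fun c hc z => by
      rw [hval c hc]; simp
    have hval' : ∀ x ∈ φ.source, ∀ w, α (φ x) w = β x (T (φ x).1 w.1) := fun x hx w => by
      rw [hval _ (φ.map_source hx), φ.left_inv hx]
    have hne : α (φ x₀) ≠ 0 := by
      intro h0
      obtain ⟨u, hu⟩ := h.exists_ne_zero x₀
      rw [← hβ] at hu
      obtain ⟨v, hv⟩ := hT x₀ hx₀ (mfderiv (𝓡 d) (𝓡 r) π x₀ u)
      have := hval' x₀ hx₀ (v, 0)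
      rw [h0, hv] at this
      exact hu this.symm
    obtain ⟨O', hO', hray⟩ := exists_nhds_form_ray (φ.open_target.mem_nhds hc₀) hα hne hker
      (fun c hc z w hw => by
        obtain ⟨u, hu, H⟩ := hd c hc z
        obtain ⟨w', h1, h2⟩ := H w
        rw [h2]
        exact ((h.mfderiv_projection_eq_zero_iff _ u).mp hu).2 w' (h1.symm.trans hw))
    filter_upwards [φ.open_source.mem_nhds hx₀, (φ.continuousAt hx₀) hO'] with x hx hxO hπx
    have hfx := hfst x hx x₀ hx₀ hπx
    obtain ⟨t, ht, hαt⟩ := hray _ hxO _ (mem_of_mem_nhds hO') hfx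
    refine ⟨t, ht, ContinuousLinearMap.ext fun v => ?_⟩
    obtain ⟨w, rfl⟩ := hT x hx v
    have h1 := hval' x hx (w, 0)
    have h2 := hval' x₀ hx₀ (w, 0)
    rw [hαt, smul_apply, h2, ← hfx] at h1
    exact h1.symm
  -- Being on the same ray is symmetric and transitive, and holds locally within a fibre, so
  -- connectedness extends it to the whole fibre.
  refine (h.leafQuotient.connected_fibre (π y)).isPreconnected.induction₂
    (fun x y => ∃ t : ℝ, 0 < t ∧ β x = t • β y) (fun x hx => ?_) (fun x y z _ _ _ => ?_)
    (fun x y _ _ => ?_) hxy rfl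
  · filter_upwards [mem_nhdsWithin_of_mem_nhds (hloc x), self_mem_nhdsWithin] with z hz hzf
    obtain ⟨t, ht, hzt⟩ := hz (Eq.trans hzf (Eq.symm hx))
    exact ⟨t⁻¹, by positivity, by rw [hzt, smul_smul, inv_mul_cancel₀ ht.ne', one_smul]⟩
  · rintro ⟨t, ht, h1⟩ ⟨t', ht', h2⟩
    exact ⟨t * t', by positivity, by rw [h1, h2, smul_smul]⟩
  · rintro ⟨t, ht, h1⟩
    exact ⟨t⁻¹, by positivity, by rw [h1, smul_smul, inv_mul_cancel₀ ht.ne', one_smul]⟩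

/-- If all points are vertical, the induced covector is constant along the fibres. -/
lemma covector_eq_of_isVertical (h : IsContactReduction (d := d) (r := r) η ι π)
    (hβ : ∀ x u, β x (mfderiv (𝓡 d) (𝓡 r) π x u) = η (ι x) (mfderiv (𝓡 d) (𝓡 m) ι x u))
    (hv : ∀ x : N, IsVertical η (ι x) (tangentOf (d := d) ι x))
    {x y : N} (hxy : π x = π y) : β x = β y := by
  have hloc : ∀ x₀ : N, ∀ᶠ x in 𝓝 x₀, π x = π x₀ → β x = β x₀ := by
    intro x₀
    obtain ⟨F, _, _, φ, T, α, hx₀, hfst, hT, hα, hval, hd⟩ := h.exists_coordinates hβ x₀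
    have hker : ∀ c ∈ φ.target, ∀ z, α c (0, z) = 0 := fun c hc z => by
      rw [hval c hc]; simp
    have hval' : ∀ x ∈ φ.source, ∀ w, α (φ x) w = β x (T (φ x).1 w.1) := fun x hx w => by
      rw [hval _ (φ.map_source hx), φ.left_inv hx]
    obtain ⟨O', hO', hconst⟩ := exists_nhds_form_const
      (φ.open_target.mem_nhds (φ.map_source hx₀)) hα hker
      (fun c hc z w => by
        obtain ⟨u, hu, H⟩ := hd c hc z
        obtain ⟨w', -, h2⟩ := H w
        rw [h2]
        exact h.extD_eq_zero_of_isVertical (hv _) hu w')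
    filter_upwards [φ.open_source.mem_nhds hx₀, (φ.continuousAt hx₀) hO'] with x hx hxO hπx
    have hfx := hfst x hx x₀ hx₀ hπx
    have hαt := hconst _ hxO _ (mem_of_mem_nhds hO') hfx
    refine ContinuousLinearMap.ext fun v => ?_
    obtain ⟨w, rfl⟩ := hT x hx v
    have h1 := hval' x hx (w, 0)
    have h2 := hval' x₀ hx₀ (w, 0)
    rw [hαt, h2, ← hfx] at h1
    exact h1.symm
  refine (h.leafQuotient.connected_fibre (π y)).isPreconnected.induction₂
    (fun x y => β x = β y) (fun x hx => ?_) (fun x y z _ _ _ => Eq.trans)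
    (fun x y _ _ => Eq.symm) hxy rfl
  filter_upwards [mem_nhdsWithin_of_mem_nhds (hloc x), self_mem_nhdsWithin] with z hz hzf
  exact (hz (Eq.trans hzf (Eq.symm hx))).symm

end IsContactReduction

end Covectors

/-! ### Reduced forms: existence, uniqueness and the contact condition -/

section ReducedForms

variable {m d r : ℕ}
  {M : Type*} [TopologicalSpace M] [ChartedSpace (Euc m) M]
  {N : Type*} [TopologicalSpace N] [ChartedSpace (Euc d) N]
  {Q : Type*} [TopologicalSpace Q] [ChartedSpace (Euc r) Q]
  {η : ∀ x : M, TangentSpace (𝓡 m) x →L[ℝ] ℝ} {ι : N → M} {π : N → Q}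
  {ηQ : ∀ q : Q, TangentSpace (𝓡 r) q →L[ℝ] ℝ} {f : N → ℝ}
  {E : Type*} [NormedAddCommGroup E] [NormedSpace ℝ E]

lemma mfderiv_comp_param {ι : N → M} {g : E → N} {e : E}
    (hι : ContMDiffAt (𝓡 d) (𝓡 m) ∞ ι (g e)) (hg : ContMDiffAt 𝓘(ℝ, E) (𝓡 d) ∞ g e) (v : E) :
    (mfderiv 𝓘(ℝ, E) (𝓡 m) (ι ∘ g) e v : Euc m) =
      mfderiv (𝓡 d) (𝓡 m) ι (g e) (mfderiv 𝓘(ℝ, E) (𝓡 d) g e v) := by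
  rw [mfderiv_comp e (hι.mdifferentiableAt (by simp)) (hg.mdifferentiableAt (by simp))]
  rfl

lemma pullForm_comp_param {ι : N → M} {g : E → N} {e : E}
    (hι : ContMDiffAt (𝓡 d) (𝓡 m) ∞ ι (g e)) (hg : ContMDiffAt 𝓘(ℝ, E) (𝓡 d) ∞ g e) (v : E) :
    pullForm η (ι ∘ g) e v =
      η (ι (g e)) (mfderiv (𝓡 d) (𝓡 m) ι (g e) (mfderiv 𝓘(ℝ, E) (𝓡 d) g e v)) :=
  congrArg (η (ι (g e))) (mfderiv_comp_param hι hg v)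

/-- The source of smoothness on the quotient: `β` is only chosen pointwise, but along a smooth local
section `s` it is the pullback of `η` by `ι ∘ s`. -/
lemma pullForm_section {β : N → Euc r →L[ℝ] ℝ}
    (hβ : ∀ x u, β x (mfderiv (𝓡 d) (𝓡 r) π x u) = η (ι x) (mfderiv (𝓡 d) (𝓡 m) ι x u))
    (hι : ContMDiff (𝓡 d) (𝓡 m) ∞ ι) (hπ : ContMDiff (𝓡 d) (𝓡 r) ∞ π)
    {U : Set Q} {s : Q → N} (hU : IsOpen U) (hs : ContMDiffOn (𝓡 r) (𝓡 d) ∞ s U)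
    (hπs : ∀ q ∈ U, π (s q) = q) {g : E → Q} {e : E} (he : g e ∈ U)
    (hg : ContMDiffAt 𝓘(ℝ, E) (𝓡 r) ∞ g e) (v : E) :
    pullForm η ((ι ∘ s) ∘ g) e v = β (s (g e)) (mfderiv 𝓘(ℝ, E) (𝓡 r) g e v) := by
  have hsa : ContMDiffAt (𝓡 r) (𝓡 d) ∞ s (g e) := hs.contMDiffAt (hU.mem_nhds he)
  have hid : π ∘ s =ᶠ[𝓝 (g e)] id := by filter_upwards [hU.mem_nhds he] using hπs
  have h1 := mfderiv_comp_section (hπ _) hsa hid (mfderiv 𝓘(ℝ, E) (𝓡 r) g e v)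
  refine Eq.trans ?_ (congrArg (β (s (g e))) h1)
  rw [hβ, pullForm_comp_param ((hι _).comp _ hsa) hg]
  have h2 := mfderiv_comp (g e) ((hι (s (g e))).mdifferentiableAt (by simp))
    (hsa.mdifferentiableAt (by simp))
  rw [h2]
  rfl

lemma IsReducedForm.apply_eq (h : IsReducedForm (d := d) η ι π f ηQ) (x : N)
    (u : TangentSpace (𝓡 d) x) : ηQ (π x) (mfderiv (𝓡 d) (𝓡 r) π x u) =
      f x * η (ι x) (mfderiv (𝓡 d) (𝓡 m) ι x u) :=
  congrArg (fun A : TangentSpace (𝓡 d) x →L[ℝ] ℝ => A u) (h.pullback_eq x)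

variable [IsManifold (𝓡 d) ∞ N]

/-- The inverse of the preferred chart at `x`, as a parametrization of a neighbourhood of `x`. -/
lemma exists_param (x : N) : ∃ (g : Euc d → N) (p : N → Euc d), g (p x) = x ∧
    ContMDiffAt 𝓘(ℝ, Euc d) (𝓡 d) ∞ g (p x) ∧ ContMDiffAt (𝓡 d) 𝓘(ℝ, Euc d) ∞ p x ∧
    (∀ᶠ y in 𝓝 x, g (p y) = y) ∧
    (∀ᶠ e in 𝓝 (p x), ContMDiffAt 𝓘(ℝ, Euc d) (𝓡 d) ∞ g e) ∧
    ∀ u : TangentSpace (𝓡 d) (g (p x)), ∃ w : Euc d, mfderiv 𝓘(ℝ, Euc d) (𝓡 d) g (p x) w = u := by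
  have h1 : ∀ e ∈ (extChartAt (𝓡 d) x).target,
      ContMDiffAt 𝓘(ℝ, Euc d) (𝓡 d) ∞ (extChartAt (𝓡 d) x).symm e := fun e he =>
    (contMDiffOn_extChartAt_symm (n := ∞) x).contMDiffAt
      ((isOpen_extChartAt_target x).mem_nhds he)
  have h2 : ContMDiffAt (𝓡 d) 𝓘(ℝ, Euc d) ∞ (extChartAt (𝓡 d) x) x :=
    contMDiffAt_extChartAt
  have h3 : ∀ᶠ y in 𝓝 x, (extChartAt (𝓡 d) x).symm (extChartAt (𝓡 d) x y) = y := by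
    filter_upwards [extChartAt_source_mem_nhds (I := 𝓡 d) x] with y hy
      using (extChartAt (𝓡 d) x).left_inv hy
  refine ⟨(extChartAt (𝓡 d) x).symm, extChartAt (𝓡 d) x, h3.self_of_nhds,
    h1 _ (mem_extChartAt_target x), h2, h3, ?_, fun v => ?_⟩
  · filter_upwards [extChartAt_target_mem_nhds (I := 𝓡 d) x] with e he using h1 e he
  · have h4 := mfderiv_comp x ((h1 _ (mem_extChartAt_target x)).mdifferentiableAt (by simp))
      (h2.mdifferentiableAt (by simp))
    have h5 : (extChartAt (𝓡 d) x).symm ∘ (extChartAt (𝓡 d) x) =ᶠ[𝓝 x] id := h3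
    rw [h5.mfderiv_eq, mfderiv_id] at h4
    exact ⟨_, (congrArg (fun A : Euc d →L[ℝ] Euc d => A v) h4).symm⟩

variable [IsManifold (𝓡 m) ∞ M] [IsManifold (𝓡 r) ∞ Q]

/-- The factor between two smooth forms is smooth where the second form does not vanish. -/
lemma contMDiff_factor (hη : IsSmoothForm η) (hηQ : IsSmoothForm ηQ)
    (hι : ContMDiff (𝓡 d) (𝓡 m) ∞ ι) (hπ : ContMDiff (𝓡 d) (𝓡 r) ∞ π)
    (hne : ∀ x, ∃ u, η (ι x) (mfderiv (𝓡 d) (𝓡 m) ι x u) ≠ 0)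
    (hf : ∀ x u, ηQ (π x) (mfderiv (𝓡 d) (𝓡 r) π x u) =
      f x * η (ι x) (mfderiv (𝓡 d) (𝓡 m) ι x u)) :
    ContMDiff (𝓡 d) 𝓘(ℝ, ℝ) ∞ f := by
  intro x
  obtain ⟨g, p, hgx, hg, hp, hgp, hg', hsurj⟩ := exists_param (d := d) x
  -- Near `x`, `f` is the quotient of the values of the two pulled-back forms at the fixed vector
  -- `w`.
  obtain ⟨w, hw⟩ : ∃ w, pullForm η (ι ∘ g) (p x) w ≠ 0 := by
    have := hne (g (p x))
    obtain ⟨u, hu⟩ := this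
    obtain ⟨w, rfl⟩ := hsurj u
    exact ⟨w, by rw [pullForm_comp_param (hι _) hg]; exact hu⟩
  have hsm1 : ContDiffAt ℝ ∞ (fun e => pullForm η (ι ∘ g) e w) (p x) :=
    (hη.contDiffAt_pullForm ((hι _).comp _ hg)).clm_apply contDiffAt_const
  have hsm2 : ContDiffAt ℝ ∞ (fun e => pullForm ηQ (π ∘ g) e w) (p x) :=
    (hηQ.contDiffAt_pullForm ((hπ _).comp _ hg)).clm_apply contDiffAt_const
  have hquot := (hsm2.div hsm1 hw).contMDiffAt.comp x hp
  refine hquot.congr_of_eventuallyEq ?_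
  have hev : ∀ᶠ e in 𝓝 (p x), f (g e) =
      pullForm ηQ (π ∘ g) e w / pullForm η (ι ∘ g) e w := by
    filter_upwards [hg', hsm1.continuousAt.eventually_ne hw] with e he hew
    rw [eq_div_iff hew, pullForm_comp_param (hι _) he, pullForm_comp_param (hπ _) he, hf]
  filter_upwards [hgp, hp.continuousAt.eventually hev] with y hy hy'
  rw [hy] at hy'
  exact hy'

/-- On the kernel of `η`, the exterior derivative of a reduced form is that of `η`, up to the
factor. -/
lemma IsReducedForm.extD_eq (h : IsReducedForm (d := d) η ι π f ηQ) (hη : IsSmoothForm η)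
    (hι : ContMDiff (𝓡 d) (𝓡 m) ∞ ι) (hπ : ContMDiff (𝓡 d) (𝓡 r) ∞ π)
    (x : N) (u w : TangentSpace (𝓡 d) x)
    (hu : η (ι x) (mfderiv (𝓡 d) (𝓡 m) ι x u) = 0)
    (hw : η (ι x) (mfderiv (𝓡 d) (𝓡 m) ι x w) = 0) :
    extD ηQ (π x) (mfderiv (𝓡 d) (𝓡 r) π x u) (mfderiv (𝓡 d) (𝓡 r) π x w) =
      f x * extD η (ι x) (mfderiv (𝓡 d) (𝓡 m) ι x u) (mfderiv (𝓡 d) (𝓡 m) ι x w) := by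
  obtain ⟨g, p, hgx, hg, hp, hgp, hg', hsurj⟩ := exists_param (d := d) x
  -- Naming `p x` allows `x` to be replaced by `g e`, on which the types of `u` and `w` depend.
  obtain ⟨e, he⟩ : ∃ e, p x = e := ⟨_, rfl⟩
  rw [he] at hgx hg hg' hsurj
  clear hgp hp he
  subst hgx
  obtain ⟨a, rfl⟩ := hsurj u
  obtain ⟨b, rfl⟩ := hsurj w
  have hιg := (hι (g e)).comp e hg
  have hπg := (hπ (g e)).comp e hg
  have heq : pullForm ηQ (π ∘ g) =ᶠ[𝓝 e] fun e' => f (g e') • pullForm η (ι ∘ g) e' := by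
    filter_upwards [hg'] with e' he'
    refine ContinuousLinearMap.ext fun v => ?_
    rw [pullForm_comp_param (hπ _) he', smul_apply, pullForm_comp_param (hι _) he',
      h.apply_eq, smul_eq_mul]
  have hfg : DifferentiableAt ℝ (fun e' => f (g e')) e :=
    (((h.smooth_factor (g e)).comp e hg).contDiffAt).differentiableAt (by simp)
  have hα := (hη.contDiffAt_pullForm hιg).differentiableAt (by simp : (∞ : ℕ∞ω) ≠ 0)
  have hD : HasFDerivAt (fun e' => f (g e') • pullForm η (ι ∘ g) e') _ e :=
    hfg.hasFDerivAt.smul hα.hasFDerivAt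
  have hD' := (hD.congr_of_eventuallyEq heq).fderiv
  have h1 := h.smooth.fderiv_pullForm_sub hπg a b
  have h2 := hη.fderiv_pullForm_sub hιg a b
  -- These two equations remove the contribution of `df ∧ η` to `d(fη)`.
  have ha0 : pullForm η (ι ∘ g) e a = 0 := by rw [pullForm_comp_param (hι _) hg]; exact hu
  have hb0 : pullForm η (ι ∘ g) e b = 0 := by rw [pullForm_comp_param (hι _) hg]; exact hw
  rw [hD'] at h1
  simp only [add_apply, smul_apply, ContinuousLinearMap.smulRight_apply, smul_eq_mul, ha0, hb0,
    mul_zero, add_zero] at h1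
  rw [← mul_sub, h2] at h1
  have e1 := congrArg₂ (fun a b => extD ηQ (π (g e)) a b)
    (mfderiv_comp_param (hπ _) hg a) (mfderiv_comp_param (hπ _) hg b)
  have e2 := congrArg₂ (fun a b => extD η (ι (g e)) a b)
    (mfderiv_comp_param (hι _) hg a) (mfderiv_comp_param (hι _) hg b)
  exact (e1.symm.trans h1.symm).trans (congrArg (f (g e) * ·) e2)

namespace IsContactReduction

lemma isLinearReduction (h : IsContactReduction (d := d) (r := r) η ι π)
    (hQ : IsReducedForm (d := d) η ι π f ηQ) (x : N) :
    IsLinearReduction (η (ι x)).toLinearMap (extD η (ι x))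
      (mfderiv (𝓡 d) (𝓡 m) ι x).toLinearMap (mfderiv (𝓡 d) (𝓡 r) π x).toLinearMap
      (ηQ (π x)).toLinearMap (extD ηQ (π x)) (f x) where
  contact := h.contact (ι x)
  alt := extD_self (π x)
  coisotropic := h.coisotropic.2 x
  nonhorizontal := h.exists_ne_zero x
  surjective := h.mfderiv_projection_surjective x
  ker_eq := h.leafQuotient.ker_eq x
  ne_zero := hQ.factor_ne_zero x
  form_eq := hQ.apply_eq x
  deriv_eq := hQ.extD_eq h.contactForm.1 h.contMDiff_inclusion h.contMDiff_projection x

lemma isContactPair_reduced (h : IsContactReduction (d := d) (r := r) η ι π)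
    (hQ : IsReducedForm (d := d) η ι π f ηQ) (q : Q) :
    IsContactPair (ηQ q).toLinearMap (extD ηQ q) := by
  obtain ⟨x, rfl⟩ := h.projection_surjective q
  exact (h.isLinearReduction hQ x).isContactPair

/-- A reduced form is a contact form. -/
lemma isContactForm_reduced [Nonempty N] (h : IsContactReduction (d := d) (r := r) η ι π)
    (hQ : IsReducedForm (d := d) η ι π f ηQ) : IsContactForm ηQ := by
  have : Nonempty Q := ⟨π (Classical.arbitrary N)⟩
  exact isContactForm_of_isContactPair hQ.smooth (h.isContactPair_reduced hQ)

lemma isReducedForm_of_apply_eq (h : IsContactReduction (d := d) (r := r) η ι π)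
    (hηQ : IsSmoothForm ηQ) (hne : ∀ x, f x ≠ 0)
    (hf : ∀ x u, ηQ (π x) (mfderiv (𝓡 d) (𝓡 r) π x u) =
      f x * η (ι x) (mfderiv (𝓡 d) (𝓡 m) ι x u)) :
    IsReducedForm (d := d) η ι π f ηQ where
  smooth := hηQ
  smooth_factor := contMDiff_factor h.contactForm.1 hηQ h.contMDiff_inclusion
    h.contMDiff_projection h.exists_ne_zero hf
  factor_ne_zero := hne
  pullback_eq x := ContinuousLinearMap.ext (hf x)

/-- If all points are vertical, `η` descends to the quotient. -/
lemma existsUnique_reduced_of_isVertical (h : IsContactReduction (d := d) (r := r) η ι π)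
    (hv : ∀ x : N, IsVertical η (ι x) (tangentOf (d := d) ι x)) :
    ∃! ηQ : ∀ q : Q, TangentSpace (𝓡 r) q →L[ℝ] ℝ,
      IsReducedForm (d := d) η ι π (fun _ => 1) ηQ := by
  obtain ⟨β, hβ⟩ := h.exists_covector
  -- `σ` is an arbitrary, possibly discontinuous section. Since `β` is constant on fibres, it may be
  -- replaced near any point by a smooth local section.
  choose σ hσ using h.projection_surjective
  have hβσ : ∀ x, β (σ (π x)) = β x := fun x =>
    h.covector_eq_of_isVertical hβ hv (hσ (π x))
  refine ⟨fun q => β (σ q), h.isReducedForm_of_apply_eq (fun x₀ => ?_) (fun _ => one_ne_zero)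
    (fun x u => ?_), fun ηQ hηQ => ?_⟩
  · refine fun e he => ContDiffAt.contDiffWithinAt ?_
    set g := (extChartAt (𝓡 r) x₀).symm with hg
    have hgs : ∀ e ∈ (extChartAt (𝓡 r) x₀).target, ContMDiffAt 𝓘(ℝ, Euc r) (𝓡 r) ∞ g e :=
      fun e he => (contMDiffOn_extChartAt_symm (n := ∞) x₀).contMDiffAt
        ((isOpen_extChartAt_target x₀).mem_nhds he)
    obtain ⟨U, s, hU, hxU, -, hs, hπs⟩ :=
      exists_local_section (h.leafQuotient.submersion.isSubmersionAt (σ (g e)))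
    rw [hσ] at hxU
    have hsm : ContDiffAt ℝ ∞ (pullForm η ((ι ∘ s) ∘ g)) e :=
      h.contactForm.1.contDiffAt_pullForm
        (((h.contMDiff_inclusion _).comp _ (hs.contMDiffAt (hU.mem_nhds hxU))).comp e (hgs e he))
    refine hsm.congr_of_eventuallyEq ?_
    filter_upwards [(isOpen_extChartAt_target x₀).mem_nhds he,
      (hgs e he).continuousAt (hU.mem_nhds hxU)] with e' he' heU
    refine ContinuousLinearMap.ext fun v => ?_
    rw [pullForm_section hβ h.contMDiff_inclusion h.contMDiff_projection hU hs hπs heU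
      (hgs e' he')]
    have : β (s (g e')) = β (σ (g e')) :=
      h.covector_eq_of_isVertical hβ hv ((hπs _ heU).trans (hσ _).symm)
    rw [this]
    rfl
  · rw [one_mul, ← hβ x u]
    exact congrArg (fun A : Euc r →L[ℝ] ℝ => A (mfderiv (𝓡 d) (𝓡 r) π x u)) (hβσ x)
  · funext q
    obtain ⟨x, rfl⟩ := h.projection_surjective q
    refine ContinuousLinearMap.ext fun v => ?_
    obtain ⟨u, rfl⟩ := h.mfderiv_projection_surjective x v
    rw [hηQ.apply_eq, one_mul, ← hβ x u]
    exact (congrArg (fun A : Euc r →L[ℝ] ℝ => A (mfderiv (𝓡 d) (𝓡 r) π x u)) (hβσ x)).symm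

/-- The quotient carries a reduced form. -/
lemma exists_reduced [T2Space Q] [SecondCountableTopology Q]
    (h : IsContactReduction (d := d) (r := r) η ι π) :
    ∃ (f : N → ℝ) (ηQ : ∀ q : Q, TangentSpace (𝓡 r) q →L[ℝ] ℝ),
      IsReducedForm (d := d) η ι π f ηQ := by
  obtain ⟨β, hβ⟩ := h.exists_covector
  choose σ hσ using h.projection_surjective
  have hsec : ∀ q, ∃ (U : Set Q) (s : Q → N), IsOpen U ∧ q ∈ U ∧
      ContMDiffOn (𝓡 r) (𝓡 d) ∞ s U ∧ ∀ q ∈ U, π (s q) = q := fun q => by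
    obtain ⟨U, s, hU, hxU, -, hs, hπs⟩ :=
      exists_local_section (h.leafQuotient.submersion.isSubmersionAt (σ q))
    rw [hσ] at hxU
    exact ⟨U, s, hU, hxU, hs, hπs⟩
  choose U s hU hqU hs hπs using hsec
  have : LocallyCompactSpace Q := ChartedSpace.locallyCompactSpace (Euc r) Q
  obtain ⟨ρ, hρ⟩ := SmoothPartitionOfUnity.exists_isSubordinate (𝓡 r) (isClosed_univ (X := Q)) U
    hU (fun q _ => Set.mem_iUnion.mpr ⟨q, hqU q⟩)
  set ηQ : Q → Euc r →L[ℝ] ℝ := fun q => ∑ᶠ i, ρ i q • β (s i q) with hηQ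
  have hray : ∀ x, ∃ t : ℝ, 0 < t ∧ ηQ (π x) = t • β x := by
    intro x
    -- An open ray is convex, so the weighted sum of the local choices at `π x` stays on the ray of
    -- `β x`, and the factor is positive.
    have hconv : Convex ℝ {γ : Euc r →L[ℝ] ℝ | ∃ t : ℝ, 0 < t ∧ γ = t • β x} := by
      rintro _ ⟨t, ht, rfl⟩ _ ⟨t', ht', rfl⟩ a b ha hb hab
      refine ⟨a * t + b * t', ?_, by rw [smul_smul, smul_smul, add_smul]⟩
      rcases ha.eq_or_lt with rfl | ha'
      · have : b = 1 := by linarith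
        simp [this, ht']
      · positivity
    refine ρ.finsum_smul_mem_convex (Set.mem_univ (π x)) (g := fun i q => β (s i q))
      (fun i hi => ?_) hconv
    have hiU : π x ∈ U i := hρ i (subset_tsupport _ hi)
    exact h.covector_ray hβ (hπs i _ hiU)
  choose f hf hfη using hray
  refine ⟨f, ηQ, h.isReducedForm_of_apply_eq (fun x₀ => ?_) (fun x => (hf x).ne')
    (fun x u => ?_)⟩
  · refine fun e he => ContDiffAt.contDiffWithinAt ?_
    set g := (extChartAt (𝓡 r) x₀).symm with hg
    have hgs : ∀ e ∈ (extChartAt (𝓡 r) x₀).target, ContMDiffAt 𝓘(ℝ, Euc r) (𝓡 r) ∞ g e :=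
      fun e he => (contMDiffOn_extChartAt_symm (n := ∞) x₀).contMDiffAt
        ((isOpen_extChartAt_target x₀).mem_nhds he)
    obtain ⟨W, hW, hfin⟩ := ρ.locallyFinite (g e)
    have haux : ∀ (I : Finset Q) (c : Q → ℝ) (b : Q → Euc r →L[ℝ] ℝ) (A : Euc r →L[ℝ] Euc r)
        (v : Euc r), (∑ i ∈ I, c i • b i) (A v) = (∑ i ∈ I, c i • (b i).comp A) v := by
      intro I c b A v
      simp [sum_apply]
    have hsum : chartForm (M := Q) ηQ x₀ =ᶠ[𝓝 e] fun e' => ∑ i ∈ hfin.toFinset,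
        ρ i (g e') • (β (s i (g e'))).comp (mfderiv 𝓘(ℝ, Euc r) (𝓡 r) g e') := by
      filter_upwards [(hgs e he).continuousAt hW] with e' heW
      refine ContinuousLinearMap.ext fun v => ?_
      have h1 : ηQ (g e') = ∑ i ∈ hfin.toFinset, ρ i (g e') • β (s i (g e')) := by
        refine finsum_eq_sum_of_support_subset _ fun i hi => ?_
        rw [Set.Finite.coe_toFinset]
        refine ⟨g e', fun h0 => hi ?_, heW⟩
        simp only [h0, zero_smul]
      refine (congrArg (fun A : Euc r →L[ℝ] ℝ => A (mfderiv 𝓘(ℝ, Euc r) (𝓡 r) g e' v))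
        h1).trans ?_
      exact haux _ _ _ _ _
    refine ContDiffAt.congr_of_eventuallyEq (ContDiffAt.sum fun i _ => ?_) hsum
    -- Off the support of `ρ i` the section `s i` need not be smooth, but the whole term is zero
    -- near the point.
    by_cases hi : g e ∈ tsupport (ρ i)
    · have hiU : g e ∈ U i := hρ i hi
      have hsm : ContDiffAt ℝ ∞ (pullForm η ((ι ∘ s i) ∘ g)) e :=
        h.contactForm.1.contDiffAt_pullForm (((h.contMDiff_inclusion _).comp _
          ((hs i).contMDiffAt ((hU i).mem_nhds hiU))).comp e (hgs e he))
      have hρs : ContDiffAt ℝ ∞ (fun e' => ρ i (g e')) e :=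
        (((ρ i).contMDiff (g e)).comp e (hgs e he)).contDiffAt
      refine (hρs.smul hsm).congr_of_eventuallyEq ?_
      filter_upwards [(isOpen_extChartAt_target x₀).mem_nhds he,
        (hgs e he).continuousAt ((hU i).mem_nhds hiU)] with e' he' heU
      refine ContinuousLinearMap.ext fun v => ?_
      exact congrArg (ρ i (g e') • ·) (pullForm_section hβ h.contMDiff_inclusion
        h.contMDiff_projection (hU i) (hs i) (hπs i) heU (hgs e' he') v).symm
    · have h0 : ∀ᶠ q in 𝓝 (g e), ρ i q = 0 := notMem_tsupport_iff_eventuallyEq.mp hi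
      refine (contDiffAt_const (c := (0 : Euc r →L[ℝ] ℝ))).congr_of_eventuallyEq ?_
      filter_upwards [(hgs e he).continuousAt h0] with e' he'
      rw [show ρ i (g e') = 0 from he', zero_smul]
      rfl
  · have := congrArg (fun A : Euc r →L[ℝ] ℝ => A (mfderiv (𝓡 d) (𝓡 r) π x u)) (hfη x)
    refine Eq.trans this ?_
    rw [← hβ x u]
    rfl

end IsContactReduction

end ReducedForms

/-! ### Inverse function and constant rank theorems -/

section ConstantRank

variable {E F : Type*} [NormedAddCommGroup E] [NormedSpace ℝ E] [FiniteDimensional ℝ E]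
  [NormedAddCommGroup F] [NormedSpace ℝ F] [FiniteDimensional ℝ F]

/-- `univBall` reparametrizes a ball by all of `ℝ^k`, so that every disc can have domain `Euc k`;
its smooth inverse gives injectivity. -/
lemma injective_fderiv_univBall {k : ℕ} (c : Euc k) {ε : ℝ} (hε : 0 < ε) (y : Euc k) :
    Function.Injective (fderiv ℝ (OpenPartialHomeomorph.univBall c ε) y) := by
  set b := OpenPartialHomeomorph.univBall c ε with hb
  have hmem : b y ∈ Metric.ball c ε := by
    rw [← OpenPartialHomeomorph.univBall_target c hε]
    exact b.map_source (by simp [hb])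
  have h1 : DifferentiableAt ℝ b.symm (b y) :=
    ((OpenPartialHomeomorph.contDiffOn_univBall_symm (n := 1)).contDiffAt
      (Metric.isOpen_ball.mem_nhds hmem)).differentiableAt one_ne_zero
  have h2 : DifferentiableAt ℝ b y :=
    (OpenPartialHomeomorph.contDiff_univBall (n := 1)).differentiable one_ne_zero y
  have h3 := fderiv_comp y h1 h2
  have h4 : b.symm ∘ b = id := funext fun z => b.left_inv (by simp [hb])
  rw [h4, fderiv_id] at h3
  intro u v huv
  have hu := congrArg (fun A : Euc k →L[ℝ] Euc k => A u) h3
  have hv := congrArg (fun A : Euc k →L[ℝ] Euc k => A v) h3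
  simp only [ContinuousLinearMap.comp_apply, ContinuousLinearMap.id_apply] at hu hv
  rw [hu, hv, huv]

/-- **Inverse function theorem**, for a smooth map on an open set. -/
lemma exists_smooth_openPartialHomeomorph {F : Type*} [NormedAddCommGroup F] [NormedSpace ℝ F]
    {g : E → F} {U : Set E} (hU : IsOpen U)
    (hg : ∀ w ∈ U, ContDiffAt ℝ ∞ g w) {w₀ : E} (hw₀ : w₀ ∈ U) {T : E ≃L[ℝ] F}
    (hT : HasFDerivAt g (T : E →L[ℝ] F) w₀) :
    ∃ Θ : OpenPartialHomeomorph E F, w₀ ∈ Θ.source ∧ Θ.source ⊆ U ∧ (∀ w, Θ w = g w) ∧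
      ∀ p ∈ Θ.target, ContDiffAt ℝ ∞ Θ.symm p := by
  set Θ₀ := (hg w₀ hw₀).toOpenPartialHomeomorph g hT (by simp) with hΘ₀
  have hw₀Θ : w₀ ∈ Θ₀.source := (hg w₀ hw₀).mem_toOpenPartialHomeomorph_source hT (by simp)
  -- The source is shrunk until the derivative is invertible throughout, so that the inverse is
  -- smooth on the whole target and not only at one point.
  have hinv : ∀ᶠ w in 𝓝 w₀, fderiv ℝ g w ∈ Set.range ((↑) : (E ≃L[ℝ] F) → E →L[ℝ] F) := by
    have hc : ContinuousAt (fderiv ℝ g) w₀ :=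
      ((hg w₀ hw₀).fderiv_right (m := ∞) (by simp)).continuousAt
    refine hc ?_
    rw [hT.fderiv]
    exact ContinuousLinearEquiv.nhds T
  obtain ⟨V, hV, hVo, hwV⟩ := eventually_nhds_iff.mp
    (Filter.Eventually.and (hU.eventually_mem hw₀) hinv)
  refine ⟨Θ₀.restrOpen V hVo, ⟨hw₀Θ, hwV⟩, fun w hw => (hV w hw.2).1, fun w => rfl,
    fun p hp => ?_⟩
  have hmem := (Θ₀.restrOpen V hVo).map_target hp
  obtain ⟨hpU, S, hS⟩ := hV _ hmem.2
  refine (Θ₀.restrOpen V hVo).contDiffAt_symm (f₀' := S) hp ?_ (hg _ hpU)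
  rw [hS]
  exact ((hg _ hpU).differentiableAt (by simp)).hasFDerivAt

/-- A linear map of rank `k` becomes an isomorphism when it is completed by a projection. -/
lemma exists_rank_coordinates (A : E →L[ℝ] F) {k : ℕ}
    (hk : Module.finrank ℝ (LinearMap.range A.toLinearMap) = k) :
    ∃ (K : Submodule ℝ E) (R : F →L[ℝ] Euc k) (P : E →L[ℝ] K) (T : E ≃L[ℝ] Euc k × K),
      (T : E →L[ℝ] Euc k × K) = (R.comp A).prod P := by
  set K := LinearMap.ker A.toLinearMap
  have R₀ : LinearMap.range A.toLinearMap ≃ₗ[ℝ] Euc k :=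
    LinearEquiv.ofFinrankEq _ _ (by rw [hk]; simp)
  obtain ⟨R, hR⟩ := LinearMap.exists_extend R₀.toLinearMap
  obtain ⟨P, hP⟩ := K.subtype.exists_leftInverse_of_injective (by simp)
  set T₀ : E →ₗ[ℝ] Euc k × K := (R ∘ₗ A.toLinearMap).prod P
  have hinj : Function.Injective T₀ := by
    rw [injective_iff_map_eq_zero]
    intro v hv
    obtain ⟨h1, h2⟩ := Prod.mk_eq_zero.mp hv
    have h3 : R₀ ⟨A v, v, rfl⟩ = 0 := by
      rw [← h1]
      exact (LinearMap.congr_fun hR ⟨A v, v, rfl⟩).symm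
    have h4 : A v = 0 := by
      have := (LinearEquiv.map_eq_zero_iff R₀).mp h3
      exact congrArg Subtype.val this
    have h5 : P v = ⟨v, h4⟩ := LinearMap.congr_fun hP ⟨v, h4⟩
    rw [h5] at h2
    exact congrArg Subtype.val h2
  have hdim : Module.finrank ℝ E = Module.finrank ℝ (Euc k × K) := by
    have := LinearMap.finrank_range_add_finrank_ker A.toLinearMap
    rw [hk] at this
    rw [Module.finrank_prod, ← this]
    simp [K]
  refine ⟨K, LinearMap.toContinuousLinearMap R, LinearMap.toContinuousLinearMap P,
    (LinearEquiv.ofInjectiveOfFinrankEq T₀ hinj hdim).toContinuousLinearEquiv, ?_⟩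
  ext v <;> rfl

/-- **Constant rank theorem**: a map of constant rank `k` has, near every point, the same image as
its restriction to a `k`-dimensional disc, on which it is an immersion. -/
theorem exists_transversal_of_constant_rank {g : E → F} {U : Set E} (hU : IsOpen U)
    (hg : ContDiffOn ℝ ∞ g U) {k : ℕ}
    (hrank : ∀ w ∈ U, Module.finrank ℝ (LinearMap.range (fderiv ℝ g w).toLinearMap) = k)
    {w₀ : E} (hw₀ : w₀ ∈ U) :
    ∃ (O : Set E) (h : Euc k → E), IsOpen O ∧ w₀ ∈ O ∧ O ⊆ U ∧ ContDiff ℝ ∞ h ∧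
      (∀ y, h y ∈ O) ∧ Set.range (g ∘ h) = g '' O ∧
      ∀ y, Function.Injective (fderiv ℝ (g ∘ h) y) := by
  have hgs : ∀ w ∈ U, ContDiffAt ℝ ∞ g w := fun w hw => hg.contDiffAt (hU.mem_nhds hw)
  obtain ⟨K, R, P, T, hT⟩ := exists_rank_coordinates (fderiv ℝ g w₀) (hrank w₀ hw₀)
  -- `R` is an isomorphism on the range of the derivative at `w₀` and `P` is a projection to its
  -- kernel, so `Φ` is a local diffeomorphism there.
  set Φ : E → Euc k × K := fun w => (R (g w), P w) with hΦdef
  have hΦ : ∀ w ∈ U, ContDiffAt ℝ ∞ Φ w := fun w hw =>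
    (R.contDiff.contDiffAt.comp w (hgs w hw)).prodMk P.contDiff.contDiffAt
  have hΦ' : HasFDerivAt Φ (T : E →L[ℝ] Euc k × K) w₀ := by
    rw [hT]
    exact (R.hasFDerivAt.comp w₀ ((hgs w₀ hw₀).differentiableAt (by simp)).hasFDerivAt).prodMk
      P.hasFDerivAt
  obtain ⟨Θ, hw₀Θ, hΘU, hΘΦ, hΘs⟩ := exists_smooth_openPartialHomeomorph hU hΦ hw₀ hΦ'
  have hnhds : Θ.target ∈ 𝓝 (Θ w₀) := Θ.open_target.mem_nhds (Θ.map_source hw₀Θ)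
  obtain ⟨ε, hε, hball⟩ := Metric.mem_nhds_iff.mp hnhds
  obtain ⟨c₀, z₀, hcz⟩ : ∃ c₀ z₀, Θ w₀ = (c₀, z₀) := ⟨_, _, rfl⟩
  rw [hcz] at hball
  have hΨ : ∀ p ∈ Metric.ball (c₀, z₀) ε, ContDiffAt ℝ ∞ Θ.symm p := fun p hp =>
    hΘs p (hball hp)
  have hΨU : ∀ p ∈ Metric.ball (c₀, z₀) ε, Θ.symm p ∈ U := fun p hp =>
    hΘU (Θ.map_target (hball hp))
  have hΦΨ : ∀ p ∈ Metric.ball (c₀, z₀) ε, Φ (Θ.symm p) = p := fun p hp => by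
    rw [← hΘΦ]; exact Θ.right_inv (hball hp)
  have hgΨ : ∀ p ∈ Metric.ball (c₀, z₀) ε, ContDiffAt ℝ ∞ (g ∘ Θ.symm) p := fun p hp =>
    (hgs _ (hΨU p hp)).comp p (hΨ p hp)
  have hRg : ∀ p ∈ Metric.ball (c₀, z₀) ε, ∀ v,
      R (fderiv ℝ (g ∘ Θ.symm) p v) = v.1 := fun p hp v => by
    have h1 : R ∘ (g ∘ Θ.symm) =ᶠ[𝓝 p] Prod.fst := by
      filter_upwards [Metric.isOpen_ball.mem_nhds hp] with p' hp'
      exact congrArg Prod.fst (hΦΨ p' hp')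
    have h2 := (R.hasFDerivAt.comp p
      ((hgΨ p hp).differentiableAt (by simp)).hasFDerivAt).fderiv
    rw [h1.fderiv_eq, fderiv_fst] at h2
    exact (congrArg (fun A : Euc k × K →L[ℝ] Euc k => A v) h2).symm
  -- In the coordinates `Φ`, `R ∘ g` is the first projection. So `R` maps the range of `dg`, of
  -- dimension `k`, onto `ℝ^k`, hence injectively; as `R ∘ g` has zero derivative along `K`, so has
  -- `g`.
  have hindep : ∀ c ∈ Metric.ball c₀ ε, ∀ z ∈ Metric.ball z₀ ε,
      g (Θ.symm (c, z)) = g (Θ.symm (c, z₀)) := by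
    intro c hc z hz
    have hmem : ∀ z ∈ Metric.ball z₀ ε, (c, z) ∈ Metric.ball (c₀, z₀) ε := fun z hz => by
      rw [← ball_prod_same]; exact ⟨hc, hz⟩
    refine const_right_of_fderiv_eq_zero (b := g ∘ Θ.symm) Metric.isOpen_ball (convex_ball z₀ ε)
      (fun z hz => (hgΨ _ (hmem z hz)).differentiableAt (by simp)) (fun z hz z' => ?_) hz
      (Metric.mem_ball_self hε)
    have hp := hmem z hz
    set w := Θ.symm (c, z)
    have hwU : w ∈ U := hΨU _ hp
    have hchain : fderiv ℝ (g ∘ Θ.symm) (c, z) =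
        (fderiv ℝ g w).comp (fderiv ℝ Θ.symm (c, z)) :=
      fderiv_comp (c, z) ((hgs w hwU).differentiableAt (by simp))
      ((hΨ _ hp).differentiableAt (by simp))
    have hrange : ∀ v, fderiv ℝ (g ∘ Θ.symm) (c, z) v ∈
        LinearMap.range (fderiv ℝ g w).toLinearMap := fun v => by
      rw [hchain]; exact ⟨_, rfl⟩
    set Rr : LinearMap.range (fderiv ℝ g w).toLinearMap →ₗ[ℝ] Euc k :=
      R.toLinearMap.domRestrict _ with hRr
    have hsurj : Function.Surjective Rr := fun v =>
      ⟨⟨_, hrange (v, 0)⟩, hRg _ hp (v, 0)⟩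
    have hinj : Function.Injective Rr :=
      (LinearMap.injective_iff_surjective_of_finrank_eq_finrank
        (by rw [hrank w hwU]; simp)).mpr hsurj
    have h0 : Rr ⟨_, hrange (0, z')⟩ = Rr 0 := by
      rw [map_zero]
      exact hRg _ hp (0, z')
    exact congrArg Subtype.val (hinj h0)
  set b := OpenPartialHomeomorph.univBall c₀ ε with hb
  have hbmem : ∀ y, (b y, z₀) ∈ Metric.ball (c₀, z₀) ε := fun y => by
    rw [← ball_prod_same, ← OpenPartialHomeomorph.univBall_target c₀ hε]
    exact ⟨b.map_source (by simp [hb]), Metric.mem_ball_self hε⟩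
  have hbs : ContDiff ℝ ∞ b := OpenPartialHomeomorph.contDiff_univBall
  set h : Euc k → E := fun y => Θ.symm (b y, z₀) with hh
  have hhs : ContDiff ℝ ∞ h := contDiff_iff_contDiffAt.mpr fun y =>
    (hΨ _ (hbmem y)).comp y (hbs.prodMk contDiff_const).contDiffAt
  have hhO : ∀ y, h y ∈ Θ.source ∩ Θ ⁻¹' Metric.ball (c₀, z₀) ε := fun y => by
    refine ⟨Θ.map_target (hball (hbmem y)), ?_⟩
    rw [Set.mem_preimage, hΘΦ, hΦΨ _ (hbmem y)]
    exact hbmem y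
  have hOU : Θ.source ∩ Θ ⁻¹' Metric.ball (c₀, z₀) ε ⊆ U := fun w hw => hΘU hw.1
  refine ⟨Θ.source ∩ Θ ⁻¹' Metric.ball (c₀, z₀) ε, h,
    Θ.isOpen_inter_preimage Metric.isOpen_ball, ⟨hw₀Θ, ?_⟩, hOU, hhs, hhO, ?_, ?_⟩
  · rw [Set.mem_preimage, hcz]; exact Metric.mem_ball_self hε
  · apply Set.Subset.antisymm
    · rintro _ ⟨y, rfl⟩
      exact ⟨h y, hhO y, rfl⟩
    · rintro _ ⟨w, ⟨hw, hwb⟩, rfl⟩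
      obtain ⟨c, z, hwcz⟩ : ∃ c z, Θ w = (c, z) := ⟨_, _, rfl⟩
      rw [Set.mem_preimage, hwcz, ← ball_prod_same] at hwb
      have hc : c ∈ b.target := by
        rw [hb, OpenPartialHomeomorph.univBall_target c₀ hε]; exact hwb.1
      refine ⟨b.symm c, ?_⟩
      simp only [Function.comp_apply, hh]
      rw [b.right_inv hc, ← hindep c hwb.1 z hwb.2, ← hwcz, Θ.left_inv hw]
  · intro y
    -- The differential of `g ∘ h` is injective because that of `b` is, after applying `R`.
    have h1 : R ∘ (g ∘ h) = b := funext fun y => congrArg Prod.fst (hΦΨ _ (hbmem y))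
    have hgh : DifferentiableAt ℝ (g ∘ h) y :=
      ((hgs _ (hOU (hhO y))).comp y hhs.contDiffAt).differentiableAt (by simp)
    have h2 := (R.hasFDerivAt.comp y hgh.hasFDerivAt).fderiv
    rw [h1] at h2
    have h3 := injective_fderiv_univBall c₀ hε y
    rw [← hb, h2] at h3
    exact Function.Injective.of_comp h3

end ConstantRank

/-! ### Injective differentials and immersions -/

section Immersions

variable {k r : ℕ} {E : Type*} [NormedAddCommGroup E] [NormedSpace ℝ E]
  {P : Type*} [TopologicalSpace P] [ChartedSpace (Euc k) P]
  {Q : Type*} [TopologicalSpace Q] [ChartedSpace (Euc r) Q]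

lemma exists_mfderiv_chart_eq {ψ : OpenPartialHomeomorph Q (Euc r)}
    (hψ : ψ ∈ IsManifold.maximalAtlas (𝓡 r) ∞ Q) {q : Q} (hq : q ∈ ψ.source) :
    ∃ T : Euc r ≃L[ℝ] Euc r, ∀ v : Euc r, T v = mfderiv (𝓡 r) 𝓘(ℝ, Euc r) ψ q v := by
  have h1 : MDifferentiableAt (𝓡 r) 𝓘(ℝ, Euc r) ψ q :=
    (contMDiffAt_of_mem_maximalAtlas' hψ hq).mdifferentiableAt (by simp)
  have h2 : MDifferentiableAt 𝓘(ℝ, Euc r) (𝓡 r) ψ.symm (ψ q) :=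
    (contMDiffAt_symm_of_mem_maximalAtlas hψ (ψ.map_source hq)).mdifferentiableAt (by simp)
  have h3 := mfderiv_comp q h2 h1
  have h4 : ψ.symm ∘ ψ =ᶠ[𝓝 q] id := by
    filter_upwards [ψ.open_source.mem_nhds hq] with y hy using ψ.left_inv hy
  rw [h4.mfderiv_eq, mfderiv_id] at h3
  set A : Euc r →L[ℝ] Euc r := mfderiv (𝓡 r) 𝓘(ℝ, Euc r) ψ q
  set B : Euc r →L[ℝ] Euc r := mfderiv 𝓘(ℝ, Euc r) (𝓡 r) ψ.symm (ψ q)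
  have h5 : Function.LeftInverse B A := fun v =>
    (congrArg (fun C : Euc r →L[ℝ] Euc r => C v) h3).symm
  exact ⟨(LinearEquiv.ofInjectiveOfFinrankEq A.toLinearMap h5.injective
    rfl).toContinuousLinearEquiv, fun v => rfl⟩

lemma contDiffAt_chart_comp {ψ : OpenPartialHomeomorph Q (Euc r)}
    (hψ : ψ ∈ IsManifold.maximalAtlas (𝓡 r) ∞ Q) {G : E → Q} {e : E}
    (hG : ContMDiffAt 𝓘(ℝ, E) (𝓡 r) ∞ G e) (he : G e ∈ ψ.source) :
    ContDiffAt ℝ ∞ (ψ ∘ G) e := by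
  rw [← contMDiffAt_iff_contDiffAt]
  exact (contMDiffAt_of_mem_maximalAtlas' hψ he).comp e hG

lemma fderiv_chart_comp {ψ : OpenPartialHomeomorph Q (Euc r)}
    (hψ : ψ ∈ IsManifold.maximalAtlas (𝓡 r) ∞ Q) {G : E → Q} {e : E}
    (hG : MDifferentiableAt 𝓘(ℝ, E) (𝓡 r) G e) (he : G e ∈ ψ.source) (v : E) :
    fderiv ℝ (ψ ∘ G) e v =
      mfderiv (𝓡 r) 𝓘(ℝ, Euc r) ψ (G e) (mfderiv 𝓘(ℝ, E) (𝓡 r) G e v) := by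
  have h1 := mfderiv_comp e ((contMDiffAt_of_mem_maximalAtlas' hψ he).mdifferentiableAt
    (by simp)) hG
  rw [mfderiv_eq_fderiv] at h1
  exact congrArg (fun C : E →L[ℝ] Euc r => C v) h1

/-- An injective linear map becomes an isomorphism when a complement of its range is added. -/
lemma exists_complement_coordinates (A : Euc k →L[ℝ] Euc r) (hA : Function.Injective A) {c : ℕ}
    (hc : k + c = r) :
    ∃ (B : Euc c →L[ℝ] Euc r) (J : (Euc k × Euc c) ≃L[ℝ] Euc r),
      (J : Euc k × Euc c →L[ℝ] Euc r) = A.coprod B := by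
  obtain ⟨K, hK⟩ := Submodule.exists_isCompl (LinearMap.range A.toLinearMap)
  have hdim : Module.finrank ℝ K = c := by
    have h1 := Submodule.finrank_add_eq_of_isCompl hK
    rw [LinearMap.finrank_range_of_inj hA] at h1
    simp only [finrank_euclideanSpace, Fintype.card_fin] at h1
    omega
  have B : Euc c ≃ₗ[ℝ] K := LinearEquiv.ofFinrankEq _ _ (by rw [hdim]; simp)
  set B' : Euc c →ₗ[ℝ] Euc r := K.subtype ∘ₗ B.toLinearMap
  have hinj : Function.Injective (A.toLinearMap.coprod B') := by
    rw [injective_iff_map_eq_zero]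
    rintro ⟨v, z⟩ hvz
    have h1 : A v + (B z : Euc r) = 0 := hvz
    have h2 : A v ∈ K := by
      rw [eq_neg_of_add_eq_zero_left h1]
      exact K.neg_mem (B z).2
    have h3 : A v = 0 := Submodule.disjoint_def.mp hK.disjoint _ ⟨v, rfl⟩ h2
    rw [h3, zero_add] at h1
    have h4 : B z = 0 := Subtype.ext h1
    rw [LinearEquiv.map_eq_zero_iff] at h4
    rw [h4, hA (h3.trans (map_zero A).symm)]
    rfl
  refine ⟨LinearMap.toContinuousLinearMap B', (LinearEquiv.ofInjectiveOfFinrankEq _ hinj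
    (by simp [hc])).toContinuousLinearEquiv, ?_⟩
  ext v <;> rfl

/-- A smooth map with injective differential is an immersion. -/
lemma isImmersionAtOfComplement_of_injective [IsManifold (𝓡 k) ∞ P] [IsManifold (𝓡 r) ∞ Q]
    {f : P → Q} (hf : ContMDiff (𝓡 k) (𝓡 r) ∞ f) {p : P}
    (hinj : Function.Injective (mfderiv (𝓡 k) (𝓡 r) f p)) {c : ℕ} (hc : k + c = r) :
    Manifold.IsImmersionAtOfComplement (Euc c) (𝓡 k) (𝓡 r) ∞ f p := by
  set φ := chartAt (Euc k) p
  set ψ := chartAt (Euc r) (f p)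
  have hφ : φ ∈ IsManifold.maximalAtlas (𝓡 k) ∞ P := IsManifold.chart_mem_maximalAtlas p
  have hψ : ψ ∈ IsManifold.maximalAtlas (𝓡 r) ∞ Q := IsManifold.chart_mem_maximalAtlas (f p)
  have hp : p ∈ φ.source := mem_chart_source _ p
  have hfp : f p ∈ ψ.source := mem_chart_source _ (f p)
  set U : Set (Euc k) := φ.target ∩ φ.symm ⁻¹' (f ⁻¹' ψ.source) with hUdef
  have hU : IsOpen U := φ.isOpen_inter_preimage_symm (ψ.open_source.preimage hf.continuous)
  have hG : ∀ e ∈ U, ContMDiffAt 𝓘(ℝ, Euc k) (𝓡 r) ∞ (f ∘ φ.symm) e := fun e he =>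
    (hf _).comp e (contMDiffAt_symm_of_mem_maximalAtlas hφ he.1)
  set e₀ := φ p
  have hsymm : φ.symm e₀ = p := φ.left_inv hp
  have he₀ : e₀ ∈ U := ⟨φ.map_source hp, by
    rw [Set.mem_preimage, hsymm]; exact hfp⟩
  have hψG : ∀ e ∈ U, ContDiffAt ℝ ∞ (ψ ∘ f ∘ φ.symm) e := fun e he =>
    contDiffAt_chart_comp hψ (hG e he) he.2
  set A := fderiv ℝ (ψ ∘ f ∘ φ.symm) e₀ with hA
  have hAinj : Function.Injective A := by
    have hback : ((ψ ∘ f ∘ φ.symm) ∘ φ : P → Euc r) =ᶠ[𝓝 p] ψ ∘ f := by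
      filter_upwards [φ.open_source.mem_nhds hp] with y hy
      simp only [Function.comp_apply, φ.left_inv hy]
    obtain ⟨T, hT⟩ := exists_mfderiv_chart_eq hφ hp
    obtain ⟨S, hS⟩ := exists_mfderiv_chart_eq hψ hfp
    have h1 := mfderiv_comp p (I := 𝓡 k) (I' := 𝓘(ℝ, Euc k)) (I'' := 𝓘(ℝ, Euc r)) (f := φ)
      (g := ψ ∘ f ∘ φ.symm) (hψG e₀ he₀ |>.contMDiffAt.mdifferentiableAt (by simp))
      ((contMDiffAt_of_mem_maximalAtlas' hφ hp).mdifferentiableAt (by simp))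
    rw [hback.mfderiv_eq, mfderiv_eq_fderiv, mfderiv_comp p
      ((contMDiffAt_of_mem_maximalAtlas' hψ hfp).mdifferentiableAt (by simp))
      ((hf p).mdifferentiableAt (by simp))] at h1
    have h2 : ∀ v : Euc k, S (mfderiv (𝓡 k) (𝓡 r) f p v) = A (T v) := fun v => by
      rw [hT]
      exact (hS _).trans (congrArg (fun C : Euc k →L[ℝ] Euc r => C v) h1)
    intro u v huv
    obtain ⟨u, rfl⟩ := T.surjective u
    obtain ⟨v, rfl⟩ := T.surjective v
    rw [← h2, ← h2] at huv
    exact congrArg T (hinj (S.injective huv))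
  obtain ⟨B, J, hJ⟩ := exists_complement_coordinates A hAinj hc
  -- The coordinate expression of `f` is thickened by a complement of the range of its differential,
  -- which makes it a local diffeomorphism.
  set g : Euc k × Euc c → Euc r := fun w => (ψ ∘ f ∘ φ.symm) w.1 + B w.2 with hg
  have hgs : ∀ w ∈ U ×ˢ (Set.univ : Set (Euc c)), ContDiffAt ℝ ∞ g w := fun w hw =>
    ((hψG w.1 hw.1).comp w contDiffAt_fst).add (B.contDiff.contDiffAt.comp w contDiffAt_snd)
  have hgJ : HasFDerivAt g (J : Euc k × Euc c →L[ℝ] Euc r) (e₀, 0) := by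
    rw [hJ]
    have h1 : HasFDerivAt (ψ ∘ f ∘ φ.symm) A (e₀, (0 : Euc c)).1 :=
      ((hψG e₀ he₀).differentiableAt (by simp)).hasFDerivAt
    convert! (h1.comp (e₀, (0 : Euc c)) hasFDerivAt_fst).add
      (B.hasFDerivAt.comp (e₀, (0 : Euc c)) hasFDerivAt_snd) using 1
  obtain ⟨Θ, h0Θ, hΘU, hΘg, hΘs⟩ := exists_smooth_openPartialHomeomorph
    (hU.prod isOpen_univ) hgs ⟨he₀, Set.mem_univ _⟩ hgJ
  set V : Set P := φ.source ∩ φ ⁻¹' {e | (e, (0 : Euc c)) ∈ Θ.source} with hV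
  have hVo : IsOpen V := φ.isOpen_inter_preimage
    (Θ.open_source.preimage (Continuous.prodMk continuous_id continuous_const))
  -- Undoing the thickened map straightens `f`, which becomes `e ↦ J (e, 0)` in this chart.
  set χ : OpenPartialHomeomorph Q (Euc r) :=
    (ψ.trans Θ.symm).trans J.toHomeomorph.toOpenPartialHomeomorph with hχ
  have hsrc : ∀ y, y ∈ χ.source ↔ y ∈ ψ.source ∧ ψ y ∈ Θ.target := fun y => by simp [hχ]
  have htgt : ∀ e, e ∈ χ.target ↔ J.symm e ∈ Θ.source ∧ Θ (J.symm e) ∈ ψ.target := fun e => by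
    simp [hχ]
  have hχmem : χ ∈ IsManifold.maximalAtlas (𝓡 r) ∞ Q := by
    apply OpenPartialHomeomorph.mem_maximalAtlas_of_contMDiffOn
    · intro y hy
      obtain ⟨h1, h2⟩ := (hsrc y).mp hy
      refine ContMDiffAt.contMDiffWithinAt ?_
      exact ((J.contDiff.contDiffAt.comp _ (hΘs _ h2)).contMDiffAt).comp y
        (contMDiffAt_of_mem_maximalAtlas' hψ h1)
    · intro e he
      obtain ⟨h1, h2⟩ := (htgt e).mp he
      refine ContMDiffAt.contMDiffWithinAt ?_
      have h3 : ContDiffAt ℝ ∞ Θ (J.symm e) := by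
        rw [show (Θ : Euc k × Euc c → Euc r) = g from funext hΘg]
        exact hgs _ (hΘU h1)
      exact ContMDiffAt.comp (g := ψ.symm) (f := Θ ∘ J.symm) e
        (contMDiffAt_symm_of_mem_maximalAtlas hψ h2)
        (h3.comp e J.symm.contDiff.contDiffAt).contMDiffAt
  have hgz : ∀ e, g (e, 0) = ψ (f (φ.symm e)) := fun e => by simp [hg]
  have hmem : ∀ e, (e, (0 : Euc c)) ∈ Θ.source → f (φ.symm e) ∈ χ.source ∧
      χ (f (φ.symm e)) = J (e, 0) := fun e he => by
    have h1 : Θ (e, 0) = ψ (f (φ.symm e)) := (hΘg _).trans (hgz e)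
    refine ⟨(hsrc _).mpr ⟨(hΘU he).1.2, ?_⟩, ?_⟩
    · rw [← h1]; exact Θ.map_source he
    · change J (Θ.symm (ψ (f (φ.symm e)))) = _
      rw [← h1, Θ.left_inv he]
  refine Manifold.IsImmersionAtOfComplement.mk_of_continuousAt hf.continuous.continuousAt J
    (φ.restr V) χ ?_ ?_ (restr_mem_maximalAtlas (contDiffGroupoid ∞ (𝓡 k)) hφ hVo) hχmem ?_
  · rw [φ.restr_source' _ hVo]
    exact ⟨hp, hp, h0Θ⟩
  · have := (hmem e₀ h0Θ).1
    rwa [hsymm] at this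
  · intro e he
    have he' : e ∈ (φ.restr V).target := by simpa using he
    have h1 := (φ.restr V).map_target he'
    rw [φ.restr_source' _ hVo] at h1
    have h2 : φ ((φ.restr V).symm e) = e := (φ.restr V).right_inv he'
    have h3 : (e, (0 : Euc c)) ∈ Θ.source := by
      have := h1.2.2
      rwa [Set.mem_preimage, h2] at this
    exact (hmem e h3).2

end Immersions

/-! ### Disjoint unions of copies of `ℝ^k` -/

section DiscreteUnion

variable {k r : ℕ} {I : Type*} [TopologicalSpace I] [DiscreteTopology I]
  {Q : Type*} [TopologicalSpace Q] [ChartedSpace (Euc r) Q]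

/-- The chart of `I × ℝ^k`, for `I` discrete, given by the copy of `ℝ^k` with index `i`. -/
def sheetChart (k : ℕ) (i : I) : OpenPartialHomeomorph (I × Euc k) (Euc k) where
  toFun := Prod.snd
  invFun y := (i, y)
  source := {i} ×ˢ Set.univ
  target := Set.univ
  map_source' _ _ := Set.mem_univ _
  map_target' _ _ := ⟨rfl, Set.mem_univ _⟩
  left_inv' _ hp := Prod.ext hp.1.symm rfl
  right_inv' _ _ := rfl
  open_source := (isOpen_discrete _).prod isOpen_univ
  open_target := isOpen_univ
  continuousOn_toFun := continuous_snd.continuousOn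
  continuousOn_invFun := (Continuous.prodMk continuous_const continuous_id).continuousOn

/-- A disjoint union of copies of `ℝ^k`. -/
@[reducible]
def sheetChartedSpace (k : ℕ) (I : Type*) [TopologicalSpace I] [DiscreteTopology I] :
    ChartedSpace (Euc k) (I × Euc k) where
  atlas := Set.range (sheetChart k)
  chartAt p := sheetChart k p.1
  mem_chart_source _ := ⟨rfl, Set.mem_univ _⟩
  chart_mem_atlas p := ⟨p.1, rfl⟩

attribute [local instance] sheetChartedSpace

lemma isManifold_sheets : IsManifold (𝓡 k) ∞ (I × Euc k) := by
  apply isManifold_of_contDiffOn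
  rintro _ _ ⟨i, rfl⟩ ⟨j, rfl⟩
  exact contDiff_id.contDiffOn

attribute [local instance] isManifold_sheets

lemma sheetChart_mem_maximalAtlas (i : I) :
    sheetChart k i ∈ IsManifold.maximalAtlas (𝓡 k) ∞ (I × Euc k) :=
  IsManifold.subset_maximalAtlas ⟨i, rfl⟩

lemma contMDiff_sheet_snd : ContMDiff (𝓡 k) 𝓘(ℝ, Euc k) ∞ (Prod.snd : I × Euc k → Euc k) :=
  fun p => contMDiffAt_of_mem_maximalAtlas' (sheetChart_mem_maximalAtlas p.1)
    ⟨rfl, Set.mem_univ _⟩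

lemma eventuallyEq_sheet {Q : Type*} (F : I → Euc k → Q) (p : I × Euc k) :
    (fun p : I × Euc k => F p.1 p.2) =ᶠ[𝓝 p] F p.1 ∘ Prod.snd := by
  filter_upwards [((isOpen_discrete {p.1}).prod isOpen_univ).mem_nhds
    (⟨rfl, Set.mem_univ _⟩ : p ∈ ({p.1} : Set I) ×ˢ (Set.univ : Set (Euc k)))] with p' hp'
  rw [Function.comp_apply, show p'.1 = p.1 from hp'.1]

lemma contMDiff_sheets {F : I → Euc k → Q} (hF : ∀ i, ContMDiff 𝓘(ℝ, Euc k) (𝓡 r) ∞ (F i)) :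
    ContMDiff (𝓡 k) (𝓡 r) ∞ (fun p : I × Euc k => F p.1 p.2) := fun p =>
  ((hF p.1 _).comp p (contMDiff_sheet_snd p)).congr_of_eventuallyEq (eventuallyEq_sheet F p)

lemma mfderiv_sheets {F : I → Euc k → Q} (hF : ∀ i, ContMDiff 𝓘(ℝ, Euc k) (𝓡 r) ∞ (F i))
    (p : I × Euc k) (v : Euc k) :
    (mfderiv (𝓡 k) (𝓡 r) (fun p : I × Euc k => F p.1 p.2) p v : Euc r) =
      mfderiv 𝓘(ℝ, Euc k) (𝓡 r) (F p.1) p.2 v := by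
  have h1 := mfderiv_comp p ((hF p.1 p.2).mdifferentiableAt (by simp))
    ((contMDiff_sheet_snd p).mdifferentiableAt (by simp))
  rw [← (eventuallyEq_sheet F p).mfderiv_eq] at h1
  have h2 : (mfderiv (𝓡 k) 𝓘(ℝ, Euc k) (Prod.snd : I × Euc k → Euc k) p : Euc k →L[ℝ] Euc k) =
      ContinuousLinearMap.id ℝ (Euc k) :=
    ((contMDiff_sheet_snd p).mdifferentiableAt (by simp)).mfderiv.trans
      (fderivWithin_id (𝓡 k).uniqueDiffWithinAt_image)
  refine (congrArg (fun A : Euc k →L[ℝ] Euc r => A v) h1).trans ?_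
  exact congrArg (mfderiv 𝓘(ℝ, Euc k) (𝓡 r) (F p.1) p.2)
    (congrArg (fun A : Euc k →L[ℝ] Euc k => A v) h2)

end DiscreteUnion

/-! ### Tangent spaces of embedded submanifolds -/

section TangentSpaces

variable {m : ℕ} {E : Type*} [NormedAddCommGroup E] [NormedSpace ℝ E]
  {M : Type*} [TopologicalSpace M] [ChartedSpace (Euc m) M]

/-- Velocities of a map into `S` are tangent to `S`. -/
lemma mfderiv_mem_tangentTo {S : Set M} {g : E → M} {e : E}
    (hg : ContMDiffAt 𝓘(ℝ, E) (𝓡 m) ∞ g e) (hS : ∀ᶠ w in 𝓝 e, g w ∈ S) (v : E) :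
    mfderiv 𝓘(ℝ, E) (𝓡 m) g e v ∈ tangentTo m S (g e) := by
  set l : ℝ → E := fun t => e + t • v with hl
  have hl0 : l 0 = e := by simp [hl]
  have hls : ContDiff ℝ ∞ l := contDiff_const.add (contDiff_id.smul contDiff_const)
  have hld : HasFDerivAt l (ContinuousLinearMap.toSpanSingleton ℝ v) 0 := by
    have h1 : HasDerivAt l ((1 : ℝ) • v) 0 := ((hasDerivAt_id (0 : ℝ)).smul_const v).const_add e
    rw [one_smul] at h1
    exact h1.hasFDerivAt
  have hg' : ContMDiffAt 𝓘(ℝ, E) (𝓡 m) ∞ g (l 0) := by rwa [hl0]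
  have hmem : mfderiv 𝓘(ℝ, E) (𝓡 m) g (l 0) v ∈ tangentTo m S (g (l 0)) := by
    refine Submodule.subset_span ⟨g ∘ l, rfl, hg'.comp 0 hls.contMDiff.contMDiffAt, ?_, ?_⟩
    · rw [← hl0] at hS
      exact hls.continuous.continuousAt.eventually hS
    · have h2 := (hg'.mdifferentiableAt (by simp)).hasMFDerivAt.comp (0 : ℝ) hld.hasMFDerivAt
      have h3 : ∀ A : E →L[ℝ] Euc m, A.comp (ContinuousLinearMap.toSpanSingleton ℝ v) =
        ContinuousLinearMap.toSpanSingleton ℝ (A v) := fun A => A.comp_toSpanSingleton v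
      exact Eq.mp (congrArg (fun A : ℝ →L[ℝ] Euc m => HasMFDerivAt 𝓘(ℝ, ℝ) (𝓡 m) (g ∘ l) 0 A)
        (h3 (mfderiv 𝓘(ℝ, E) (𝓡 m) g (l 0)))) h2
  rwa [hl0] at hmem

/-- For a curve in `S`, the difference quotients in the chart lie in `W`, which is closed, so the
velocity does too. Conversely, `φ.symm` restricted to `W` maps into `S` near the point, and its
differential reaches every `v` whose image is in `W`. -/
lemma mem_tangentTo_iff {S : Set M} {φ : OpenPartialHomeomorph M (Euc m)}
    (hφ : φ ∈ IsManifold.maximalAtlas (𝓡 m) ∞ M) {W : Submodule ℝ (Euc m)}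
    (hW : ∀ y ∈ φ.source, y ∈ S ↔ φ y ∈ W) {x : M} (hx : x ∈ φ.source) (hxS : x ∈ S)
    (v : TangentSpace (𝓡 m) x) :
    v ∈ tangentTo m S x ↔ (mfderiv (𝓡 m) 𝓘(ℝ, Euc m) φ x v : Euc m) ∈ W := by
  constructor
  · intro hv
    have hle : tangentTo m S x ≤
        W.comap (mfderiv (𝓡 m) 𝓘(ℝ, Euc m) φ x).toLinearMap := by
      refine Submodule.span_le.mpr ?_
      rintro v ⟨γ, rfl, hγ, hγS, hγv⟩
      have hd : fderiv ℝ (φ ∘ γ) 0 1 = mfderiv (𝓡 m) 𝓘(ℝ, Euc m) φ (γ 0) v := by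
        rw [fderiv_chart_comp hφ hγv.mdifferentiableAt hx, hγv.mfderiv]
        exact congrArg (mfderiv (𝓡 m) 𝓘(ℝ, Euc m) φ (γ 0)) (one_smul ℝ v)
      have hderiv : HasDerivAt (φ ∘ γ) (fderiv ℝ (φ ∘ γ) 0 1) 0 :=
        ((contDiffAt_chart_comp hφ hγ hx).differentiableAt (by simp)).hasFDerivAt.hasDerivAt
      have hsl := hderiv.tendsto_slope
      have hev : ∀ᶠ t in 𝓝[≠] (0 : ℝ), slope (φ ∘ γ) 0 t ∈ (W : Set (Euc m)) := by
        have h1 : ∀ᶠ t in 𝓝 (0 : ℝ), γ t ∈ φ.source :=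
          hγ.continuousAt.eventually (φ.open_source.eventually_mem hx)
        filter_upwards [nhdsWithin_le_nhds h1, nhdsWithin_le_nhds hγS] with t ht1 ht2
        exact W.smul_mem _ (W.sub_mem ((hW _ ht1).mp ht2) ((hW _ hx).mp hxS))
      have := (Submodule.closed_of_finiteDimensional W).mem_of_tendsto hsl hev
      change mfderiv (𝓡 m) 𝓘(ℝ, Euc m) φ (γ 0) v ∈ (W : Set (Euc m))
      rw [← hd]
      exact this
    exact hle hv
  · intro hv
    obtain ⟨e, he, rfl⟩ : ∃ e ∈ φ.target, φ.symm e = x := ⟨φ x, φ.map_source hx, φ.left_inv hx⟩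
    obtain ⟨T, hT⟩ := exists_mfderiv_chart_eq hφ hx
    have heW : e ∈ W := by
      have := (hW _ hx).mp hxS
      rwa [φ.right_inv he] at this
    set a : W := ⟨e, heW⟩
    set w : W := ⟨_, hv⟩
    set g : W → M := fun b => φ.symm (b : Euc m) with hg
    have hs : ContMDiffAt 𝓘(ℝ, W) (𝓡 m) ∞ g a :=
      ContMDiffAt.comp (g := φ.symm) (f := (Subtype.val : W → Euc m)) a
        (contMDiffAt_symm_of_mem_maximalAtlas hφ he) W.subtypeL.contDiff.contMDiff.contMDiffAt
    have htgt : ∀ᶠ b : W in 𝓝 a, (b : Euc m) ∈ φ.target :=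
      continuous_subtype_val.continuousAt.eventually (φ.open_target.eventually_mem he)
    have hgS : ∀ᶠ b in 𝓝 a, g b ∈ S := by
      filter_upwards [htgt] with b hb
      rw [hW _ (φ.map_target hb), φ.right_inv hb]
      exact b.2
    have hmem := mfderiv_mem_tangentTo hs hgS w
    have heq : φ ∘ g =ᶠ[𝓝 a] W.subtypeL := by
      filter_upwards [htgt] with b hb using φ.right_inv hb
    have hd := fderiv_chart_comp hφ (hs.mdifferentiableAt (by simp)) hx w
    rw [heq.fderiv_eq, ContinuousLinearMap.fderiv] at hd
    have hv' : (mfderiv 𝓘(ℝ, W) (𝓡 m) g a w : Euc m) = v :=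
      T.injective ((hT _).trans (hd.symm.trans (hT v).symm))
    exact hv' ▸ hmem

end TangentSpaces

/-! ### Countable families of Legendrian discs -/

section Discs

variable {k r : ℕ} {Q : Type*} [TopologicalSpace Q] [ChartedSpace (Euc r) Q]
  {ηQ : ∀ q : Q, TangentSpace (𝓡 r) q →L[ℝ] ℝ}

/-- A Legendrian immersion of `ℝ^k`. -/
structure IsLegendrianDisc (ηQ : ∀ q : Q, TangentSpace (𝓡 r) q →L[ℝ] ℝ) (F : Euc k → Q) :
    Prop where
  contMDiff : ContMDiff 𝓘(ℝ, Euc k) (𝓡 r) ∞ F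
  injective : ∀ y, Function.Injective (mfderiv 𝓘(ℝ, Euc k) (𝓡 r) F y)
  eq_contactCompl : ∀ y, LinearMap.range (mfderiv 𝓘(ℝ, Euc k) (𝓡 r) F y).toLinearMap =
    contactCompl ηQ (F y) (LinearMap.range (mfderiv 𝓘(ℝ, Euc k) (𝓡 r) F y).toLinearMap)

/-- The discs may overlap in `Q`, so they are separated in `I × ℝ^k` with `I` discrete; countability
of `I` makes this second countable. -/
lemma isImmersedLegendrian_of_discs [IsManifold (𝓡 r) ∞ Q] (hr : r = 2 * k + 1) {I : Type}
    [Countable I] {F : I → Euc k → Q} (hF : ∀ i, IsLegendrianDisc ηQ (F i)) :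
    IsImmersedLegendrian ηQ (⋃ i, Set.range (F i)) := by
  let _ : TopologicalSpace I := ⊥
  have : DiscreteTopology I := ⟨rfl⟩
  let := sheetChartedSpace k I
  have := isManifold_sheets (k := k) (I := I)
  have hd := mfderiv_sheets fun i => (hF i).contMDiff
  refine ⟨k, I × Euc k, inferInstance, inferInstance, hr, inferInstance, inferInstance,
    inferInstance, fun p => F p.1 p.2, ?_, ?_, fun p => ?_⟩
  · refine Manifold.IsImmersionOfComplement.isImmersion (F := Euc (k + 1)) fun p =>
      isImmersionAtOfComplement_of_injective (contMDiff_sheets fun i => (hF i).contMDiff) ?_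
        (by omega)
    intro u v huv
    exact (hF p.1).injective p.2 ((hd p u).symm.trans (huv.trans (hd p v)))
  · ext q
    simp
  · have : LinearMap.range (mfderiv (𝓡 k) (𝓡 r) (fun p : I × Euc k => F p.1 p.2) p).toLinearMap =
        LinearMap.range (mfderiv 𝓘(ℝ, Euc k) (𝓡 r) (F p.1) p.2).toLinearMap :=
      congrArg LinearMap.range (LinearMap.ext (hd p) :
        (mfderiv (𝓡 k) (𝓡 r) (fun p : I × Euc k => F p.1 p.2) p).toLinearMap =
          ((mfderiv 𝓘(ℝ, Euc k) (𝓡 r) (F p.1) p.2).toLinearMap : Euc k →ₗ[ℝ] Euc r))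
    rw [this]
    exact (hF p.1).eq_contactCompl p.2

/-- A linear slice covered by countably many `k`-dimensional discs has dimension at most `k`. -/
lemma finrank_le_of_subset_discs {I : Type} [Countable I] {F : I → Euc k → Q}
    (hF : ∀ i, ContMDiff 𝓘(ℝ, Euc k) (𝓡 r) ∞ (F i)) {ψ : OpenPartialHomeomorph Q (Euc r)}
    (hψ : ψ ∈ IsManifold.maximalAtlas (𝓡 r) ∞ Q) {W : Submodule ℝ (Euc r)} {a : Euc r}
    (ha : a ∈ ψ.target) (haW : a ∈ W)
    (hW : ∀ e ∈ ψ.target, e ∈ W → ψ.symm e ∈ ⋃ i, Set.range (F i)) :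
    Module.finrank ℝ W ≤ k := by
  set s : Set W := Subtype.val ⁻¹' ψ.target
  have hs : s ∈ 𝓝 (⟨a, haW⟩ : W) :=
    (ψ.open_target.preimage continuous_subtype_val).mem_nhds ha
  -- Hausdorff dimension replaces a rank argument: it equals `finrank W` for the open piece of `W`,
  -- is at most `k` for each locally Lipschitz image of a part of `ℝ^k`, and a countable union takes
  -- the supremum.
  have h1 : dimH (Subtype.val '' s : Set (Euc r)) = Module.finrank ℝ W := by
    rw [isometry_subtype_coe.dimH_image, Real.dimH_of_mem_nhds hs]
  have h2 : (Subtype.val '' s : Set (Euc r)) ⊆ ⋃ i, (ψ ∘ F i) '' (F i ⁻¹' ψ.source) := by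
    rintro _ ⟨e, he, rfl⟩
    obtain ⟨i, y, hy⟩ := Set.mem_iUnion.mp (hW _ he e.2)
    refine Set.mem_iUnion.mpr ⟨i, y, ?_, ?_⟩
    · rw [Set.mem_preimage, hy]
      exact ψ.map_target he
    · rw [Function.comp_apply, hy]
      exact ψ.right_inv he
  have h3 : ∀ i, dimH ((ψ ∘ F i) '' (F i ⁻¹' ψ.source)) ≤ k := fun i => by
    have h4 : dimH ((ψ ∘ F i) '' (F i ⁻¹' ψ.source)) ≤ dimH (F i ⁻¹' ψ.source) := by
      refine dimH_image_le_of_locally_lipschitzOn fun y hy => ?_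
      obtain ⟨C, t, ht, hC⟩ := ((contDiffAt_chart_comp hψ (hF i y) hy).of_le
        (by simp : (1 : WithTop ℕ∞) ≤ ∞)).exists_lipschitzOnWith
      exact ⟨C, t, mem_nhdsWithin_of_mem_nhds ht, hC⟩
    refine h4.trans ((dimH_mono (Set.subset_univ _)).trans ?_)
    rw [Real.dimH_of_mem_nhds (E := Euc k) (x := 0) Filter.univ_mem]
    simp
  have h5 : (Module.finrank ℝ W : ENNReal) ≤ k := by
    rw [← h1]
    refine (dimH_mono h2).trans ?_
    rw [dimH_iUnion]
    exact iSup_le h3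
  exact_mod_cast h5

lemma finrank_tangentTo {S : Set Q} {ψ : OpenPartialHomeomorph Q (Euc r)}
    (hψ : ψ ∈ IsManifold.maximalAtlas (𝓡 r) ∞ Q) {W : Submodule ℝ (Euc r)}
    (hW : ∀ y ∈ ψ.source, y ∈ S ↔ ψ y ∈ W) {q : Q} (hq : q ∈ ψ.source) (hqS : q ∈ S) :
    Module.finrank ℝ (tangentTo r S q) ≤ Module.finrank ℝ W := by
  obtain ⟨T, hT⟩ := exists_mfderiv_chart_eq hψ hq
  set A : tangentTo r S q →ₗ[ℝ] W :=
    ((mfderiv (𝓡 r) 𝓘(ℝ, Euc r) ψ q).toLinearMap : TangentSpace (𝓡 r) q →ₗ[ℝ] Euc r).restrict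
      fun v hv => (mem_tangentTo_iff hψ hW hq hqS v).mp hv
  refine LinearMap.finrank_le_finrank_of_injective (f := A) fun u v huv => Subtype.ext ?_
  have h1 : mfderiv (𝓡 r) 𝓘(ℝ, Euc r) ψ q u = mfderiv (𝓡 r) 𝓘(ℝ, Euc r) ψ q v :=
    congrArg Subtype.val huv
  exact T.injective ((hT _).trans (h1.trans (hT _).symm))

/-- A disc through `q` gives a `k`-dimensional subspace of the tangent space, and the covering by
countably many discs bounds the whole tangent space by `k`. So the two agree, and the complement
condition passes from the disc. -/
lemma isLegendrian_of_discs {I : Type} [Countable I] {F : I → Euc k → Q}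
    (hF : ∀ i, IsLegendrianDisc ηQ (F i)) (hS : IsSubmanifold r (⋃ i, Set.range (F i))) :
    IsLegendrian ηQ (⋃ i, Set.range (F i)) := by
  refine ⟨hS, fun q hq => ?_⟩
  obtain ⟨ψ, hψ, hqψ, W, hW⟩ := hS q hq
  have hdim : Module.finrank ℝ W ≤ k :=
    finrank_le_of_subset_discs (fun i => (hF i).contMDiff) hψ (ψ.map_source hqψ)
      ((hW q hqψ).mp hq) fun e he heW =>
        (hW _ (ψ.map_target he)).mpr (by rwa [ψ.right_inv he])
  have hdim' := (finrank_tangentTo hψ hW hqψ hq).trans hdim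
  obtain ⟨i, y, rfl⟩ := Set.mem_iUnion.mp hq
  have hle : LinearMap.range (mfderiv 𝓘(ℝ, Euc k) (𝓡 r) (F i) y).toLinearMap ≤
      tangentTo r (⋃ i, Set.range (F i)) (F i y) := by
    rintro _ ⟨v, rfl⟩
    exact mfderiv_mem_tangentTo ((hF i).contMDiff y)
      (Filter.Eventually.of_forall fun w => Set.mem_iUnion_of_mem i (Set.mem_range_self w)) v
  have hrank : Module.finrank ℝ
      (LinearMap.range (mfderiv 𝓘(ℝ, Euc k) (𝓡 r) (F i) y).toLinearMap) = k := by
    rw [LinearMap.finrank_range_of_inj ((hF i).injective y)]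
    exact finrank_euclideanSpace_fin
  have heq := Submodule.eq_of_le_of_finrank_le hle (hdim'.trans hrank.ge)
  rw [← heq]
  exact (hF i).eq_contactCompl y

end Discs

/-! ### Parametrizing a clean intersection -/

section CleanIntersections

variable {m d r : ℕ}
  {M : Type*} [TopologicalSpace M] [ChartedSpace (Euc m) M]
  {N : Type*} [TopologicalSpace N] [ChartedSpace (Euc d) N]
  {Q : Type*} [TopologicalSpace Q] [ChartedSpace (Euc r) Q]
  {η : ∀ x : M, TangentSpace (𝓡 m) x →L[ℝ] ℝ} {ι : N → M} {π : N → Q} {L : Set M}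

/-- A clean intersection `N ∩ L` is locally parametrized, as a subset of `N`, by a map whose
differential has as its range the vectors tangent to `L`. -/
lemma CleanIntersection.exists_param [IsManifold (𝓡 d) ∞ N] [IsManifold (𝓡 m) ∞ M]
    (hι : Manifold.IsSmoothEmbedding (𝓡 d) (𝓡 m) ∞ ι)
    (hNL : CleanIntersection m (d := d) ι L) {x : N} (hx : ι x ∈ L) :
    ∃ (W : Submodule ℝ (Euc m)) (g : W → N) (U : Set W) (w₀ : W), IsOpen U ∧ w₀ ∈ U ∧
      (∀ w ∈ U, ContMDiffAt 𝓘(ℝ, W) (𝓡 d) ∞ g w) ∧ (∀ w ∈ U, ι (g w) ∈ L) ∧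
      (∀ w ∈ U, LinearMap.range (mfderiv 𝓘(ℝ, W) (𝓡 d) g w).toLinearMap =
        (tangentTo m L (ι (g w))).comap (mfderiv (𝓡 d) (𝓡 m) ι (g w)).toLinearMap) ∧
      ∀ O ⊆ U, IsOpen O → w₀ ∈ O → ∃ V, IsOpen V ∧ x ∈ V ∧ V ∩ ι ⁻¹' L = g '' O := by
  obtain ⟨φ, hφ, hxφ, W, hW⟩ := hNL.1 (ι x) ⟨⟨x, rfl⟩, hx⟩
  set U : Set W := Subtype.val ⁻¹' φ.target with hUdef
  have hU : IsOpen U := φ.open_target.preimage continuous_subtype_val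
  have hmem : ∀ w : W, w ∈ U → φ.symm w ∈ Set.range ι ∩ L := fun w hw => by
    rw [hW _ (φ.map_target hw), φ.right_inv hw]
    exact w.2
  -- `g` is `ι⁻¹ ∘ φ.symm` on `U`; the value `x` elsewhere is never used.
  have hex : ∀ w : W, ∃ n : N, w ∈ U → ι n = φ.symm w := fun w => by
    by_cases hw : w ∈ U
    · obtain ⟨n, hn⟩ := (hmem w hw).1
      exact ⟨n, fun _ => hn⟩
    · exact ⟨x, fun h => absurd h hw⟩
  choose g hg using hex
  have hev : ∀ w ∈ U, ι ∘ g =ᶠ[𝓝 w] φ.symm ∘ Subtype.val := fun w hw => by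
    filter_upwards [hU.mem_nhds hw] with w' hw' using hg w' hw'
  have hιg : ∀ w ∈ U, ContMDiffAt 𝓘(ℝ, W) (𝓡 m) ∞ (ι ∘ g) w := fun w hw =>
    (ContMDiffAt.comp (g := φ.symm) (f := (Subtype.val : W → Euc m)) w
      (contMDiffAt_symm_of_mem_maximalAtlas hφ hw)
      W.subtypeL.contDiff.contMDiff.contMDiffAt).congr_of_eventuallyEq (hev w hw)
  -- Smoothness into `N` follows from that of `ι ∘ g`: the embedding `ι` detects continuity, and the
  -- immersion `ι` then detects smoothness.
  have hgs : ∀ w ∈ U, ContMDiffAt 𝓘(ℝ, W) (𝓡 d) ∞ g w := fun w hw =>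
    (ContMDiffAt.iff_comp_isImmersionAt (hι.isImmersion.isImmersionAt (g w))).mpr
      ⟨hι.isEmbedding.isInducing.continuousAt_iff.mpr (hιg w hw).continuousAt, hιg w hw⟩
  have hgφ : ∀ w ∈ U, ι (g w) ∈ φ.source := fun w hw => by
    rw [hg w hw]; exact φ.map_target hw
  have hgS : ∀ w ∈ U, ι (g w) ∈ Set.range ι ∩ L := fun w hw => by
    rw [hg w hw]; exact hmem w hw
  have hd : ∀ w ∈ U, ∀ v : W, (mfderiv (𝓡 m) 𝓘(ℝ, Euc m) φ (ι (g w))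
      (mfderiv (𝓡 d) (𝓡 m) ι (g w) (mfderiv 𝓘(ℝ, W) (𝓡 d) g w v)) : Euc m) = W.subtype v := by
    intro w hw v
    have h1 : φ ∘ (ι ∘ g) =ᶠ[𝓝 w] W.subtypeL := by
      filter_upwards [hU.mem_nhds hw] with w' hw'
      simp only [Function.comp_apply, hg w' hw']
      exact φ.right_inv hw'
    have h2 := fderiv_chart_comp hφ ((hιg w hw).mdifferentiableAt (by simp)) (hgφ w hw) v
    rw [h1.fderiv_eq, ContinuousLinearMap.fderiv] at h2
    have h3 : (mfderiv 𝓘(ℝ, W) (𝓡 m) (ι ∘ g) w v : Euc m) =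
        mfderiv (𝓡 d) (𝓡 m) ι (g w) (mfderiv 𝓘(ℝ, W) (𝓡 d) g w v) :=
      mfderiv_comp_param hι.contMDiff.contMDiffAt (hgs w hw) v
    exact (congrArg (mfderiv (𝓡 m) 𝓘(ℝ, Euc m) φ (ι (g w))) h3.symm).trans h2.symm
  refine ⟨W, g, U, ⟨φ (ι x), (hW _ hxφ).mp ⟨⟨x, rfl⟩, hx⟩⟩, hU, φ.map_source hxφ, hgs,
    fun w hw => (hgS w hw).2, fun w hw => ?_, fun O hOU hO hxO => ?_⟩
  · have hclean := hNL.2 (g w) (hgS w hw).2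
    have hiff : ∀ u : TangentSpace (𝓡 d) (g w),
        mfderiv (𝓡 d) (𝓡 m) ι (g w) u ∈ tangentTo m L (ι (g w)) ↔
        (mfderiv (𝓡 m) 𝓘(ℝ, Euc m) φ (ι (g w)) (mfderiv (𝓡 d) (𝓡 m) ι (g w) u) : Euc m) ∈ W := by
      intro u
      rw [← mem_tangentTo_iff hφ hW (hgφ w hw) (hgS w hw), hclean]
      exact ⟨fun h => ⟨⟨u, rfl⟩, h⟩, fun h => h.2⟩
    apply le_antisymm
    · rintro _ ⟨v, rfl⟩
      exact (hiff _).mpr ((congrArg (· ∈ W) (hd w hw v)).mpr (Subtype.property (v : W)))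
    · intro u hu
      have hu' := (hiff u).mp hu
      refine ⟨(⟨_, hu'⟩ : W), ?_⟩
      obtain ⟨T, hT⟩ := exists_mfderiv_chart_eq hφ (hgφ w hw)
      apply mfderiv_injective_of_isImmersionAt (hι.isImmersion.isImmersionAt (g w))
      exact T.injective ((hT _).trans ((hd w hw ⟨_, hu'⟩).trans (hT _).symm))
  · obtain ⟨O', hO', rfl⟩ := isOpen_induced_iff.mp hO
    refine ⟨ι ⁻¹' (φ.source ∩ φ ⁻¹' O'),
      (φ.isOpen_inter_preimage hO').preimage hι.contMDiff.continuous, ⟨hxφ, hxO⟩, ?_⟩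
    ext n
    constructor
    · rintro ⟨⟨hn1, hn2⟩, hnL⟩
      refine ⟨⟨φ (ι n), (hW _ hn1).mp ⟨⟨n, rfl⟩, hnL⟩⟩, hn2, hι.isEmbedding.injective ?_⟩
      rw [hg _ (φ.map_source hn1)]
      exact φ.left_inv hn1
    · rintro ⟨w, hw, rfl⟩
      refine ⟨⟨hgφ w (hOU hw), ?_⟩, (hgS w (hOU hw)).2⟩
      rw [Set.mem_preimage, hg w (hOU hw), φ.right_inv (hOU hw)]
      exact hw

end CleanIntersections

/-! ### The projection of `N ∩ L` -/

section ReducedLegendrian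

variable {k m d r : ℕ}
  {M : Type*} [TopologicalSpace M] [ChartedSpace (Euc m) M] [IsManifold (𝓡 m) ∞ M]
  {N : Type*} [TopologicalSpace N] [ChartedSpace (Euc d) N] [IsManifold (𝓡 d) ∞ N]
  {Q : Type*} [TopologicalSpace Q] [ChartedSpace (Euc r) Q] [IsManifold (𝓡 r) ∞ Q]
  {η : ∀ x : M, TangentSpace (𝓡 m) x →L[ℝ] ℝ} {ι : N → M} {π : N → Q} {L : Set M}
  {f : N → ℝ} {ηQ : ∀ q : Q, TangentSpace (𝓡 r) q →L[ℝ] ℝ}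

namespace IsContactReduction

/-- Near each of its points, `N ∩ L` projects onto a Legendrian disc. -/
lemma exists_legendrianDisc (h : IsContactReduction (d := d) (r := r) η ι π)
    (hQ : IsReducedForm (d := d) η ι π f ηQ) (hL : IsLegendrian η L)
    (hNL : CleanIntersection m (d := d) ι L) (hr : r = 2 * k + 1) {x : N} (hx : ι x ∈ L) :
    ∃ (V : Set N) (F : Euc k → Q), IsOpen V ∧ x ∈ V ∧ Set.range F = π '' (V ∩ ι ⁻¹' L) ∧
      IsLegendrianDisc ηQ F := by
  obtain ⟨W, g, U, w₀, hU, hw₀, hgs, hgL, hgr, hV⟩ := hNL.exists_param h.coisotropic.1 hx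
  set G : W → Q := π ∘ g with hGdef
  have hG : ∀ w ∈ U, ContMDiffAt 𝓘(ℝ, W) (𝓡 r) ∞ G w := fun w hw =>
    (h.contMDiff_projection _).comp w (hgs w hw)
  have hGr : ∀ w ∈ U, LinearMap.range (mfderiv 𝓘(ℝ, W) (𝓡 r) G w).toLinearMap =
      ((tangentTo m L (ι (g w))).comap (mfderiv (𝓡 d) (𝓡 m) ι (g w)).toLinearMap).map
        (mfderiv (𝓡 d) (𝓡 r) π (g w)).toLinearMap := fun w hw => by
    rw [← hgr w hw, ← LinearMap.range_comp, hGdef,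
      mfderiv_comp w ((h.contMDiff_projection _).mdifferentiableAt (by simp))
        ((hgs w hw).mdifferentiableAt (by simp))]
    rfl
  have hGc : ∀ w ∈ U, LinearMap.range (mfderiv 𝓘(ℝ, W) (𝓡 r) G w).toLinearMap =
      contactCompl ηQ (G w) (LinearMap.range (mfderiv 𝓘(ℝ, W) (𝓡 r) G w).toLinearMap) :=
    fun w hw => by
      rw [hGr w hw]
      exact (h.isLinearReduction hQ (g w)).map_comap_eq_complement (hL.2 _ (hgL w hw))
  -- Constancy of the rank comes from the contact structure: a subspace equal to its complement in
  -- dimension `2 k + 1` has dimension `k`.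
  have hGk : ∀ w ∈ U, Module.finrank ℝ
      (LinearMap.range (mfderiv 𝓘(ℝ, W) (𝓡 r) G w).toLinearMap) = k := fun w hw => by
    have h1 := (h.isContactPair_reduced hQ (G w)).finrank_of_eq_complement (hGc w hw)
    rw [finrank_tangentSpace] at h1
    omega
  set ψ := chartAt (Euc r) (G w₀)
  have hψ : ψ ∈ IsManifold.maximalAtlas (𝓡 r) ∞ Q := IsManifold.chart_mem_maximalAtlas (G w₀)
  set U' := U ∩ G ⁻¹' ψ.source
  have hU' : IsOpen U' := ContinuousOn.isOpen_inter_preimage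
    (fun w hw => (hG w hw).continuousAt.continuousWithinAt) hU ψ.open_source
  have hrank : ∀ w ∈ U', Module.finrank ℝ
      (LinearMap.range (fderiv ℝ (ψ ∘ G) w).toLinearMap) = k := fun w hw => by
    obtain ⟨T, hT⟩ := exists_mfderiv_chart_eq hψ hw.2
    obtain ⟨A, hA, hAk⟩ : ∃ A : W →ₗ[ℝ] Euc r, (∀ v, A v = mfderiv 𝓘(ℝ, W) (𝓡 r) G w v) ∧
        Module.finrank ℝ (LinearMap.range A) = k :=
      ⟨(mfderiv 𝓘(ℝ, W) (𝓡 r) G w).toLinearMap, fun _ => rfl, hGk w hw.1⟩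
    have h1 : (fderiv ℝ (ψ ∘ G) w).toLinearMap = T.toLinearEquiv.toLinearMap ∘ₗ A :=
      LinearMap.ext fun v => (fderiv_chart_comp hψ ((hG w hw.1).mdifferentiableAt (by simp))
        hw.2 v).trans ((congrArg _ (hA v).symm).trans (hT _).symm)
    rw [h1, LinearMap.range_comp, LinearEquiv.finrank_map_eq, hAk]
  obtain ⟨O, s, hO, hw₀O, hOU, hs, hsO, hrange, hinj⟩ :=
    exists_transversal_of_constant_rank hU'
      (fun w hw => (contDiffAt_chart_comp hψ (hG w hw.1) hw.2).contDiffWithinAt) hrank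
      (⟨hw₀, mem_chart_source _ _⟩ : w₀ ∈ U')
  obtain ⟨V, hVo, hxV, hVL⟩ := hV O (fun w hw => (hOU hw).1) hO hw₀O
  have hF : ContMDiff 𝓘(ℝ, Euc k) (𝓡 r) ∞ (G ∘ s) := fun y =>
    (hG _ (hOU (hsO y)).1).comp y hs.contMDiff.contMDiffAt
  have hFinj : ∀ y, Function.Injective (mfderiv 𝓘(ℝ, Euc k) (𝓡 r) (G ∘ s) y) := by
    intro y u v huv
    have h1 := fderiv_chart_comp hψ ((hF y).mdifferentiableAt (by simp)) (hOU (hsO y)).2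
    exact hinj y ((h1 u).trans ((congrArg (mfderiv (𝓡 r) 𝓘(ℝ, Euc r) ψ (G (s y))) huv).trans
      (h1 v).symm))
  refine ⟨V, G ∘ s, hVo, hxV, ?_, hF, hFinj, fun y => ?_⟩
  · rw [hVL, ← Set.image_comp]
    apply Set.Subset.antisymm
    · rintro _ ⟨y, rfl⟩
      exact ⟨s y, hsO y, rfl⟩
    · rintro _ ⟨w, hw, rfl⟩
      obtain ⟨y, hy⟩ : (ψ ∘ G) w ∈ Set.range ((ψ ∘ G) ∘ s) := by
        rw [hrange]; exact ⟨w, hw, rfl⟩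
      exact ⟨y, ψ.injOn (hOU (hsO y)).2 (hOU hw).2 hy⟩
  · have hw := (hOU (hsO y)).1
    -- The disc is a restriction of `G` with injective differential, so its `k`-dimensional range
    -- fills the range of `dG`, whose complement is known.
    have hle : LinearMap.range (mfderiv 𝓘(ℝ, Euc k) (𝓡 r) (G ∘ s) y).toLinearMap ≤
        LinearMap.range (mfderiv 𝓘(ℝ, W) (𝓡 r) G (s y)).toLinearMap := by
      rw [mfderiv_comp y ((hG _ hw).mdifferentiableAt (by simp))
        (hs.contMDiff.contMDiffAt.mdifferentiableAt (by simp))]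
      exact LinearMap.range_comp_le_range _ _
    have heq := Submodule.eq_of_le_of_finrank_le hle (by
      rw [LinearMap.finrank_range_of_inj (hFinj y)]
      exact ((hGk _ hw).trans finrank_euclideanSpace_fin.symm).le)
    rw [heq]
    exact hGc _ hw

/-- The projection of `N ∩ L` is covered by countably many Legendrian discs. -/
lemma exists_legendrianDiscs [SecondCountableTopology M]
    (h : IsContactReduction (d := d) (r := r) η ι π)
    (hQ : IsReducedForm (d := d) η ι π f ηQ) (hL : IsLegendrian η L)
    (hNL : CleanIntersection m (d := d) ι L) (hr : r = 2 * k + 1) :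
    ∃ (I : Type) (_ : Countable I) (F : I → Euc k → Q),
      (∀ i, IsLegendrianDisc ηQ (F i)) ∧ ⋃ i, Set.range (F i) = π '' (ι ⁻¹' L) := by
  have : SecondCountableTopology N := h.coisotropic.1.isEmbedding.secondCountableTopology
  choose V F hVo hxV hrange hF using fun x : ι ⁻¹' L =>
    h.exists_legendrianDisc hQ hL hNL hr (x := x) x.2
  obtain ⟨t, ht, hcover⟩ := TopologicalSpace.isOpen_iUnion_countable V hVo
  have : Countable t := ht.to_subtype
  -- The countable index set is moved to `Type`, the universe required of the domain of the
  -- immersion.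
  have hI : Countable (Shrink.{0} t) := (equivShrink.{0} t).symm.injective.countable
  refine ⟨Shrink.{0} t, hI, fun i => F ((equivShrink.{0} t).symm i), fun i => hF _, ?_⟩
  apply Set.Subset.antisymm
  · refine Set.iUnion_subset fun i => ?_
    rw [hrange]
    exact Set.image_mono Set.inter_subset_right
  · rintro _ ⟨x, hx, rfl⟩
    have hx' : x ∈ ⋃ i ∈ t, V i := by
      rw [hcover]
      exact Set.mem_iUnion_of_mem ⟨x, hx⟩ (hxV ⟨x, hx⟩)
    obtain ⟨i, hi, hxi⟩ := Set.mem_iUnion₂.mp hx'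
    refine Set.mem_iUnion_of_mem (equivShrink.{0} t ⟨i, hi⟩) ?_
    simp only [Equiv.symm_apply_apply, hrange]
    exact ⟨x, ⟨hxi, hx⟩, rfl⟩

end IsContactReduction

end ReducedLegendrian

end ContactReduction

end

theorem mainTheorem4 {m d r : ℕ}
    {M : Type*} [TopologicalSpace M] [T2Space M] [SecondCountableTopology M]
    [ChartedSpace (ContactReduction.Euc m) M] [IsManifold (𝓡 m) ∞ M]
    {N : Type*} [TopologicalSpace N] [Nonempty N]
    [ChartedSpace (ContactReduction.Euc d) N] [IsManifold (𝓡 d) ∞ N]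
    {Q : Type*} [TopologicalSpace Q] [T2Space Q] [SecondCountableTopology Q]
    [ChartedSpace (ContactReduction.Euc r) Q] [IsManifold (𝓡 r) ∞ Q]
    (η : ∀ x : M, TangentSpace (𝓡 m) x →L[ℝ] ℝ)
    (hη : ContactReduction.IsContactForm η)
    (ι : N → M) (hN : ContactReduction.IsCoisotropic (d := d) η ι)
    (hhor : ∀ x : N, ¬ ContactReduction.IsHorizontal η (ι x)
      (ContactReduction.tangentOf (d := d) ι x))
    (π : N → Q)
    (hπ : ContactReduction.IsLeafQuotient (d := d) (r := r)
      (ContactReduction.charDistribution η ι) π)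
    (L : Set M) (hL : ContactReduction.IsLegendrian η L)
    (hNL : ContactReduction.CleanIntersection m (d := d) ι L) :
    (∃ (f : N → ℝ) (ηQ : ∀ q : Q, TangentSpace (𝓡 r) q →L[ℝ] ℝ),
      ContactReduction.IsReducedForm (d := d) η ι π f ηQ) ∧
    ((∀ x : N, ContactReduction.IsVertical η (ι x) (ContactReduction.tangentOf (d := d) ι x)) →
      ∃! ηQ : ∀ q : Q, TangentSpace (𝓡 r) q →L[ℝ] ℝ,
        ContactReduction.IsReducedForm (d := d) η ι π (fun _ => 1) ηQ) ∧
    ∀ (f : N → ℝ) (ηQ : ∀ q : Q, TangentSpace (𝓡 r) q →L[ℝ] ℝ),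
      ContactReduction.IsReducedForm (d := d) η ι π f ηQ →
        ContactReduction.IsContactForm ηQ ∧
        ContactReduction.IsImmersedLegendrian ηQ (π '' (ι ⁻¹' L)) ∧
        (ContactReduction.IsSubmanifold r (π '' (ι ⁻¹' L)) →
          ContactReduction.IsLegendrian ηQ (π '' (ι ⁻¹' L))) := by
  have h : ContactReduction.IsContactReduction (d := d) (r := r) η ι π := ⟨hη, hN, hhor, hπ⟩
  refine ⟨h.exists_reduced, h.existsUnique_reduced_of_isVertical, fun f ηQ hQ => ?_⟩
  have hc := h.isContactForm_reduced hQ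
  -- The contact condition on the quotient supplies the dimension `k` of the discs.
  obtain ⟨-, k, hr, -⟩ := id hc
  obtain ⟨I, _, F, hF, hrange⟩ := h.exists_legendrianDiscs hQ hL hNL hr
  rw [← hrange]
  exact ⟨hc, ContactReduction.isImmersedLegendrian_of_discs hr hF,
    ContactReduction.isLegendrian_of_discs hF⟩
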